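/- For integers $n,N\ge 1$ let $M_N$ be the space of complex $N\times N$ matrices, $U(N)\subset M_N$ the unitary group, $\tau_N=N^{-1}\mathrm{tr}$ and $\|\xi\|_{L_2(\tau_N)}=\tau_N(\xi^*\xi)^{1/2}$. For $x=(x_j),y=(y_j)\in M_N^n$ let $\|\sum_j x_j\otimes\bar y_j\|$ be the operator norm on $\ell_2^N\otimes\ell_2^N$, where $\bar y_j$ is the entrywise complex conjugate of $y_j$. For $\delta>0$, $x$ and $y$ are called $\delta$-separated if $$\Big\|\sum_j x_j\otimes\bar y_j\Big\|\le(1-\delta)\Big\|\sum_j x_j\otimes\bar x_j\Big\|^{1/2}\Big\|\sum_j y_j\otimes\bar y_j\Big\|^{1/2},$$ and a subset of $M_N^n$ is $\delta$-separated if any two distinct members are. For $0<\varepsilon<1$ let $S_\varepsilon=S_\varepsilon(n,N)$ be the set of all $u=(u_j)\in U(N)^n$ such that $$\Big\|\sum_j u_j\xi u_j^*\Big\|_{L_2(\tau_N)}\le\varepsilon n\,\|\xi\|_{L_2(\tau_N)}\quad\text{for all }\xi\in M_N\text{ with }\mathrm{tr}\,\xi=0$$ (quantum expanders with spectral gap $1-\varepsilon$).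 **Theorem.** (i) For every $0<\delta<1$ there is a constant $\beta_\delta>0$ such that for every $0<\varepsilon<1$ there is $n_0=n_0(\varepsilon,\delta)$ such that for all $n\ge n_0$ and all $N\ge1$ there is a finite $\delta$-separated subset $T\subset S_\varepsilon(n,N)$ with $$|T|\ge\exp(\beta_\delta nN^2).$$ (ii) This is optimal up to the constant in the exponent: for all $0<\delta<1$ and $n,N\ge1$, every $\delta$-separated subset $T\subset U(N)^n$ is finite, and $$|T|\le\big(1+\sqrt{2/\delta}\big)^{2nN^2}\le\exp\big(2\sqrt{2/\delta}\;nN^2\big).$$ -/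

import Mathlib

open scoped Kronecker Matrix

noncomputable section

namespace QExp

/-- `n`-tuples of complex `N × N` matrices. -/
abbrev Tuple (n N : ℕ) : Type := Fin n → Matrix (Fin N) (Fin N) ℂ

/-- The set `U(N)^n` of `n`-tuples of unitary `N × N` matrices. -/
def unitaryTuples (n N : ℕ) : Set (Tuple n N) :=
  {u | ∀ j, u j ∈ Matrix.unitaryGroup (Fin N) ℂ}

/-- The operator norm of `∑ j, x j ⊗ conj (y j)` on the Hilbert space `ℓ₂^N ⊗ ℓ₂^N`, where
`conj` is the entrywise complex conjugate. -/
def tensorNorm {n N : ℕ} (x y : Tuple n N) : ℝ :=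
  ‖Matrix.toEuclideanCLM (n := Fin N × Fin N) (𝕜 := ℂ) (∑ j, x j ⊗ₖ (y j).map star)‖

/-- `x` and `y` are `δ`-separated. -/
def Separated {n N : ℕ} (δ : ℝ) (x y : Tuple n N) : Prop :=
  tensorNorm x y ≤ (1 - δ) * (Real.sqrt (tensorNorm x x) * Real.sqrt (tensorNorm y y))

/-- A set of tuples is `δ`-separated if any two distinct members are `δ`-separated. -/
def SeparatedFamily {n N : ℕ} (δ : ℝ) (T : Set (Tuple n N)) : Prop :=
  T.Pairwise (Separated δ)

/-- The norm of `L₂(τ_N)`: `‖ξ‖ = (N⁻¹ tr (ξ* ξ))^{1/2}`. -/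
def hNorm {N : ℕ} (ξ : Matrix (Fin N) (Fin N) ℂ) : ℝ :=
  Real.sqrt ((N : ℝ)⁻¹ * (ξᴴ * ξ).trace.re)

/-- The set `S_ε(n, N)` of all `u ∈ U(N)^n` such that `ξ ↦ ∑ j, u j * ξ * (u j)*` has norm at
most `ε n` on the orthogonal complement (the matrices of trace zero) of the identity. -/
def expanders (ε : ℝ) (n N : ℕ) : Set (Tuple n N) :=
  {u | u ∈ unitaryTuples n N ∧ ∀ ξ : Matrix (Fin N) (Fin N) ℂ, ξ.trace = 0 →
    hNorm (∑ j, u j * ξ * (u j)ᴴ) ≤ ε * n * hNorm ξ}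

end QExp

end

/-! Under the Hilbert–Schmidt identification of `ℓ₂^N ⊗ ℓ₂^N` with the `N × N` matrices,
`tensorNorm u v` is the norm of `ξ ↦ ∑ u j * ξ * (v j)ᴴ`, which is `n` if `u = v` is unitary.

*Lower bound.* Let `T` be a maximal `δ`-separated set of expanders and `u ∉ T` an expander. Then `u`
is not separated from some `v ∈ T`: the pairing `Re ∑ tr (u j * ξ * (v j)ᴴ * η)` is large for some
`ξ`, `η` in the Hilbert–Schmidt unit ball. The singular values of `ξ` above `κ ∼ N ^ (-1 / 2)` make
up a matrix of small trace norm, whose contribution is negligible by the spectral gap of `u` and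
`v`; hence `ξ` may be taken of operator norm at most `κ`. For Haar distributed `u` and fixed `ξ` and
`η` the pairing is then subgaussian, hence large with probability at most `exp (-c * n * N ^ 2)`,
and a net of `exp (C * N ^ 2)` pairs takes care of all `ξ` and `η`. As Haar distributed tuples are
expanders with probability at least `1 / 2` once `√n ≥ C / ε`, a union bound over `v ∈ T` bounds the
cardinality of `T` from below.

Both facts on Haar distributed tuples `u` are deduced from Gaussian ones: if `Y` is Gaussian, then
so is `u j * |Y j|`, and by Jensen's inequality one may average over `|Y j|` alone, which replaces
`|Y j|` by a multiple of the identity in linear expressions and by a unitarily equivariant map in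
quadratic ones. For Gaussian tuples a rotation decouples the two factors of the tensor, and the
decoupled norm is bounded by moments of order `∼ N`. As products of Gaussian variables have
nonnegative expectations, identifying all the matrices occurring in a word increases the moments,
and a single Gaussian matrix remains.

*Upper bound.* Testing `∑ u j ⊗ conj (v j)` on the identity matrix bounds the distance of separated
unitary tuples from below, and volume packing in real dimension `2 * n * N ^ 2` does the rest.
-/

noncomputable section

namespace QExp

open MeasureTheory Complex ComplexConjugate Module Metric

section Packing

variable {E : Type*} [NormedAddCommGroup E] [NormedSpace ℝ E] [FiniteDimensional ℝ E]

lemma card_le_of_separated_of_norm_le (s : Finset E) {R θ : ℝ} (hR : 0 ≤ R) (hθ : 0 < θ)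
    (hs : ∀ x ∈ s, ‖x‖ ≤ R) (hsep : (s : Set E).Pairwise fun x y => θ ≤ ‖x - y‖) :
    (s.card : ℝ) ≤ (1 + 2 * R / θ) ^ finrank ℝ E := by
  borelize E
  let μ : Measure E := Measure.addHaar
  have hunit : 0 < μ.real (ball 0 1) :=
    ENNReal.toReal_pos (measure_ball_pos _ _ one_pos).ne' measure_ball_lt_top.ne
  have hball (x : E) {r : ℝ} (hr : 0 < r) :
      μ.real (ball x r) = r ^ finrank ℝ E * μ.real (ball 0 1) := by
    rw [measureReal_def, μ.addHaar_ball_of_pos x hr, ENNReal.toReal_mul,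
      ENNReal.toReal_ofReal (by positivity), measureReal_def]
  have hdisj : (s : Set E).PairwiseDisjoint fun x => ball x (θ / 2) := fun x hx y hy hxy =>
    ball_disjoint_ball (by rw [dist_eq_norm, add_halves]; exact hsep hx hy hxy)
  have hsub : ⋃ x ∈ s, ball x (θ / 2) ⊆ ball 0 (R + θ / 2) := by
    refine Set.iUnion₂_subset fun x hx => ball_subset_ball' ?_
    rw [dist_zero_right]
    linarith [hs x hx]
  have hvol := measureReal_mono (μ := μ) hsub measure_ball_lt_top.ne
  rw [measureReal_biUnion_finset hdisj (fun _ _ => measurableSet_ball)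
    (fun _ _ => measure_ball_lt_top.ne), Finset.sum_congr rfl fun x _ => hball x (half_pos hθ),
    Finset.sum_const, nsmul_eq_mul, hball 0 (show 0 < R + θ / 2 by positivity),
    ← mul_assoc, mul_le_mul_iff_left₀ hunit, ← le_div_iff₀ (by positivity), ← div_pow] at hvol
  rwa [show (R + θ / 2) / (θ / 2) = 1 + 2 * R / θ by field_simp; ring] at hvol

lemma exists_maximal_pairwise {α : Type*} {r : α → α → Prop} [Std.Symm r] {A : Set α}
    {B : ℕ} (hB : ∀ t : Finset α, (t : Set α) ⊆ A → (t : Set α).Pairwise r → t.card ≤ B) :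
    ∃ t : Finset α, (t : Set α) ⊆ A ∧ (t : Set α).Pairwise r ∧
      ∀ x ∈ A, x ∉ t → ∃ y ∈ t, ¬r x y := by
  classical
  let cards : Set ℕ := Finset.card '' {t : Finset α | (t : Set α) ⊆ A ∧ (t : Set α).Pairwise r}
  have hbdd : BddAbove cards := ⟨B, by rintro _ ⟨t, ⟨htA, htr⟩, rfl⟩; exact hB t htA htr⟩
  obtain ⟨t, ⟨htA, htr⟩, htcard⟩ := Nat.sSup_mem (s := cards) ⟨0, ∅, by simp, rfl⟩ hbdd
  refine ⟨t, htA, htr, fun x hx hxt => ?_⟩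
  by_contra! hsep
  have hinsert : (insert x t).card ∈ cards := by
    refine ⟨insert x t, ⟨?_, ?_⟩, rfl⟩ <;> rw [Finset.coe_insert]
    · exact Set.insert_subset hx htA
    · exact htr.insert_of_symm fun y hy _ => hsep y hy
  have := le_csSup hbdd hinsert
  rw [Finset.card_insert_of_notMem hxt] at this
  omega

lemma exists_finset_net {A : Set E} {R θ : ℝ} (hR : 0 ≤ R) (hθ : 0 < θ)
    (hA : ∀ x ∈ A, ‖x‖ ≤ R) :
    ∃ t : Finset E, (t : Set E) ⊆ A ∧ (t.card : ℝ) ≤ (1 + 2 * R / θ) ^ finrank ℝ E ∧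
      ∀ x ∈ A, ∃ y ∈ t, ‖x - y‖ < θ := by
  have hbound (t : Finset E) (ht : (t : Set E) ⊆ A)
      (hsep : (t : Set E).Pairwise fun x y => θ ≤ ‖x - y‖) :
      (t.card : ℝ) ≤ (1 + 2 * R / θ) ^ finrank ℝ E :=
    card_le_of_separated_of_norm_le t hR hθ (fun x hx => hA x (ht hx)) hsep
  have : Std.Symm fun x y : E => θ ≤ ‖x - y‖ := ⟨fun x y h => by rwa [norm_sub_rev]⟩
  obtain ⟨t, htA, hsep, hmax⟩ :=
    exists_maximal_pairwise fun t ht hsep => Nat.le_floor (hbound t ht hsep)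
  refine ⟨t, htA, hbound t htA hsep, fun x hx => ?_⟩
  by_cases hxt : x ∈ t
  · exact ⟨x, hxt, by simpa using hθ⟩
  · simpa using hmax x hx hxt

end Packing

section HilbertSchmidt

open scoped Matrix.Norms.Frobenius

variable {m p : Type*} [Fintype m] [Fintype p]

lemma frobenius_norm_sq_eq_sum (A : Matrix m p ℂ) : ‖A‖ ^ 2 = ∑ i, ∑ j, ‖A i j‖ ^ 2 := by
  rw [Matrix.frobenius_norm_def, ← Real.sqrt_eq_rpow, Real.sq_sqrt (by positivity)]
  simp only [Real.rpow_two]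

lemma frobenius_norm_sq_eq_trace (A : Matrix m p ℂ) : ((‖A‖ ^ 2 : ℝ) : ℂ) = (Aᴴ * A).trace := by
  simp only [frobenius_norm_sq_eq_sum, Matrix.trace, Matrix.diag, Matrix.mul_apply,
    Matrix.conjTranspose_apply, ofReal_sum, ofReal_pow, ← conj_mul']
  exact Finset.sum_comm

lemma frobenius_norm_sq_eq_re_trace (A : Matrix m p ℂ) : ‖A‖ ^ 2 = (Aᴴ * A).trace.re := by
  rw [← frobenius_norm_sq_eq_trace, ofReal_re]

lemma frobenius_norm_eq_of_trace_eq {q : Type*} [Fintype q] {A : Matrix m p ℂ} {B : Matrix q p ℂ}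
    (h : (Aᴴ * A).trace = (Bᴴ * B).trace) : ‖A‖ = ‖B‖ := by
  rw [← frobenius_norm_sq_eq_trace, ← frobenius_norm_sq_eq_trace, ofReal_inj] at h
  exact (pow_left_inj₀ (norm_nonneg _) (norm_nonneg _) two_ne_zero).1 h

/-- The vector of entries of a matrix: the Frobenius norm of the matrix is the Euclidean norm of
this vector. -/
def entries : Matrix m p ℂ ≃ₗᵢ[ℂ] EuclideanSpace ℂ (m × p) where
  toFun A := WithLp.toLp 2 fun q => A q.1 q.2
  invFun v := Matrix.of fun i j => v (i, j)
  map_add' _ _ := rfl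
  map_smul' _ _ := rfl
  left_inv _ := rfl
  right_inv _ := rfl
  norm_map' A := by
    refine (pow_left_inj₀ (norm_nonneg _) (norm_nonneg _) two_ne_zero).1 ?_
    rw [EuclideanSpace.norm_sq_eq, frobenius_norm_sq_eq_sum, Fintype.sum_prod_type]
    rfl

@[simp] lemma entries_apply (A : Matrix m p ℂ) (q : m × p) : entries A q = A q.1 q.2 := rfl

lemma inner_entries (A B : Matrix m p ℂ) : inner ℂ (entries A) (entries B) = (Aᴴ * B).trace := by
  simp only [PiLp.inner_apply, entries_apply, RCLike.inner_apply, Fintype.sum_prod_type,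
    Matrix.trace, Matrix.diag, Matrix.mul_apply, Matrix.conjTranspose_apply, starRingEnd_apply,
    mul_comm]
  exact Finset.sum_comm

lemma norm_trace_mul_le (A : Matrix m p ℂ) (B : Matrix p m ℂ) : ‖(A * B).trace‖ ≤ ‖A‖ * ‖B‖ := by
  simpa only [inner_entries, Matrix.conjTranspose_conjTranspose, LinearIsometryEquiv.norm_map,
    Matrix.frobenius_norm_conjTranspose] using norm_inner_le_norm (𝕜 := ℂ) (entries Aᴴ) (entries B)

lemma frobenius_norm_sub_sq (A B : Matrix m p ℂ) :
    ‖A - B‖ ^ 2 = ‖A‖ ^ 2 + ‖B‖ ^ 2 - 2 * (A * Bᴴ).trace.re := by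
  have hre : (Aᴴ * B).trace.re = (A * Bᴴ).trace.re := by
    rw [← conj_re, starRingEnd_apply, ← Matrix.trace_conjTranspose, Matrix.conjTranspose_mul,
      Matrix.conjTranspose_conjTranspose, Matrix.trace_mul_comm]
  simp only [frobenius_norm_sq_eq_re_trace, Matrix.conjTranspose_sub, Matrix.sub_mul,
    Matrix.mul_sub, Matrix.trace_sub, sub_re, hre, Matrix.trace_mul_comm Bᴴ A]
  ring

variable [DecidableEq m]

lemma frobenius_norm_one : ‖(1 : Matrix m m ℂ)‖ = √(Fintype.card m) := by
  rw [← Real.sqrt_sq (norm_nonneg _), frobenius_norm_sq_eq_re_trace]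
  simp

lemma norm_trace_le (A : Matrix m m ℂ) : ‖A.trace‖ ≤ √(Fintype.card m) * ‖A‖ := by
  simpa only [one_mul, frobenius_norm_one] using norm_trace_mul_le 1 A

variable {U : Matrix m m ℂ}

lemma conjTranspose_mem_unitaryGroup (hU : U ∈ Matrix.unitaryGroup m ℂ) :
    Uᴴ ∈ Matrix.unitaryGroup m ℂ := Unitary.star_mem hU

lemma conjTranspose_mul_self_of_unitary (hU : U ∈ Matrix.unitaryGroup m ℂ) : Uᴴ * U = 1 :=
  Matrix.mem_unitaryGroup_iff'.1 hU

lemma self_mul_conjTranspose_of_unitary (hU : U ∈ Matrix.unitaryGroup m ℂ) : U * Uᴴ = 1 :=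
  Matrix.mem_unitaryGroup_iff.1 hU

lemma frobenius_norm_unitary_mul (hU : U ∈ Matrix.unitaryGroup m ℂ) (A : Matrix m p ℂ) :
    ‖U * A‖ = ‖A‖ := by
  apply frobenius_norm_eq_of_trace_eq
  rw [Matrix.conjTranspose_mul, Matrix.mul_assoc, ← Matrix.mul_assoc Uᴴ,
    conjTranspose_mul_self_of_unitary hU, Matrix.one_mul]

lemma frobenius_norm_mul_unitary (hU : U ∈ Matrix.unitaryGroup m ℂ) (A : Matrix p m ℂ) :
    ‖A * U‖ = ‖A‖ := by
  rw [← Matrix.frobenius_norm_conjTranspose, Matrix.conjTranspose_mul,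
    frobenius_norm_unitary_mul (conjTranspose_mem_unitaryGroup hU),
    Matrix.frobenius_norm_conjTranspose]

lemma frobenius_norm_conj_unitary (hU : U ∈ Matrix.unitaryGroup m ℂ) (A : Matrix m m ℂ) :
    ‖U * A * Uᴴ‖ = ‖A‖ := by
  rw [frobenius_norm_mul_unitary (conjTranspose_mem_unitaryGroup hU), frobenius_norm_unitary_mul hU]

lemma trace_conj_unitary (hU : U ∈ Matrix.unitaryGroup m ℂ) (A : Matrix m m ℂ) :
    (U * A * Uᴴ).trace = A.trace := by
  rw [Matrix.trace_mul_comm, ← Matrix.mul_assoc, conjTranspose_mul_self_of_unitary hU,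
    Matrix.one_mul]

lemma frobenius_norm_unitary (hU : U ∈ Matrix.unitaryGroup m ℂ) : ‖U‖ = √(Fintype.card m) := by
  rw [← Matrix.mul_one U, frobenius_norm_unitary_mul hU, frobenius_norm_one]

end HilbertSchmidt

section TensorNorm

open scoped Matrix.Norms.Frobenius

variable {n N : ℕ}

/-- Complex matrices of size `N`. -/
abbrev Mat (N : ℕ) : Type := Matrix (Fin N) (Fin N) ℂ

/-- The matrix `∑ x j ⊗ conj (y j)`, whose trace moments bound `tensorNorm x y`. -/
def tensorMatrix (x y : Tuple n N) : Matrix (Fin N × Fin N) (Fin N × Fin N) ℂ :=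
  ∑ j, x j ⊗ₖ (y j).map star

/-- The operator `∑ x j ⊗ conj (y j)` on `ℓ₂^N ⊗ ℓ₂^N`, whose norm is `tensorNorm x y`. Under the
identification `entries` it is the operator `ξ ↦ ∑ x j * ξ * (y j)ᴴ` on matrices. -/
def tensorOp (x y : Tuple n N) :
    EuclideanSpace ℂ (Fin N × Fin N) →L[ℂ] EuclideanSpace ℂ (Fin N × Fin N) :=
  Matrix.toEuclideanCLM (𝕜 := ℂ) (tensorMatrix x y)

lemma tensorNorm_eq_norm_tensorOp (x y : Tuple n N) : tensorNorm x y = ‖tensorOp x y‖ := rfl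

lemma tensorOp_entries (x y : Tuple n N) (ξ : Mat N) :
    tensorOp x y (entries ξ) = entries (∑ j, x j * ξ * (y j)ᴴ) := by
  have hvec (A : Mat N) : (entries A).ofLp = Aᵀ.vec := rfl
  apply (WithLp.equiv 2 _).injective
  simp only [tensorOp, tensorMatrix, WithLp.equiv_apply, Matrix.ofLp_toEuclideanCLM, hvec,
    Matrix.sum_mulVec, Matrix.kronecker_mulVec_vec, Matrix.transpose_sum, Matrix.vec_sum,
    Matrix.transpose_mul, Matrix.mul_assoc]
  rfl

lemma continuous_tensorOp : Continuous fun p : Tuple n N × Tuple n N => tensorOp p.1 p.2 := by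
  refine (LinearMap.continuous_of_finiteDimensional
    (Matrix.toEuclideanCLM (n := Fin N × Fin N) (𝕜 := ℂ)).toAlgEquiv.toLinearMap).comp ?_
  refine continuous_finsetSum _ fun j _ => continuous_matrix fun a b => ?_
  simp only [Matrix.kroneckerMap_apply, Matrix.map_apply]
  fun_prop

lemma tensorNorm_nonneg (x y : Tuple n N) : 0 ≤ tensorNorm x y := norm_nonneg _

lemma norm_sum_le_tensorNorm (x y : Tuple n N) (ξ : Mat N) :
    ‖∑ j, x j * ξ * (y j)ᴴ‖ ≤ tensorNorm x y * ‖ξ‖ := by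
  simpa only [tensorOp_entries, LinearIsometryEquiv.norm_map, tensorNorm_eq_norm_tensorOp] using
    (tensorOp x y).le_opNorm (entries ξ)

lemma tensorNorm_le_of_norm_sum_le {x y : Tuple n N} {C : ℝ} (hC : 0 ≤ C)
    (h : ∀ ξ : Mat N, ‖∑ j, x j * ξ * (y j)ᴴ‖ ≤ C * ‖ξ‖) : tensorNorm x y ≤ C := by
  refine (tensorOp x y).opNorm_le_bound hC (entries.surjective.forall.2 fun ξ => ?_)
  simpa only [tensorOp_entries, LinearIsometryEquiv.norm_map] using h ξ

lemma tensorNorm_comm (x y : Tuple n N) : tensorNorm x y = tensorNorm y x := by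
  have hle (x y : Tuple n N) : tensorNorm x y ≤ tensorNorm y x :=
    tensorNorm_le_of_norm_sum_le (tensorNorm_nonneg y x) fun ξ => by
      simpa only [Matrix.conjTranspose_sum, Matrix.conjTranspose_mul, Matrix.mul_assoc,
        Matrix.conjTranspose_conjTranspose, Matrix.frobenius_norm_conjTranspose] using
        (Matrix.frobenius_norm_conjTranspose _).trans_le (norm_sum_le_tensorNorm y x ξᴴ)
  exact (hle x y).antisymm (hle y x)

lemma tensorNorm_le_of_unitary {x y : Tuple n N} (hx : x ∈ unitaryTuples n N)
    (hy : y ∈ unitaryTuples n N) : tensorNorm x y ≤ n := by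
  refine tensorNorm_le_of_norm_sum_le n.cast_nonneg fun ξ => (norm_sum_le _ _).trans_eq ?_
  simp [frobenius_norm_mul_unitary (conjTranspose_mem_unitaryGroup (hy _)),
    frobenius_norm_unitary_mul (hx _)]

lemma tensorNorm_self_of_unitary [NeZero N] {u : Tuple n N} (hu : u ∈ unitaryTuples n N) :
    tensorNorm u u = n := by
  apply (tensorNorm_le_of_unitary hu hu).antisymm
  have hone := norm_sum_le_tensorNorm u u 1
  have hsum : ∑ j, u j * 1 * (u j)ᴴ = (n : ℂ) • (1 : Mat N) := by
    simp [self_mul_conjTranspose_of_unitary (hu _), Nat.cast_smul_eq_nsmul]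
  rw [hsum, norm_smul, norm_natCast] at hone
  exact le_of_mul_le_mul_right hone (norm_pos_iff.2 one_ne_zero)

lemma separated_iff_of_unitary [NeZero N] {δ : ℝ} {x y : Tuple n N} (hx : x ∈ unitaryTuples n N)
    (hy : y ∈ unitaryTuples n N) : Separated δ x y ↔ tensorNorm x y ≤ (1 - δ) * n := by
  rw [Separated, tensorNorm_self_of_unitary hx, tensorNorm_self_of_unitary hy,
    Real.mul_self_sqrt n.cast_nonneg]

end TensorNorm

section Gaussian

lemma integral_comp_of_measurePreserving {α β E : Type*} [MeasurableSpace α] [MeasurableSpace β]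
    [NormedAddCommGroup E] [NormedSpace ℝ E] {μ : Measure α} {ν : Measure β} {f : α → β}
    (hf : MeasurePreserving f μ ν) {g : β → E} (hg : AEStronglyMeasurable g ν) :
    ∫ x, g (f x) ∂μ = ∫ y, g y ∂ν := by
  rw [← hf.map_eq] at hg ⊢
  rw [integral_map hf.aemeasurable hg]

/-- The density of the standard complex Gaussian measure. -/
def gaussianDensity (z : ℂ) : ℝ := Real.pi⁻¹ * Real.exp (-‖z‖ ^ 2)

lemma gaussianDensity_nonneg (z : ℂ) : 0 ≤ gaussianDensity z := by
  unfold gaussianDensity; positivity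

lemma continuous_gaussianDensity : Continuous gaussianDensity := by
  unfold gaussianDensity; fun_prop

/-- The standard complex Gaussian measure, normalized so that `E |z|² = 1`. -/
def gaussianC : Measure ℂ := volume.withDensity fun z => ENNReal.ofReal (gaussianDensity z)

lemma integral_gaussianC {E : Type*} [NormedAddCommGroup E] [NormedSpace ℝ E] (f : ℂ → E) :
    ∫ z, f z ∂gaussianC = ∫ z, gaussianDensity z • f z := by
  rw [gaussianC, integral_withDensity_eq_integral_toReal_smul
    continuous_gaussianDensity.measurable.ennreal_ofReal (by simp)]
  simp only [ENNReal.toReal_ofReal (gaussianDensity_nonneg _)]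

lemma integrable_gaussianC {E : Type*} [NormedAddCommGroup E] [NormedSpace ℝ E] {f : ℂ → E} :
    Integrable f gaussianC ↔ Integrable fun z => gaussianDensity z • f z := by
  rw [gaussianC, integrable_withDensity_iff_integrable_smul'
    continuous_gaussianDensity.measurable.ennreal_ofReal (by simp)]
  simp only [ENNReal.toReal_ofReal (gaussianDensity_nonneg _)]

lemma integral_gaussianC_cexp (c w : ℂ) :
    ∫ z, cexp (c * (inner ℝ w z : ℝ)) ∂gaussianC = cexp (c ^ 2 * ‖w‖ ^ 2 / 4) := by
  have hdens (z : ℂ) : gaussianDensity z • cexp (c * (inner ℝ w z : ℝ))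
      = (Real.pi : ℂ)⁻¹ * cexp (-1 * ‖z‖ ^ 2 + c * (inner ℝ w z : ℝ)) := by
    rw [real_smul, gaussianDensity, Complex.exp_add]
    push_cast
    ring_nf
  have : (Real.pi : ℂ) ≠ 0 := ofReal_ne_zero.2 Real.pi_ne_zero
  simp_rw [integral_gaussianC, hdens]
  rw [integral_const_mul, GaussianFourier.integral_cexp_neg_mul_sq_norm_add (by simp) c w,
    finrank_real_complex]
  norm_num

lemma gaussianDensity_mul_exp (b : ℝ) (z : ℂ) :
    gaussianDensity z * Real.exp (b * ‖z‖ ^ 2) = Real.pi⁻¹ * Real.exp (-(1 - b) * ‖z‖ ^ 2) := by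
  rw [gaussianDensity, mul_assoc, ← Real.exp_add]
  ring_nf

lemma integrable_exp_neg_mul_sq_norm {b : ℝ} (hb : 0 < b) :
    Integrable fun z : ℂ => Real.exp (-b * ‖z‖ ^ 2) := by
  refine (GaussianFourier.integrable_cexp_neg_mul_sq_norm_add (V := ℂ) (b := (b : ℂ))
    (by simpa using hb) 0 0).norm.congr (.of_forall fun z => ?_)
  simp [norm_exp, ← ofReal_pow]

lemma integrable_gaussianC_exp_mul_sq {b : ℝ} (hb : b < 1) :
    Integrable (fun z : ℂ => Real.exp (b * ‖z‖ ^ 2)) gaussianC := by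
  simp only [integrable_gaussianC, smul_eq_mul, gaussianDensity_mul_exp]
  exact (integrable_exp_neg_mul_sq_norm (sub_pos.2 hb)).const_mul _

lemma integral_gaussianC_exp_mul_sq {b : ℝ} (hb : b < 1) :
    ∫ z, Real.exp (b * ‖z‖ ^ 2) ∂gaussianC = (1 - b)⁻¹ := by
  simp only [integral_gaussianC, smul_eq_mul, gaussianDensity_mul_exp]
  rw [integral_const_mul, GaussianFourier.integral_rexp_neg_mul_sq_norm (sub_pos.2 hb),
    finrank_real_complex]
  have := sub_pos.2 hb
  have := Real.pi_ne_zero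
  norm_num
  field_simp

instance : IsProbabilityMeasure gaussianC := by
  have : IsFiniteMeasure gaussianC := by
    simpa [integrable_const_iff, isFiniteMeasure_iff] using
      integrable_gaussianC_exp_mul_sq (b := 0) one_pos
  have hmass := integral_gaussianC_exp_mul_sq (b := 0) one_pos
  simp only [zero_mul, Real.exp_zero, integral_const, smul_eq_mul, mul_one, sub_zero,
    inv_one] at hmass
  exact ⟨(ENNReal.toReal_eq_one_iff _).1 hmass⟩

lemma integrable_gaussianC_exp_mul_norm (a : ℝ) :
    Integrable (fun z : ℂ => Real.exp (a * ‖z‖)) gaussianC := by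
  refine ((integrable_gaussianC_exp_mul_sq (b := 1 / 4) (by norm_num)).const_mul
    (Real.exp (a ^ 2))).mono' (by fun_prop) (.of_forall fun z => ?_)
  rw [Real.norm_of_nonneg (Real.exp_pos _).le, ← Real.exp_add, Real.exp_le_exp]
  nlinarith [sq_nonneg (a - ‖z‖ / 2)]

lemma measurePreserving_gaussianC_mul (w : Circle) :
    MeasurePreserving (fun z : ℂ => (w : ℂ) * z) gaussianC gaussianC := by
  have hrot : MeasurePreserving (fun z : ℂ => (w : ℂ) * z) := (rotation w).measurePreserving
  refine ⟨hrot.measurable, Measure.ext fun s hs => ?_⟩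
  rw [Measure.map_apply hrot.measurable hs, gaussianC, withDensity_apply _ hs,
    withDensity_apply _ (hrot.measurable hs), ← hrot.setLIntegral_comp_preimage hs
      continuous_gaussianDensity.measurable.ennreal_ofReal]
  simp [gaussianDensity, Circle.norm_coe]

lemma integrable_gaussianC_pow_mul_conj_pow (a b : ℕ) :
    Integrable (fun z : ℂ => z ^ a * conj z ^ b) gaussianC := by
  refine ((integrable_gaussianC_exp_mul_norm 1).const_mul ((a + b).factorial : ℝ)).mono'
    (by fun_prop) (.of_forall fun z => ?_)
  have h := Real.pow_div_factorial_le_exp ‖z‖ (norm_nonneg z) (a + b)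
  rw [div_le_iff₀ (by positivity)] at h
  simpa [pow_add, mul_comm] using h

lemma integral_gaussianC_pow_mul_conj_pow_self (a : ℕ) :
    ∫ z, z ^ a * conj z ^ a ∂gaussianC = a.factorial := by
  have hpow (z : ℂ) : ‖z‖ ^ (2 * a : ℝ) = (‖z‖ ^ 2) ^ a := by
    rw [← pow_mul, ← Real.rpow_natCast]
    push_cast
    rfl
  have hdens (z : ℂ) : gaussianDensity z • (z ^ a * conj z ^ a)
      = ((Real.pi⁻¹ * (‖z‖ ^ (2 * a : ℝ) * Real.exp (-‖z‖ ^ (2 : ℝ))) : ℝ) : ℂ) := by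
    rw [← mul_pow, mul_conj, normSq_eq_norm_sq, real_smul, gaussianDensity, hpow, Real.rpow_two]
    push_cast
    ring
  have hgamma : ((2 * a + 2 : ℝ) / 2) = (a : ℝ) + 1 := by ring
  have hexp : (-2 : ℝ) < 2 * a := by linarith [a.cast_nonneg (α := ℝ)]
  simp_rw [integral_gaussianC, hdens]
  rw [integral_complex_ofReal, integral_const_mul,
    Complex.integral_rpow_mul_exp_neg_rpow (by norm_num) hexp, hgamma,
    Real.Gamma_nat_eq_factorial, ← ofReal_natCast]
  field_simp

lemma integral_gaussianC_pow_mul_conj_pow_of_ne {a b : ℕ} (hab : a ≠ b) :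
    ∫ z, z ^ a * conj z ^ b ∂gaussianC = 0 := by
  have hne : (a : ℂ) - b ≠ 0 := sub_ne_zero.2 (Nat.cast_injective.ne hab)
  let w : Circle := Circle.exp (Real.pi / (a - b))
  have hw : (w : ℂ) ^ a * conj (w : ℂ) ^ b = -1 := by
    rw [Circle.coe_exp, ← exp_conj, ← Complex.exp_nat_mul, ← Complex.exp_nat_mul,
      ← Complex.exp_add, ← exp_pi_mul_I]
    simp only [map_mul, conj_ofReal, conj_I]
    congr 1
    push_cast
    field_simp
    ring
  have hsymm := integral_comp_of_measurePreserving (measurePreserving_gaussianC_mul w)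
    (g := fun z => z ^ a * conj z ^ b) (by fun_prop)
  have hneg (z : ℂ) : (w * z) ^ a * conj (w * z) ^ b = -(z ^ a * conj z ^ b) := by
    rw [map_mul, mul_pow, mul_pow]
    linear_combination (z ^ a * conj z ^ b) * hw
  simp_rw [hneg, integral_neg] at hsymm
  exact self_eq_neg.1 hsymm.symm

lemma integral_gaussianC_pow_mul_conj_pow (a b : ℕ) :
    ∫ z, z ^ a * conj z ^ b ∂gaussianC = if a = b then (a.factorial : ℂ) else 0 := by
  split_ifs with hab
  · rw [← hab, integral_gaussianC_pow_mul_conj_pow_self]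
  · exact integral_gaussianC_pow_mul_conj_pow_of_ne hab

variable {ι κ : Type*} [Fintype ι] [Fintype κ]

/-- The law of a vector of independent standard complex Gaussian variables. -/
def gaussianPi (ι : Type*) [Fintype ι] : Measure (ι → ℂ) := Measure.pi fun _ => gaussianC

instance : IsProbabilityMeasure (gaussianPi ι) := by unfold gaussianPi; infer_instance

lemma integrable_gaussianPi_exp_sum_norm (a : ℝ) :
    Integrable (fun y : ι → ℂ => Real.exp (a * ∑ i, ‖y i‖)) (gaussianPi ι) := by
  simpa only [Finset.mul_sum, Real.exp_sum, gaussianPi] using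
    Integrable.fintype_prod (μ := fun _ : ι => gaussianC)
      (f := fun _ z => Real.exp (a * ‖z‖)) fun _ => integrable_gaussianC_exp_mul_norm a

lemma integrable_gaussianPi_of_norm_le_exp {E : Type*} [NormedAddCommGroup E] {f : (ι → ℂ) → E}
    (hf : AEStronglyMeasurable f (gaussianPi ι)) (C a : ℝ)
    (h : ∀ y, ‖f y‖ ≤ C * Real.exp (a * ∑ i, ‖y i‖)) : Integrable f (gaussianPi ι) :=
  ((integrable_gaussianPi_exp_sum_norm a).const_mul C).mono' hf (.of_forall h)

lemma integral_gaussianPi_cexp (c : ℂ) (w : ι → ℂ) :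
    ∫ y, cexp (c * ((∑ i, inner ℝ (w i) (y i) : ℝ) : ℂ)) ∂gaussianPi ι
      = cexp (c ^ 2 * (∑ i, ‖w i‖ ^ 2 : ℝ) / 4) := by
  have h := integral_fintype_prod_eq_prod (𝕜 := ℂ) (μ := fun _ : ι => gaussianC)
    (fun i z => cexp (c * (inner ℝ (w i) z : ℝ)))
  simp_rw [integral_gaussianC_cexp, ← Complex.exp_sum] at h
  simpa only [gaussianPi, ofReal_sum, ofReal_pow, Finset.mul_sum, Finset.sum_div] using h

lemma integral_gaussianPi_exp (w : ι → ℂ) :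
    ∫ y, Real.exp (∑ i, inner ℝ (w i) (y i)) ∂gaussianPi ι = Real.exp ((∑ i, ‖w i‖ ^ 2) / 4) := by
  have h := integral_gaussianPi_cexp 1 w
  simp only [one_mul, one_pow, ← ofReal_exp, integral_complex_ofReal] at h
  exact_mod_cast h

lemma charFun_map_gaussianPi {L : (ι → ℂ) → (κ → ℂ)} (L' : (κ → ℂ) → (ι → ℂ)) (hL : Measurable L)
    (hadj : ∀ t y, ∑ k, inner ℝ (t k) (L y k) = ∑ i, inner ℝ (L' t i) (y i))
    (t : PiLp 2 fun _ : κ => ℂ) :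
    charFun (((gaussianPi ι).map L).map (WithLp.toLp 2)) t
      = cexp (I ^ 2 * (∑ i, ‖L' t.ofLp i‖ ^ 2 : ℝ) / 4) := by
  rw [charFun_apply, integral_map (by fun_prop) (by fun_prop),
    integral_map hL.aemeasurable (by fun_prop), ← integral_gaussianPi_cexp]
  simp only [real_inner_comm t, PiLp.inner_apply, hadj, mul_comm I]

/-- The law of a standard Gaussian vector is determined by its characteristic function, and the
adjoint `L'` transports it. -/
lemma measurePreserving_gaussianPi {L : (ι → ℂ) → (κ → ℂ)} (L' : (κ → ℂ) → (ι → ℂ))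
    (hL : Measurable L)
    (hadj : ∀ t y, ∑ k, inner ℝ (t k) (L y k) = ∑ i, inner ℝ (L' t i) (y i))
    (hiso : ∀ t, ∑ i, ‖L' t i‖ ^ 2 = ∑ k, ‖t k‖ ^ 2) :
    MeasurePreserving L (gaussianPi ι) (gaussianPi κ) := by
  refine ⟨hL, (MeasurableEquiv.toLp 2 (κ → ℂ)).map_measurableEquiv_injective ?_⟩
  have : IsProbabilityMeasure ((gaussianPi ι).map L) :=
    Measure.isProbabilityMeasure_map hL.aemeasurable
  refine Measure.ext_of_charFun (E := PiLp 2 fun _ : κ => ℂ) (funext fun t => ?_)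
  have hid := charFun_map_gaussianPi (κ := κ) id measurable_id (fun _ _ => rfl) t
  rw [Measure.map_id] at hid
  exact (charFun_map_gaussianPi L' hL hadj t).trans (by rw [hiso]; exact hid.symm)

end Gaussian

section Moments

open scoped ComplexOrder

variable {ι κ : Type*}

/-- The value of a polynomial at a vector and its conjugate. Natural coefficients suffice here and
make the Gaussian expectation nonnegative. -/
def evalConj (y : ι → ℂ) : MvPolynomial (ι ⊕ ι) ℕ →ₐ[ℕ] ℂ :=
  MvPolynomial.aeval (Sum.elim y fun i => conj (y i))

lemma evalConj_rename (π : ι → κ) (F : MvPolynomial (ι ⊕ ι) ℕ) (z : κ → ℂ) :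
    evalConj z (MvPolynomial.rename (Sum.map π π) F) = evalConj (z ∘ π) F := by
  rw [evalConj, MvPolynomial.aeval_rename, Sum.elim_comp_map]
  rfl

variable [Fintype ι] [Fintype κ]

lemma integrable_gaussianPi_monomial (a b : ι → ℕ) :
    Integrable (fun y : ι → ℂ => (∏ i, y i ^ a i) * ∏ i, conj (y i) ^ b i) (gaussianPi ι) := by
  simpa only [Finset.prod_mul_distrib, gaussianPi] using
    Integrable.fintype_prod (μ := fun _ : ι => gaussianC) (f := fun i z => z ^ a i * conj z ^ b i)
      fun i => integrable_gaussianC_pow_mul_conj_pow _ _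

lemma integral_gaussianPi_monomial (a b : ι → ℕ) :
    ∫ y, (∏ i, y i ^ a i) * ∏ i, conj (y i) ^ b i ∂gaussianPi ι
      = ((if a = b then ∏ i, (a i).factorial else 0 : ℕ) : ℂ) := by
  have h := integral_fintype_prod_eq_prod (𝕜 := ℂ) (μ := fun _ : ι => gaussianC)
    (fun i z => z ^ a i * conj z ^ b i)
  simp only [integral_gaussianC_pow_mul_conj_pow, Finset.prod_mul_distrib] at h
  rw [gaussianPi, h]
  split_ifs with hab
  · simp [hab]
  · obtain ⟨i, hi⟩ := Function.ne_iff.1 hab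
    rw [Finset.prod_eq_zero (Finset.mem_univ i) (if_neg hi), Nat.cast_zero]

lemma evalConj_eq_sum (F : MvPolynomial (ι ⊕ ι) ℕ) (y : ι → ℂ) :
    evalConj y F = ∑ m ∈ F.support, ((F.coeff m : ℕ) : ℂ) *
      ((∏ i, y i ^ m (Sum.inl i)) * ∏ i, conj (y i) ^ m (Sum.inr i)) := by
  rw [evalConj, MvPolynomial.aeval_def, MvPolynomial.eval₂_eq']
  simp [Fintype.prod_sum_type]

lemma integrable_evalConj (F : MvPolynomial (ι ⊕ ι) ℕ) :
    Integrable (fun y => evalConj y F) (gaussianPi ι) := by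
  simp_rw [evalConj_eq_sum]
  exact integrable_finsetSum _ fun m _ => (integrable_gaussianPi_monomial _ _).const_mul _

lemma integral_evalConj (F : MvPolynomial (ι ⊕ ι) ℕ) :
    ∫ y, evalConj y F ∂gaussianPi ι = ∑ m ∈ F.support, ((F.coeff m : ℕ) : ℂ) *
      ((if m ∘ Sum.inl = m ∘ Sum.inr then ∏ i, (m (Sum.inl i)).factorial else 0 : ℕ) : ℂ) := by
  simp_rw [evalConj_eq_sum]
  rw [integral_finsetSum _ fun m _ => (integrable_gaussianPi_monomial _ _).const_mul _]
  simp only [integral_const_mul, integral_gaussianPi_monomial]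
  rfl

lemma integral_evalConj_nonneg (F : MvPolynomial (ι ⊕ ι) ℕ) :
    0 ≤ ∫ y, evalConj y F ∂gaussianPi ι := by
  rw [integral_evalConj]
  exact Finset.sum_nonneg fun m _ => by positivity

lemma prod_comp_pow [DecidableEq κ] {M : Type*} [CommMonoid M] (π : ι → κ) (z : κ → M)
    (a : ι → ℕ) : ∏ i, z (π i) ^ a i = ∏ l, z l ^ ∑ i with π i = l, a i := by
  rw [← Finset.prod_fiberwise Finset.univ π]
  refine Finset.prod_congr rfl fun _ _ => ?_
  rw [← Finset.prod_pow_eq_pow_sum]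
  exact Finset.prod_congr rfl fun i hi => by rw [(Finset.mem_filter.1 hi).2]

lemma integral_gaussianPi_monomial_le_comp (π : ι → κ) (a b : ι → ℕ) :
    ∫ y, (∏ i, y i ^ a i) * ∏ i, conj (y i) ^ b i ∂gaussianPi ι
      ≤ ∫ z, (∏ i, z (π i) ^ a i) * ∏ i, conj (z (π i)) ^ b i ∂gaussianPi κ := by
  classical
  simp_rw [prod_comp_pow π _ a, prod_comp_pow π (fun _ => conj (_ : ℂ)) b]
  rw [integral_gaussianPi_monomial, integral_gaussianPi_monomial, Nat.cast_le]
  split_ifs with hab hsum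
  · rw [← Finset.prod_fiberwise Finset.univ π]
    exact Finset.prod_le_prod' fun _ _ =>
      Nat.le_of_dvd (Nat.factorial_pos _) (Nat.prod_factorial_dvd_factorial_sum _ _)
  · exact absurd (by simp only [hab]) hsum
  all_goals exact Nat.zero_le _

lemma integral_evalConj_le_rename (π : ι → κ) (F : MvPolynomial (ι ⊕ ι) ℕ) :
    ∫ y, evalConj y F ∂gaussianPi ι
      ≤ ∫ z, evalConj z (MvPolynomial.rename (Sum.map π π) F) ∂gaussianPi κ := by
  classical
  have hint (a b : ι → ℕ) : Integrable (fun z : κ → ℂ =>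
      (∏ i, (z ∘ π) i ^ a i) * ∏ i, conj ((z ∘ π) i) ^ b i) (gaussianPi κ) := by
    simp_rw [Function.comp_apply, prod_comp_pow π _ a, prod_comp_pow π (fun _ => conj (_ : ℂ)) b]
    exact integrable_gaussianPi_monomial _ _
  simp_rw [evalConj_rename, evalConj_eq_sum]
  rw [integral_finsetSum _ fun m _ => (integrable_gaussianPi_monomial _ _).const_mul _,
    integral_finsetSum _ fun m _ => (hint _ _).const_mul _]
  refine Finset.sum_le_sum fun m _ => ?_
  simp only [integral_const_mul]
  exact mul_le_mul_of_nonneg_left (integral_gaussianPi_monomial_le_comp π _ _) (by positivity)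

end Moments

section Words

open scoped ComplexOrder

variable {ι m : Type*}

/-- The tuple of matrices with given entries; it carries a vector of Gaussian variables to a tuple
of Gaussian matrices. -/
def tupleOf (y : ι × m × m → ℂ) : ι → Matrix m m ℂ := fun j => Matrix.of fun a b => y (j, a, b)

/-- The matrix with given entries. -/
def matrixOf (z : m × m → ℂ) : Matrix m m ℂ := Matrix.of fun a b => z (a, b)

@[simp] lemma tupleOf_apply (y : ι × m × m → ℂ) (j : ι) (a b : m) :
    tupleOf y j a b = y (j, a, b) := rfl

@[simp] lemma matrixOf_apply (z : m × m → ℂ) (a b : m) : matrixOf z a b = z (a, b) := rfl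

lemma continuous_tupleOf : Continuous (tupleOf : (ι × m × m → ℂ) → ι → Matrix m m ℂ) :=
  continuous_pi fun j => continuous_matrix fun a b => continuous_apply (j, a, b)

lemma continuous_matrixOf : Continuous (matrixOf : (m × m → ℂ) → Matrix m m ℂ) :=
  continuous_matrix fun a b => continuous_apply (a, b)

variable [Fintype m]

lemma kronecker_mul_conjTranspose (A B C D : Matrix m m ℂ) :
    (A ⊗ₖ B.map star) * (C ⊗ₖ D.map star)ᴴ = (A * Cᴴ) ⊗ₖ (B * Dᴴ).map star := by
  have hmap : (B * Dᴴ).map star = B.map star * (Dᴴ).map star :=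
    Matrix.map_mul (f := starRingEnd ℂ)
  rw [Matrix.conjTranspose_kronecker, ← Matrix.mul_kronecker_mul, hmap]
  rfl

variable [DecidableEq m] {k : ℕ}

/-- The trace of the word `∏ i, Y (w i).1 * (Y (w i).2)ᴴ`. -/
def wordTrace (w : Fin k → ι × ι) (Y : ι → Matrix m m ℂ) : ℂ :=
  (List.ofFn fun i => Y (w i).1 * (Y (w i).2)ᴴ).prod.trace

lemma wordTrace_const (w : Fin k → ι × ι) (Z : Matrix m m ℂ) :
    wordTrace w (fun _ => Z) = ((Z * Zᴴ) ^ k).trace := by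
  simp [wordTrace]

variable (m) in
/-- The polynomial in the entries of a tuple and their conjugates whose value is `wordTrace`; the
point is that its coefficients are nonnegative. -/
def wordPoly (w : Fin k → ι × ι) : MvPolynomial ((ι × m × m) ⊕ (ι × m × m)) ℕ :=
  (List.ofFn fun i =>
    (Matrix.of fun a b : m => MvPolynomial.X (Sum.inl ((w i).1, a, b))) *
    (Matrix.of fun a b : m => MvPolynomial.X (Sum.inr ((w i).2, b, a)))).prod.trace

lemma evalConj_wordPoly (w : Fin k → ι × ι) (y : ι × m × m → ℂ) :
    evalConj y (wordPoly m w) = wordTrace w (tupleOf y) := by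
  have hprod := map_list_prod (evalConj y).toRingHom.mapMatrix (List.ofFn fun i =>
    (Matrix.of fun a b : m => MvPolynomial.X (R := ℕ) (Sum.inl ((w i).1, a, b))) *
    (Matrix.of fun a b : m => MvPolynomial.X (Sum.inr ((w i).2, b, a))))
  rw [RingHom.mapMatrix_apply, List.map_ofFn] at hprod
  rw [wordPoly, wordTrace, AddMonoidHom.map_trace (evalConj y)]
  refine congrArg Matrix.trace (hprod.trans ?_)
  congr 2
  ext i a b
  simp [Matrix.mul_apply, evalConj]

lemma evalConj_rename_wordPoly (w : Fin k → ι × ι) (z : m × m → ℂ) :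
    evalConj z (MvPolynomial.rename (Sum.map Prod.snd Prod.snd) (wordPoly m w))
      = ((matrixOf z * (matrixOf z)ᴴ) ^ k).trace := by
  rw [evalConj_rename, evalConj_wordPoly, ← wordTrace_const w]
  rfl

variable [Fintype ι]

lemma integrable_wordTrace (w : Fin k → ι × ι) :
    Integrable (fun y => wordTrace w (tupleOf y : ι → Matrix m m ℂ)) (gaussianPi _) := by
  simpa only [evalConj_wordPoly] using integrable_evalConj (wordPoly m w)

lemma integral_wordTrace_nonneg (w : Fin k → ι × ι) :
    0 ≤ ∫ y, wordTrace w (tupleOf y : ι → Matrix m m ℂ) ∂gaussianPi _ := by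
  simpa only [evalConj_wordPoly] using integral_evalConj_nonneg (wordPoly m w)

lemma integral_wordTrace_le (w : Fin k → ι × ι) :
    ∫ y, wordTrace w (tupleOf y : ι → Matrix m m ℂ) ∂gaussianPi _
      ≤ ∫ z, ((matrixOf z * (matrixOf z)ᴴ : Matrix m m ℂ) ^ k).trace ∂gaussianPi _ := by
  simpa only [evalConj_wordPoly, evalConj_rename_wordPoly] using
    integral_evalConj_le_rename Prod.snd (wordPoly m w)

lemma integrable_trace_pow (k : ℕ) :
    Integrable (fun z => ((matrixOf z * (matrixOf z)ᴴ : Matrix m m ℂ) ^ k).trace)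
      (gaussianPi _) := by
  simpa only [evalConj_rename_wordPoly] using integrable_evalConj
    (MvPolynomial.rename (Sum.map Prod.snd Prod.snd) (wordPoly m fun _ : Fin k => ((), ())))

lemma sum_pow_eq_sum_words {R α : Type*} [Ring R] [Fintype α] (M : α → R) (k : ℕ) :
    (∑ p, M p) ^ k = ∑ w : Fin k → α, (List.ofFn fun i => M (w i)).prod := by
  classical
  simpa using (MultilinearMap.mkPiAlgebraFin ℤ k R).map_sum fun _ p => M p

lemma trace_sum_mul_pow (Y : ι → Matrix m m ℂ) (k : ℕ) :
    (((∑ j, Y j) * (∑ j, Y j)ᴴ) ^ k).trace = ∑ w : Fin k → ι × ι, wordTrace w Y := by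
  rw [Matrix.conjTranspose_sum, Finset.sum_mul_sum, ← Finset.sum_product',
    Finset.univ_product_univ, sum_pow_eq_sum_words, Matrix.trace_sum]
  rfl

lemma list_prod_kronecker (l : List (Matrix m m ℂ × Matrix m m ℂ)) :
    (l.map fun p => p.1 ⊗ₖ p.2.map star).prod
      = (l.map Prod.fst).prod ⊗ₖ ((l.map Prod.snd).prod).map star := by
  induction l with
  | nil => simp
  | cons p l ih =>
    have hmap : (p.2 * (l.map Prod.snd).prod).map star
        = p.2.map star * ((l.map Prod.snd).prod).map star := Matrix.map_mul (f := starRingEnd ℂ)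
    simp only [List.map_cons, List.prod_cons, ih, hmap, Matrix.mul_kronecker_mul]

lemma trace_tensorMatrix_pow {n N : ℕ} (Y Z : Tuple n N) (k : ℕ) :
    ((tensorMatrix Y Z * (tensorMatrix Y Z)ᴴ) ^ k).trace
      = ∑ w : Fin k → Fin n × Fin n, wordTrace w Y * star (wordTrace w Z) := by
  rw [tensorMatrix, Matrix.conjTranspose_sum, Finset.sum_mul_sum, ← Finset.sum_product',
    Finset.univ_product_univ, sum_pow_eq_sum_words, Matrix.trace_sum]
  refine Finset.sum_congr rfl fun w _ => ?_
  simp_rw [kronecker_mul_conjTranspose]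
  have hprod := list_prod_kronecker (List.ofFn fun i =>
    (Y (w i).1 * (Y (w i).2)ᴴ, Z (w i).1 * (Z (w i).2)ᴴ))
  simp only [List.map_ofFn] at hprod
  refine (congrArg Matrix.trace hprod).trans ?_
  rw [Matrix.trace_kronecker]
  simp [wordTrace, Matrix.trace, Function.comp_def]

end Words

section GaussianMoment

open scoped ComplexOrder

variable {n N k : ℕ}

/-- The moment `E tr (Z Z*)^k` of an `N × N` matrix `Z` with independent standard complex Gaussian
entries. -/
def gaussianMoment (N k : ℕ) : ℝ :=
  ∫ z, ((matrixOf z * (matrixOf z)ᴴ : Mat N) ^ k).trace.re ∂gaussianPi (Fin N × Fin N)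

lemma integral_trace_pow_eq_gaussianMoment (N k : ℕ) :
    ∫ z, ((matrixOf z * (matrixOf z)ᴴ : Mat N) ^ k).trace ∂gaussianPi _ = gaussianMoment N k := by
  have hnonneg : 0 ≤ ∫ z, ((matrixOf z * (matrixOf z)ᴴ : Mat N) ^ k).trace ∂gaussianPi _ :=
    (integral_wordTrace_nonneg fun _ => ((), ())).trans (integral_wordTrace_le _)
  rw [gaussianMoment, eq_re_of_ofReal_le hnonneg]
  exact congrArg ofReal (integral_re (integrable_trace_pow k)).symm

lemma gaussianMoment_nonneg (N k : ℕ) : 0 ≤ gaussianMoment N k := by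
  rw [← zero_le_real, ← integral_trace_pow_eq_gaussianMoment]
  exact (integral_wordTrace_nonneg fun _ => ((), ())).trans (integral_wordTrace_le _)

lemma measurePreserving_inv_sqrt_mul_sum {κ : Type*} [Fintype κ] [NeZero n] :
    MeasurePreserving (fun (y : Fin n × κ → ℂ) (p : κ) => ((√n)⁻¹ : ℝ) * ∑ j, y (j, p))
      (gaussianPi _) (gaussianPi _) := by
  refine measurePreserving_gaussianPi (fun t q => ((√n)⁻¹ : ℝ) * t q.2) (by fun_prop)
    (fun t y => ?_) fun t => ?_
  · rw [Fintype.sum_prod_type_right]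
    refine Finset.sum_congr rfl fun p _ => ?_
    rw [Finset.mul_sum, inner_sum]
    simp only [← real_smul, real_inner_smul_left, real_inner_smul_right]
  · have hn : (n : ℝ) ≠ 0 := Nat.cast_ne_zero.2 (NeZero.ne n)
    simp [Fintype.sum_prod_type, mul_pow, inv_pow, ← Finset.mul_sum, hn]

lemma integral_trace_sum_mul_pow [NeZero n] (k : ℕ) :
    ∫ y, (((∑ j, (tupleOf y : Tuple n N) j) * (∑ j, (tupleOf y : Tuple n N) j)ᴴ) ^ k).trace
      ∂gaussianPi _ = (n : ℂ) ^ k * gaussianMoment N k := by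
  have hcont : Continuous fun z : Fin N × Fin N → ℂ =>
      ((matrixOf z * (matrixOf z)ᴴ : Mat N) ^ k).trace :=
    ((continuous_matrixOf.matrix_mul continuous_matrixOf.matrix_conjTranspose).pow k).matrix_trace
  have hsqrt : (√n : ℂ) * √n = n := by
    rw [← ofReal_mul, Real.mul_self_sqrt n.cast_nonneg, ofReal_natCast]
  have hsqrt_ne : (√n : ℂ) ≠ 0 := fun h => NeZero.ne (n : ℂ) (by rw [← hsqrt, h, mul_zero])
  have hsum (y : Fin n × Fin N × Fin N → ℂ) : ∑ j, (tupleOf y : Tuple n N) j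
      = (√n : ℂ) • matrixOf fun p => ((√n)⁻¹ : ℝ) * ∑ j, y (j, p) := by
    ext a b
    simp [Matrix.sum_apply, hsqrt_ne]
  rw [← integral_trace_pow_eq_gaussianMoment, ← integral_comp_of_measurePreserving
    (measurePreserving_inv_sqrt_mul_sum (n := n)) hcont.aestronglyMeasurable, ← integral_const_mul]
  simp only [hsum, Matrix.conjTranspose_smul, Matrix.smul_mul, Matrix.mul_smul, smul_smul,
    star_def, conj_ofReal, hsqrt, smul_pow, Matrix.trace_smul, smul_eq_mul]

lemma sum_integral_wordTrace [NeZero n] (N k : ℕ) :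
    ∑ w : Fin k → Fin n × Fin n, ∫ y, wordTrace w (tupleOf y : Tuple n N) ∂gaussianPi _
      = (n : ℂ) ^ k * gaussianMoment N k := by
  rw [← integral_finsetSum _ fun w _ => integrable_wordTrace w, ← integral_trace_sum_mul_pow]
  simp only [trace_sum_mul_pow]

lemma integrable_wordTrace_mul_star {n N k : ℕ} (w : Fin k → Fin n × Fin n) :
    Integrable (fun p : (Fin n × Fin N × Fin N → ℂ) × (Fin n × Fin N × Fin N → ℂ) =>
      wordTrace w (tupleOf p.1) * star (wordTrace w (tupleOf p.2)))
      ((gaussianPi _).prod (gaussianPi _)) :=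
  (integrable_wordTrace w).mul_prod
    ((conjCLE : ℂ →L[ℝ] ℂ).integrable_comp (integrable_wordTrace w))

lemma integral_wordTrace_mul_star_le (w : Fin k → Fin n × Fin n) :
    ∫ p : (Fin n × Fin N × Fin N → ℂ) × (Fin n × Fin N × Fin N → ℂ),
      wordTrace w (tupleOf p.1) * star (wordTrace w (tupleOf p.2))
        ∂((gaussianPi _).prod (gaussianPi _))
      ≤ (∫ y, wordTrace w (tupleOf y : Tuple n N) ∂gaussianPi _) * gaussianMoment N k := by
  have hconj : ∫ y, star (wordTrace w (tupleOf y : Tuple n N)) ∂gaussianPi _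
      = ∫ y, wordTrace w (tupleOf y : Tuple n N) ∂gaussianPi _ :=
    integral_conj.trans (conj_eq_iff_im.2 (nonneg_iff.1 (integral_wordTrace_nonneg w)).2.symm)
  rw [integral_prod_mul (fun y => wordTrace w (tupleOf y))
    (fun y => star (wordTrace w (tupleOf y))), hconj, ← integral_trace_pow_eq_gaussianMoment]
  exact mul_le_mul_of_nonneg_left (integral_wordTrace_le w) (integral_wordTrace_nonneg w)

lemma integrable_re_trace_tensorMatrix_pow (n N k : ℕ) :
    Integrable (fun p : (Fin n × Fin N × Fin N → ℂ) × (Fin n × Fin N × Fin N → ℂ) =>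
      ((tensorMatrix (tupleOf p.1) (tupleOf p.2) *
        (tensorMatrix (tupleOf p.1) (tupleOf p.2))ᴴ) ^ k).trace.re)
      ((gaussianPi _).prod (gaussianPi _)) := by
  simp_rw [trace_tensorMatrix_pow]
  exact (integrable_finsetSum _ fun w _ => integrable_wordTrace_mul_star w).re

lemma integral_re_trace_tensorMatrix_pow_le [NeZero n] (N k : ℕ) :
    ∫ p : (Fin n × Fin N × Fin N → ℂ) × (Fin n × Fin N × Fin N → ℂ),
      ((tensorMatrix (tupleOf p.1) (tupleOf p.2) *
        (tensorMatrix (tupleOf p.1) (tupleOf p.2))ᴴ) ^ k).trace.re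
        ∂((gaussianPi _).prod (gaussianPi _)) ≤ n ^ k * gaussianMoment N k ^ 2 := by
  have hsum := Finset.sum_le_sum (s := Finset.univ) fun (w : Fin k → Fin n × Fin n) _ =>
    integral_wordTrace_mul_star_le (N := N) w
  rw [← Finset.sum_mul, sum_integral_wordTrace, mul_assoc, ← sq,
    ← integral_finsetSum _ fun w _ => integrable_wordTrace_mul_star w] at hsum
  simp_rw [trace_tensorMatrix_pow]
  refine (integral_re (integrable_finsetSum _ fun w _ => integrable_wordTrace_mul_star w)).trans_le
    ((le_def.1 hsum).1.trans_eq ?_)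
  exact_mod_cast rfl

end GaussianMoment

section OperatorNorm

section

open scoped Matrix.Norms.Frobenius

lemma opNorm_sq_le_re_trace {m : Type*} [Fintype m] [DecidableEq m] (M : Matrix m m ℂ) :
    ‖Matrix.toEuclideanCLM (𝕜 := ℂ) M‖ ^ 2 ≤ (Mᴴ * M).trace.re := by
  rw [← frobenius_norm_sq_eq_re_trace]
  gcongr
  refine ContinuousLinearMap.opNorm_le_bound _ (norm_nonneg _) fun x => ?_
  calc ‖Matrix.toEuclideanCLM (𝕜 := ℂ) M x‖ = ‖M * Matrix.replicateCol Unit x.ofLp‖ := by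
        rw [← Matrix.replicateCol_mulVec, Matrix.frobenius_norm_replicateCol,
          ← Matrix.ofLp_toEuclideanCLM, WithLp.toLp_ofLp]
    _ ≤ ‖M‖ * ‖x‖ := by
        simpa only [Matrix.frobenius_norm_replicateCol, WithLp.toLp_ofLp] using
          Matrix.frobenius_norm_mul M (Matrix.replicateCol Unit x.ofLp)

end

open scoped Matrix.Norms.L2Operator

variable {m : Type*} [Fintype m] [DecidableEq m]

lemma norm_apply_le_opNorm (M : Matrix m m ℂ) (a b : m) : ‖M a b‖ ≤ ‖M‖ := by
  have hcol : M a b = (WithLp.toLp 2 (M *ᵥ (EuclideanSpace.single b (1 : ℂ)).ofLp)) a := by simp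
  rw [hcol]
  exact (PiLp.norm_apply_le _ a).trans ((M.l2_opNorm_mulVec _).trans (by simp))

lemma norm_trace_le_card_mul_opNorm (M : Matrix m m ℂ) : ‖M.trace‖ ≤ Fintype.card m * ‖M‖ := by
  refine (norm_sum_le_of_le _ fun a _ => norm_apply_le_opNorm M a a).trans_eq ?_
  rw [Finset.sum_const, Finset.card_univ, nsmul_eq_mul]

lemma opNorm_pow_le_re_trace_pow (S : Matrix m m ℂ) (r : ℕ) :
    ‖S‖ ^ (2 * 2 ^ (r + 1)) ≤ ((S * Sᴴ) ^ 2 ^ (r + 1)).trace.re := by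
  have hself : IsSelfAdjoint (S * Sᴴ) := Matrix.isHermitian_mul_conjTranspose_self S
  have hnorm : ‖(S * Sᴴ) ^ 2 ^ r‖ ^ 2 = ‖S‖ ^ (2 * 2 ^ (r + 1)) := by
    rw [hself.norm_pow_two_pow, show ‖S * Sᴴ‖ = ‖S‖ * ‖S‖ from CStarRing.norm_self_mul_star]
    ring
  have hpow : ((S * Sᴴ) ^ 2 ^ r)ᴴ * (S * Sᴴ) ^ 2 ^ r = (S * Sᴴ) ^ 2 ^ (r + 1) := by
    rw [show ((S * Sᴴ) ^ 2 ^ r)ᴴ = (S * Sᴴ) ^ 2 ^ r from hself.pow _, ← pow_add, pow_succ, mul_two]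
  rw [← hnorm, ← hpow]
  exact opNorm_sq_le_re_trace _

end OperatorNorm

section GaussianOperatorNorm

open scoped Matrix.Norms.L2Operator

variable {n N k : ℕ}

lemma re_trace_pow_le (hk : k ≠ 0) (Z : Mat N) :
    ((Z * Zᴴ) ^ k).trace.re ≤ N * (8 ^ k * k.factorial) * Real.exp (‖Z‖ ^ 2 / 8) := by
  have hnorm : ‖(Z * Zᴴ) ^ k‖ ≤ (‖Z‖ ^ 2) ^ k := by
    refine (norm_pow_le' _ (Nat.pos_of_ne_zero hk)).trans_eq ?_
    rw [sq, show ‖Z * Zᴴ‖ = ‖Z‖ * ‖Z‖ from CStarRing.norm_self_mul_star]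
  have hexp := Real.pow_div_factorial_le_exp (‖Z‖ ^ 2 / 8) (by positivity) k
  rw [div_pow, div_div, div_le_iff₀ (by positivity)] at hexp
  calc ((Z * Zᴴ) ^ k).trace.re ≤ ‖((Z * Zᴴ) ^ k).trace‖ := re_le_norm _
    _ ≤ N * ‖(Z * Zᴴ) ^ k‖ := by simpa using norm_trace_le_card_mul_opNorm ((Z * Zᴴ) ^ k)
    _ ≤ N * (Real.exp (‖Z‖ ^ 2 / 8) * (8 ^ k * k.factorial)) := by
        gcongr
        exact hnorm.trans hexp
    _ = _ := by ring

lemma measurePreserving_mulVec {x : EuclideanSpace ℂ (Fin N)} (hx : ‖x‖ = 1) :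
    MeasurePreserving (fun z : Fin N × Fin N → ℂ => matrixOf z *ᵥ x.ofLp)
      (gaussianPi _) (gaussianPi _) := by
  refine measurePreserving_gaussianPi (fun t p => t p.1 * conj (x p.2))
    (continuous_matrixOf.matrix_mulVec continuous_const).measurable (fun t z => ?_) fun t => ?_
  · rw [Fintype.sum_prod_type]
    refine Finset.sum_congr rfl fun a _ => ?_
    rw [Matrix.mulVec, dotProduct, inner_sum]
    refine Finset.sum_congr rfl fun b _ => ?_
    simp only [Complex.inner, map_mul, matrixOf_apply, conj_conj]
    ring_nf
  · have hsq : ∑ b, ‖x b‖ ^ 2 = 1 := by rw [← EuclideanSpace.norm_sq_eq, hx, one_pow]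
    simp only [Fintype.sum_prod_type, norm_mul, mul_pow, RCLike.norm_conj, ← Finset.mul_sum, hsq,
      mul_one]

variable {ι : Type*} [Fintype ι]

lemma integrable_gaussianPi_exp_mul_sum_sq {b : ℝ} (hb : b < 1) :
    Integrable (fun y : ι → ℂ => Real.exp (b * ∑ i, ‖y i‖ ^ 2)) (gaussianPi ι) := by
  simpa only [Finset.mul_sum, Real.exp_sum, gaussianPi] using
    Integrable.fintype_prod (μ := fun _ : ι => gaussianC)
      fun _ => integrable_gaussianC_exp_mul_sq hb

lemma integral_gaussianPi_exp_mul_sum_sq {b : ℝ} (hb : b < 1) :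
    ∫ y, Real.exp (b * ∑ i, ‖y i‖ ^ 2) ∂gaussianPi ι = (1 - b)⁻¹ ^ Fintype.card ι := by
  have h := integral_fintype_prod_eq_prod (𝕜 := ℝ) (ι := ι) (μ := fun _ => gaussianC)
    fun _ z => Real.exp (b * ‖z‖ ^ 2)
  simp only [integral_gaussianC_exp_mul_sq hb, ← Real.exp_sum, ← Finset.mul_sum] at h
  rw [gaussianPi, h, Finset.prod_const, Finset.card_univ]

lemma integrable_exp_mulVec {x : EuclideanSpace ℂ (Fin N)} (hx : ‖x‖ = 1) :
    Integrable (fun z => Real.exp (1 / 2 * ∑ i, ‖((matrixOf z : Mat N) *ᵥ x.ofLp) i‖ ^ 2))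
      (gaussianPi _) :=
  (measurePreserving_mulVec hx).integrable_comp_of_integrable
    (integrable_gaussianPi_exp_mul_sum_sq (by norm_num))

lemma finrank_real_euclideanSpace : finrank ℝ (EuclideanSpace ℂ ι) = 2 * Fintype.card ι := by
  rw [← finrank_mul_finrank ℝ ℂ (EuclideanSpace ℂ ι), finrank_real_complex,
    finrank_euclideanSpace]

variable [NeZero N]

lemma exists_sphere_net : ∃ t : Finset (EuclideanSpace ℂ (Fin N)),
    (∀ x ∈ t, ‖x‖ = 1) ∧ (t.card : ℝ) ≤ 25 ^ N ∧
    ∀ Z : Mat N, ∃ x ∈ t, ‖Z‖ ≤ 2 * ‖Matrix.toEuclideanCLM (𝕜 := ℂ) Z x‖ := by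
  obtain ⟨t, ht, hcard, hnet⟩ := exists_finset_net (E := EuclideanSpace ℂ (Fin N))
    (A := {x | ‖x‖ = 1}) (R := 1) (θ := 1 / 2) zero_le_one (by norm_num) fun x hx => le_of_eq hx
  rw [finrank_real_euclideanSpace, Fintype.card_fin, pow_mul] at hcard
  refine ⟨t, ht, hcard.trans_eq (by norm_num), fun Z => ?_⟩
  obtain ⟨e, he, -⟩ := hnet (EuclideanSpace.single 0 1) (by simp)
  obtain ⟨x, hx, hmax⟩ := t.exists_max_image
    (fun x => ‖Matrix.toEuclideanCLM (𝕜 := ℂ) Z x‖) ⟨e, he⟩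
  refine ⟨x, hx, ?_⟩
  set f := Matrix.toEuclideanCLM (n := Fin N) (𝕜 := ℂ) Z
  have hbound : ‖f‖ ≤ ‖f x‖ + ‖f‖ * (1 / 2) := by
    refine f.opNorm_le_of_unit_norm (by positivity) fun v hv => ?_
    obtain ⟨y, hy, hvy⟩ := hnet v hv
    calc ‖f v‖ = ‖f y + f (v - y)‖ := by rw [← map_add, add_sub_cancel]
      _ ≤ ‖f y‖ + ‖f (v - y)‖ := norm_add_le _ _
      _ ≤ ‖f x‖ + ‖f‖ * (1 / 2) := add_le_add (hmax y hy) (f.le_opNorm_of_le hvy.le)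
  rw [Matrix.cstar_norm_def]
  linarith

lemma exists_exp_opNorm_sq_le_sum : ∃ t : Finset (EuclideanSpace ℂ (Fin N)),
    (∀ x ∈ t, ‖x‖ = 1) ∧ (t.card : ℝ) ≤ 25 ^ N ∧
    ∀ Z : Mat N, Real.exp (‖Z‖ ^ 2 / 8) ≤
      ∑ x ∈ t, Real.exp (1 / 2 * ∑ i, ‖(Z *ᵥ x.ofLp) i‖ ^ 2) := by
  obtain ⟨t, hunit, hcard, hnet⟩ := exists_sphere_net (N := N)
  refine ⟨t, hunit, hcard, fun Z => ?_⟩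
  obtain ⟨x, hx, hxZ⟩ := hnet Z
  refine le_trans (Real.exp_le_exp.2 ?_)
    (Finset.single_le_sum (fun _ _ => (Real.exp_pos _).le) hx)
  have hsq := pow_le_pow_left₀ (norm_nonneg _) hxZ 2
  rw [mul_pow, EuclideanSpace.norm_sq_eq, Matrix.ofLp_toEuclideanCLM] at hsq
  linarith

lemma integrable_exp_opNorm_sq :
    Integrable (fun z => Real.exp (‖(matrixOf z : Mat N)‖ ^ 2 / 8)) (gaussianPi _) := by
  obtain ⟨t, hunit, -, hle⟩ := exists_exp_opNorm_sq_le_sum (N := N)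
  have hcont : Continuous fun z => Real.exp (‖(matrixOf z : Mat N)‖ ^ 2 / 8) :=
    Real.continuous_exp.comp ((continuous_matrixOf.norm.pow 2).div_const 8)
  refine (integrable_finsetSum t fun _ hx => integrable_exp_mulVec (hunit _ hx)).mono'
    hcont.aestronglyMeasurable (.of_forall fun z => ?_)
  rw [Real.norm_of_nonneg (Real.exp_pos _).le]
  exact hle _

lemma integral_exp_opNorm_sq_le :
    ∫ z, Real.exp (‖(matrixOf z : Mat N)‖ ^ 2 / 8) ∂gaussianPi _ ≤ 50 ^ N := by
  obtain ⟨t, hunit, hcard, hle⟩ := exists_exp_opNorm_sq_le_sum (N := N)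
  have hint x (hx : x ∈ t) := integrable_exp_mulVec (hunit x hx)
  have hval x (hx : x ∈ t) : ∫ z, Real.exp (1 / 2 *
      ∑ i, ‖((matrixOf z : Mat N) *ᵥ x.ofLp) i‖ ^ 2) ∂gaussianPi _ = 2 ^ N := by
    rw [integral_comp_of_measurePreserving (measurePreserving_mulVec (hunit x hx))
      (g := fun y => Real.exp (1 / 2 * ∑ i, ‖y i‖ ^ 2))
      (integrable_gaussianPi_exp_mul_sum_sq (by norm_num)).aestronglyMeasurable,
      integral_gaussianPi_exp_mul_sum_sq (by norm_num), Fintype.card_fin]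
    norm_num
  calc _ ≤ ∑ _ ∈ t, (2 : ℝ) ^ N := by
        rw [← Finset.sum_congr rfl hval, ← integral_finsetSum _ hint]
        exact integral_mono integrable_exp_opNorm_sq (integrable_finsetSum t hint) fun z => hle _
    _ ≤ 25 ^ N * 2 ^ N := by
        rw [Finset.sum_const, nsmul_eq_mul]
        gcongr
    _ = 50 ^ N := by rw [← mul_pow]; norm_num

lemma gaussianMoment_le (hk : N ≤ k) (hk2 : k ≤ 2 * N) : gaussianMoment N k ≤ (1600 * N) ^ k := by
  have hk0 : k ≠ 0 := fun h => NeZero.ne N (by omega)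
  have hN : (N : ℝ) ≤ 2 ^ k := mod_cast hk.trans k.lt_two_pow_self.le
  have hfact : (k.factorial : ℝ) ≤ (2 * N) ^ k := by
    exact_mod_cast (Nat.factorial_le_pow k).trans (Nat.pow_le_pow_left hk2 k)
  have h := integral_mono (integrable_trace_pow (m := Fin N) k).re
    (integrable_exp_opNorm_sq.const_mul _) fun z => re_trace_pow_le hk0 (matrixOf z)
  rw [integral_const_mul] at h
  calc gaussianMoment N k
      ≤ N * (8 ^ k * k.factorial) * ∫ z, Real.exp (‖(matrixOf z : Mat N)‖ ^ 2 / 8)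
          ∂gaussianPi _ := h
    _ ≤ 2 ^ k * (8 ^ k * (2 * N) ^ k) * 50 ^ k := by
      gcongr
      exact integral_exp_opNorm_sq_le.trans (pow_le_pow_right₀ (by norm_num) hk)
    _ = (1600 * N) ^ k := by
      rw [← mul_pow, ← mul_pow, ← mul_pow]
      ring

end GaussianOperatorNorm

section GaussianTensorNorm

variable {n N : ℕ}

lemma le_add_mul_pow {a X : ℝ} (ha : 0 < a) (hX : 0 ≤ X) {p : ℕ} (hp : p ≠ 0) :
    X ≤ a + a * (a ^ p)⁻¹ * X ^ p := by
  rcases le_total X a with h | h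
  · exact h.trans (le_add_of_nonneg_right (by positivity))
  · have hpow : X / a ≤ (X / a) ^ p := le_self_pow₀ ((one_le_div ha).2 h) hp
    rw [div_pow, div_le_iff₀ ha] at hpow
    calc X ≤ X ^ p / a ^ p * a := hpow
      _ = a * (a ^ p)⁻¹ * X ^ p := by ring
      _ ≤ _ := le_add_of_nonneg_left ha.le

/-- The order of the trace moments that bound tensor norms: the power of `2` in `(N, 2 * N]` for
`N ≠ 0`. A power of `2` is convenient because it is reached by repeated squaring. -/
def momentOrder (N : ℕ) : ℕ := 2 ^ (Nat.log 2 N + 1)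

lemma le_momentOrder (N : ℕ) : N ≤ momentOrder N := (Nat.lt_pow_succ_log_self one_lt_two N).le

lemma momentOrder_le [NeZero N] : momentOrder N ≤ 2 * N := by
  rw [momentOrder, pow_succ, mul_comm]
  exact Nat.mul_le_mul_left 2 (Nat.pow_log_le_self 2 (NeZero.ne N))

lemma tensorNorm_le_add_re_trace {a : ℝ} (ha : 0 < a) (x y : Tuple n N) :
    tensorNorm x y ≤ a + a * (a ^ (2 * momentOrder N))⁻¹ *
      ((tensorMatrix x y * (tensorMatrix x y)ᴴ) ^ momentOrder N).trace.re := by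
  refine (le_add_mul_pow ha (tensorNorm_nonneg x y) (p := 2 * momentOrder N)
    (by simp [momentOrder])).trans ?_
  gcongr
  exact opNorm_pow_le_re_trace_pow (tensorMatrix x y) _

lemma continuous_tensorNorm : Continuous fun p : Tuple n N × Tuple n N => tensorNorm p.1 p.2 :=
  continuous_tensorOp.norm

lemma integrable_tensorNorm :
    Integrable (fun p : (Fin n × Fin N × Fin N → ℂ) × (Fin n × Fin N × Fin N → ℂ) =>
      tensorNorm (tupleOf p.1) (tupleOf p.2)) ((gaussianPi _).prod (gaussianPi _)) := by
  have hcont := continuous_tensorNorm.comp (((continuous_tupleOf (ι := Fin n) (m := Fin N)).comp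
    continuous_fst).prodMk (continuous_tupleOf.comp continuous_snd))
  have hint := (integrable_re_trace_tensorMatrix_pow n N (momentOrder N)).const_mul
    (1 * (1 ^ (2 * momentOrder N))⁻¹)
  refine ((integrable_const 1).add hint).mono' hcont.aestronglyMeasurable (.of_forall fun p => ?_)
  rw [Real.norm_of_nonneg (tensorNorm_nonneg _ _)]
  exact tensorNorm_le_add_re_trace one_pos _ _

lemma integral_tensorNorm_le [NeZero n] [NeZero N] :
    ∫ p : (Fin n × Fin N × Fin N → ℂ) × (Fin n × Fin N × Fin N → ℂ),
      tensorNorm (tupleOf p.1) (tupleOf p.2) ∂((gaussianPi _).prod (gaussianPi _))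
        ≤ 3200 * N * √n := by
  have hN : (0 : ℝ) < N := Nat.cast_pos.2 (NeZero.pos N)
  have hn : (0 : ℝ) < n := Nat.cast_pos.2 (NeZero.pos n)
  set k := momentOrder N
  set a : ℝ := √n * (1600 * N)
  have ha : 0 < a := by positivity
  have hpow : a ^ (2 * k) = n ^ k * ((1600 * N) ^ k) ^ 2 := by
    rw [mul_pow, pow_mul, Real.sq_sqrt hn.le, ← pow_mul, mul_comm k 2]
  have hmoment := gaussianMoment_le (le_momentOrder N) momentOrder_le
  have hint := (integrable_re_trace_tensorMatrix_pow n N k).const_mul (a * (a ^ (2 * k))⁻¹)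
  have hle := integral_mono integrable_tensorNorm ((integrable_const a).add hint) fun p =>
    tensorNorm_le_add_re_trace ha (tupleOf p.1) (tupleOf p.2)
  rw [integral_add' (integrable_const a) hint, integral_const, probReal_univ, one_smul,
    integral_const_mul] at hle
  refine hle.trans ?_
  calc _ ≤ a + a * (a ^ (2 * k))⁻¹ * (n ^ k * ((1600 * N) ^ k) ^ 2) := by
        gcongr
        refine (integral_re_trace_tensorMatrix_pow_le N k).trans ?_
        gcongr
        exact gaussianMoment_nonneg N k
    _ = 3200 * N * √n := by
        rw [← hpow]
        field_simp
        ring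

end GaussianTensorNorm

section SecondMoments

open scoped Matrix.Norms.Frobenius

variable {ι : Type*} [Fintype ι]

lemma integrable_gaussianPi_sum_sq :
    Integrable (fun y : ι → ℂ => ∑ i, ‖y i‖ ^ 2) (gaussianPi ι) := by
  refine ((integrable_gaussianPi_exp_mul_sum_sq (b := 1 / 2) (by norm_num)).const_mul 2).mono'
    (continuous_finsetSum _ fun i _ => (continuous_apply i).norm.pow 2).aestronglyMeasurable
    (.of_forall fun y => ?_)
  rw [Real.norm_of_nonneg (by positivity)]
  linarith [Real.add_one_le_exp (1 / 2 * ∑ i, ‖y i‖ ^ 2)]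

lemma prod_pow_single {M : Type*} [CommMonoid M] [DecidableEq ι] (y : ι → M) (i : ι) :
    ∏ j, y j ^ (Pi.single i 1 : ι → ℕ) j = y i := by
  simp [Pi.single_apply, pow_ite]

lemma integrable_gaussianPi_mul_conj (i k : ι) :
    Integrable (fun y : ι → ℂ => y i * conj (y k)) (gaussianPi ι) := by
  classical
  simpa only [prod_pow_single] using
    integrable_gaussianPi_monomial (Pi.single i 1 : ι → ℕ) (Pi.single k 1)

lemma integral_gaussianPi_mul_conj [DecidableEq ι] (i k : ι) :
    ∫ y, y i * conj (y k) ∂gaussianPi ι = if i = k then 1 else 0 := by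
  have h := integral_gaussianPi_monomial (Pi.single i 1 : ι → ℕ) (Pi.single k 1)
  simp only [prod_pow_single] at h
  rw [h]
  rcases eq_or_ne i k with rfl | hik
  · simp [Pi.single_apply, apply_ite]
  · have hne : (Pi.single i 1 : ι → ℕ) ≠ Pi.single k 1 := fun h => hik (by
      simpa [Pi.single_apply] using congrFun h i)
    simp only [if_neg hik, if_neg hne, Nat.cast_zero]

end SecondMoments

section Traceless

open scoped Matrix.Norms.Frobenius

variable {n N : ℕ}

/-- The orthogonal projection onto the matrices of trace zero. -/
def tracelessProj (N : ℕ) :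
    EuclideanSpace ℂ (Fin N × Fin N) →L[ℂ] EuclideanSpace ℂ (Fin N × Fin N) :=
  (ℂ ∙ entries (1 : Mat N))ᗮ.starProjection

lemma tracelessProj_entries {ξ : Mat N} (h : ξ.trace = 0) :
    tracelessProj N (entries ξ) = entries ξ := by
  rw [tracelessProj, Submodule.starProjection_eq_self_iff,
    Submodule.mem_orthogonal_singleton_iff_inner_right, inner_entries, Matrix.conjTranspose_one,
    one_mul, h]

lemma exists_tracelessProj_eq_entries (v : EuclideanSpace ℂ (Fin N × Fin N)) :
    ∃ ξ : Mat N, ξ.trace = 0 ∧ tracelessProj N v = entries ξ := by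
  have h : tracelessProj N v ∈ (ℂ ∙ entries (1 : Mat N))ᗮ :=
    Submodule.starProjection_apply_mem _ _
  obtain ⟨ξ, hξ⟩ := entries.surjective (tracelessProj N v)
  rw [← hξ, Submodule.mem_orthogonal_singleton_iff_inner_right, inner_entries,
    Matrix.conjTranspose_one, one_mul] at h
  exact ⟨ξ, h, hξ.symm⟩

/-- The operator `ξ ↦ ∑ x j * ξ * (x j)ᴴ` restricted to the matrices of trace zero and extended by
`0` to the multiples of the identity. -/
def tracelessOp (x : Tuple n N) :
    EuclideanSpace ℂ (Fin N × Fin N) →L[ℂ] EuclideanSpace ℂ (Fin N × Fin N) :=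
  (tensorOp x x).comp (tracelessProj N)

lemma continuous_tracelessOp : Continuous (tracelessOp (n := n) (N := N)) :=
  (continuous_tensorOp.comp (continuous_id.prodMk continuous_id)).clm_comp continuous_const

lemma norm_comp_tracelessProj_le
    (f : EuclideanSpace ℂ (Fin N × Fin N) →L[ℂ] EuclideanSpace ℂ (Fin N × Fin N)) :
    ‖f.comp (tracelessProj N)‖ ≤ ‖f‖ :=
  (f.opNorm_comp_le _).trans
    (mul_le_of_le_one_right (norm_nonneg _) (Submodule.starProjection_norm_le _))

lemma tensorNorm_le_sum (x y : Tuple n N) : tensorNorm x y ≤ ∑ j, ‖x j‖ * ‖y j‖ := by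
  refine tensorNorm_le_of_norm_sum_le (by positivity) fun ξ => ?_
  rw [Finset.sum_mul]
  refine norm_sum_le_of_le _ fun j _ => ?_
  calc ‖x j * ξ * (y j)ᴴ‖ ≤ ‖x j‖ * ‖ξ‖ * ‖(y j)ᴴ‖ :=
        (Matrix.frobenius_norm_mul _ _).trans (by gcongr; exact Matrix.frobenius_norm_mul _ _)
    _ = ‖x j‖ * ‖y j‖ * ‖ξ‖ := by rw [Matrix.frobenius_norm_conjTranspose, mul_right_comm]

lemma integrable_tracelessOp :
    Integrable (fun y => tracelessOp (tupleOf y : Tuple n N)) (gaussianPi _) := by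
  refine integrable_gaussianPi_sum_sq.mono'
    (continuous_tracelessOp.comp continuous_tupleOf).aestronglyMeasurable (.of_forall fun y => ?_)
  calc ‖tracelessOp (tupleOf y : Tuple n N)‖
      ≤ ∑ j, ‖(tupleOf y : Tuple n N) j‖ * ‖(tupleOf y : Tuple n N) j‖ :=
        (norm_comp_tracelessProj_le _).trans (tensorNorm_le_sum _ _)
    _ = ∑ i, ‖y i‖ ^ 2 := by
        simp only [← sq, frobenius_norm_sq_eq_sum, Fintype.sum_prod_type, tupleOf_apply]

lemma integral_sum_conj_apply (ξ : Mat N) (p : Fin N × Fin N) :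
    ∫ y, (∑ j, (tupleOf y : Tuple n N) j * ξ * ((tupleOf y : Tuple n N) j)ᴴ) p.1 p.2 ∂gaussianPi _
      = if p.1 = p.2 then n * ξ.trace else 0 := by
  have hexp (y : Fin n × Fin N × Fin N → ℂ) :
      (∑ j, (tupleOf y : Tuple n N) j * ξ * ((tupleOf y : Tuple n N) j)ᴴ) p.1 p.2
        = ∑ j, ∑ d, ∑ c, ξ c d * (y (j, p.1, c) * conj (y (j, p.2, d))) := by
    simp only [Matrix.sum_apply, Matrix.mul_apply, Finset.sum_mul, tupleOf_apply,
      Matrix.conjTranspose_apply, star_def]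
    congr! 3
    ring
  have hint (j : Fin n) (c d : Fin N) := (integrable_gaussianPi_mul_conj
    (j, p.1, c) (j, p.2, d)).const_mul (ξ c d)
  simp only [hexp]
  rw [integral_finsetSum _ fun j _ => integrable_finsetSum _ fun d _ => integrable_finsetSum _
    fun c _ => hint j c d]
  simp only [integral_finsetSum _ fun d _ => integrable_finsetSum _ fun c _ => hint _ c d,
    integral_finsetSum _ fun c _ => hint _ c _, integral_const_mul, integral_gaussianPi_mul_conj]
  split_ifs with hp <;> simp [hp, Matrix.trace]

lemma integral_tracelessOp : ∫ y, tracelessOp (tupleOf y : Tuple n N) ∂gaussianPi _ = 0 := by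
  ext v p
  obtain ⟨ξ, htrace, hξ⟩ := exists_tracelessProj_eq_entries v
  have hcoord := (EuclideanSpace.proj p : EuclideanSpace ℂ (Fin N × Fin N) →L[ℂ] ℂ)
    |>.integral_comp_comm (integrable_tracelessOp (n := n).apply_continuousLinearMap v)
  simp only [PiLp.proj_apply] at hcoord
  rw [ContinuousLinearMap.integral_apply integrable_tracelessOp, ← hcoord]
  simp only [tracelessOp, ContinuousLinearMap.comp_apply, hξ, tensorOp_entries, entries_apply,
    integral_sum_conj_apply, htrace]
  simp

lemma tensorOp_self_sub_tensorOp_self (x y : Tuple n N) :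
    tensorOp x x - tensorOp y y = tensorOp ((√2)⁻¹ • (x + y)) ((√2)⁻¹ • (x - y))
      + tensorOp ((√2)⁻¹ • (x - y)) ((√2)⁻¹ • (x + y)) := by
  have hhalf : (√2)⁻¹ * (√2)⁻¹ = (1 / 2 : ℝ) := by
    rw [← mul_inv, Real.mul_self_sqrt two_pos.le, one_div]
  ext1 v
  obtain ⟨ξ, rfl⟩ := entries.surjective v
  simp only [sub_apply, add_apply, tensorOp_entries, ← map_sub, ← map_add,
    ← Finset.sum_sub_distrib, ← Finset.sum_add_distrib]
  congr 2 with j : 1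
  have hpolar : (x j + y j) * ξ * ((x j)ᴴ - (y j)ᴴ) + (x j - y j) * ξ * ((x j)ᴴ + (y j)ᴴ)
      = (2 : ℝ) • (x j * ξ * (x j)ᴴ - y j * ξ * (y j)ᴴ) := by
    rw [two_smul]
    noncomm_ring
  simp only [Pi.smul_apply, Pi.add_apply, Pi.sub_apply, Matrix.conjTranspose_smul, star_trivial,
    Matrix.conjTranspose_add, Matrix.conjTranspose_sub, Matrix.smul_mul, Matrix.mul_smul, smul_smul,
    hhalf, ← smul_add, hpolar]
  norm_num

end Traceless

section Symmetrization

open scoped Matrix.Norms.Frobenius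

variable {n N : ℕ}

/-- The rotation `(y, z) ↦ ((y + z) / √2, (y - z) / √2)`. It preserves the law of a pair of Gaussian
vectors and decouples the difference of two quadratic expressions. -/
def rotate {E : Type*} [AddCommGroup E] [Module ℝ E] (p : E × E) : E × E :=
  ((√2)⁻¹ • (p.1 + p.2), (√2)⁻¹ • (p.1 - p.2))

lemma measurePreserving_rotate (ι : Type*) [Fintype ι] :
    MeasurePreserving rotate ((gaussianPi ι).prod (gaussianPi ι))
      ((gaussianPi ι).prod (gaussianPi ι)) := by
  have hsplit : MeasurePreserving (MeasurableEquiv.sumPiEquivProdPi (fun _ : ι ⊕ ι => ℂ))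
      (gaussianPi (ι ⊕ ι)) ((gaussianPi ι).prod (gaussianPi ι)) :=
    measurePreserving_sumPiEquivProdPi fun _ => gaussianC
  let R : (ι ⊕ ι → ℂ) → (ι ⊕ ι → ℂ) := fun y => Sum.elim
    (fun i => (√2)⁻¹ • (y (.inl i) + y (.inr i))) (fun i => (√2)⁻¹ • (y (.inl i) - y (.inr i)))
  have hR : MeasurePreserving R (gaussianPi _) (gaussianPi _) := by
    refine measurePreserving_gaussianPi R (measurable_pi_iff.2 ?_) (fun t y => ?_) fun t => ?_
    · rintro (i | i) <;> simp only [R, Sum.elim_inl, Sum.elim_inr] <;> fun_prop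
    · simp only [Fintype.sum_sum_type, R, Sum.elim_inl, Sum.elim_inr, ← Finset.sum_add_distrib,
        real_inner_smul_left, real_inner_smul_right, inner_add_left, inner_add_right,
        inner_sub_left, inner_sub_right]
      congr! 1
      ring
    · have hhalf : (√2)⁻¹ ^ 2 = (1 / 2 : ℝ) := by rw [inv_pow, Real.sq_sqrt two_pos.le, one_div]
      simp only [Fintype.sum_sum_type, R, Sum.elim_inl, Sum.elim_inr, ← Finset.sum_add_distrib,
        norm_smul, mul_pow, Real.norm_eq_abs, sq_abs, hhalf, ← mul_add]
      refine Finset.sum_congr rfl fun i _ => ?_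
      linarith [parallelogram_law_with_norm ℝ (t (.inl i)) (t (.inr i))]
  exact (hsplit.comp hR).comp (hsplit.symm _)

lemma norm_tracelessOp_sub_le (x y : Tuple n N) :
    ‖tracelessOp x - tracelessOp y‖
      ≤ tensorNorm (rotate (x, y)).1 (rotate (x, y)).2
        + tensorNorm (rotate (x, y)).2 (rotate (x, y)).1 := by
  rw [tracelessOp, tracelessOp, ← ContinuousLinearMap.sub_comp, tensorOp_self_sub_tensorOp_self]
  exact (norm_comp_tracelessProj_le _).trans (norm_add_le _ _)

lemma integral_norm_le_integral_norm_sub {α E : Type*} [MeasurableSpace α] {μ : Measure α}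
    [IsProbabilityMeasure μ] [NormedAddCommGroup E] [NormedSpace ℝ E] [CompleteSpace E]
    {f : α → E} (hf : Integrable f μ) (hmean : ∫ x, f x ∂μ = 0) :
    ∫ x, ‖f x‖ ∂μ ≤ ∫ p, ‖f p.1 - f p.2‖ ∂μ.prod μ := by
  have hdiff : Integrable (fun p : α × α => f p.1 - f p.2) (μ.prod μ) :=
    (hf.comp_fst μ).sub (hf.comp_snd μ)
  rw [integral_prod _ hdiff.norm]
  refine integral_mono hf.norm hdiff.norm.integral_prod_left fun x => ?_
  calc ‖f x‖ = ‖∫ y, (f x - f y) ∂μ‖ := by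
        rw [integral_sub (integrable_const _) hf, hmean, integral_const, probReal_univ, one_smul,
          sub_zero]
    _ ≤ ∫ y, ‖f x - f y‖ ∂μ := norm_integral_le_integral_norm _

lemma integral_norm_tracelessOp_le [NeZero n] [NeZero N] :
    ∫ y, ‖tracelessOp (tupleOf y : Tuple n N)‖ ∂gaussianPi _ ≤ 6400 * N * √n := by
  set γ := gaussianPi (Fin n × Fin N × Fin N)
  let τ (p : (Fin n × Fin N × Fin N → ℂ) × (Fin n × Fin N × Fin N → ℂ)) : ℝ :=
    tensorNorm (tupleOf p.1) (tupleOf p.2)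
  have hrot : MeasurePreserving rotate (γ.prod γ) (γ.prod γ) := measurePreserving_rotate _
  have hτ : Integrable τ (γ.prod γ) := integrable_tensorNorm
  have hswap : Integrable (fun p => τ p.swap) (γ.prod γ) := hτ.swap
  have hint : Integrable (fun p => τ (rotate p)) (γ.prod γ) :=
    hrot.integrable_comp_of_integrable hτ
  have hint_swap : Integrable (fun p => τ (rotate p).swap) (γ.prod γ) :=
    hrot.integrable_comp_of_integrable hswap
  have hF : Integrable (fun y => tracelessOp (tupleOf y : Tuple n N)) γ := integrable_tracelessOp
  calc ∫ y, ‖tracelessOp (tupleOf y : Tuple n N)‖ ∂γ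
      ≤ ∫ p, ‖tracelessOp (tupleOf p.1 : Tuple n N) - tracelessOp (tupleOf p.2)‖ ∂γ.prod γ :=
        integral_norm_le_integral_norm_sub hF integral_tracelessOp
    _ ≤ ∫ p, (τ (rotate p) + τ (rotate p).swap) ∂γ.prod γ :=
        integral_mono ((hF.comp_fst γ).sub (hF.comp_snd γ)).norm (hint.add hint_swap)
          fun p => norm_tracelessOp_sub_le (tupleOf p.1) (tupleOf p.2)
    _ = ∫ p, τ p ∂γ.prod γ + ∫ p, τ p ∂γ.prod γ := by
        rw [integral_add hint hint_swap,
          integral_comp_of_measurePreserving hrot hτ.aestronglyMeasurable,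
          integral_comp_of_measurePreserving hrot hswap.aestronglyMeasurable,
          integral_prod_swap τ]
    _ ≤ 6400 * N * √n := by linarith [integral_tensorNorm_le (n := n) (N := N)]

end Symmetrization

section Modulus

variable {m : Type*} [Fintype m] [DecidableEq m]

open scoped ComplexOrder MatrixOrder Matrix.Norms.L2Operator

/-- The modulus `|A| = (Aᴴ * A)^(1/2)` of a square matrix. -/
def modulus (A : Matrix m m ℂ) : Matrix m m ℂ := CFC.abs A

lemma modulus_posSemidef (A : Matrix m m ℂ) : (modulus A).PosSemidef :=
  Matrix.nonneg_iff_posSemidef.1 (CFC.abs_nonneg A)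

lemma modulus_mul_self (A : Matrix m m ℂ) : modulus A * modulus A = Aᴴ * A := CFC.abs_mul_abs A

lemma conjTranspose_modulus (A : Matrix m m ℂ) : (modulus A)ᴴ = modulus A :=
  (modulus_posSemidef A).isHermitian

lemma continuous_modulus : Continuous (modulus : Matrix m m ℂ → Matrix m m ℂ) :=
  CFC.continuous_abs

omit [DecidableEq m] in
lemma exists_eq_conjTranspose_mul_self {H : Matrix m m ℂ} (hH : H.PosSemidef) :
    ∃ R : Matrix m m ℂ, H = Rᴴ * R := by
  classical
  exact CStarAlgebra.nonneg_iff_eq_star_mul_self.1 hH.nonneg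

lemma modulus_eq_of_mul_self {A H : Matrix m m ℂ} (hH : H.PosSemidef) (h : H * H = Aᴴ * A) :
    modulus A = H :=
  CFC.sqrt_unique h (Matrix.nonneg_iff_posSemidef.2 hH)

lemma modulus_mul_unitary {V : Matrix m m ℂ} (hV : V ∈ Matrix.unitaryGroup m ℂ)
    (A : Matrix m m ℂ) : modulus (A * V) = Vᴴ * modulus A * V := by
  refine modulus_eq_of_mul_self ((modulus_posSemidef A).conjTranspose_mul_mul_same V) ?_
  calc Vᴴ * modulus A * V * (Vᴴ * modulus A * V)
      = Vᴴ * modulus A * (V * Vᴴ) * modulus A * V := by simp only [Matrix.mul_assoc]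
    _ = Vᴴ * (modulus A * modulus A) * V := by
      rw [self_mul_conjTranspose_of_unitary hV, Matrix.mul_one, Matrix.mul_assoc Vᴴ]
    _ = (A * V)ᴴ * (A * V) := by
      rw [modulus_mul_self, Matrix.conjTranspose_mul]; simp only [Matrix.mul_assoc]

lemma exists_eq_smul_one_of_unitary_commute {A : Matrix m m ℂ}
    (hA : ∀ U ∈ Matrix.unitaryGroup m ℂ, Commute U A) : ∃ c : ℂ, A = c • 1 := by
  have hcomm (B : Matrix m m ℂ) : Commute B A := by
    have hB : B ∈ Submodule.span ℂ (unitary (Matrix m m ℂ) : Set (Matrix m m ℂ)) :=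
      CStarAlgebra.span_unitary (Matrix m m ℂ) ▸ Submodule.mem_top
    induction hB using Submodule.span_induction with
    | mem U hU => exact hA U hU
    | zero => exact Commute.zero_left A
    | add B C _ _ hB hC => exact hB.add_left hC
    | smul c B _ hB => exact hB.smul_left c
  obtain ⟨c, rfl⟩ := Matrix.mem_range_scalar_of_commute_single fun i j _ => hcomm (.single i j 1)
  exact ⟨c, (Matrix.smul_one_eq_diagonal c).symm⟩

end Modulus

section PolarDecomposition

variable {m : Type*} [Fintype m] [DecidableEq m]

lemma exists_linearIsometryEquiv_apply_eq {𝕜 V E : Type*} [RCLike 𝕜] [AddCommGroup V] [Module 𝕜 V]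
    [NormedAddCommGroup E] [InnerProductSpace 𝕜 E] [FiniteDimensional 𝕜 E] {f g : V →ₗ[𝕜] E}
    (h : ∀ x, ‖f x‖ = ‖g x‖) : ∃ e : E ≃ₗᵢ[𝕜] E, ∀ x, e (g x) = f x := by
  obtain ⟨s, hs⟩ := g.rangeRestrict.exists_rightInverse_of_surjective g.range_rangeRestrict
  have hs' (y : LinearMap.range g) : g (s y) = y := congrArg Subtype.val (LinearMap.congr_fun hs y)
  let isometry : LinearMap.range g →ₗᵢ[𝕜] E :=
    { toLinearMap := f ∘ₗ s
      norm_map' := fun y => by rw [LinearMap.comp_apply, h, hs', Submodule.coe_norm] }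
  refine ⟨isometry.extend.toLinearIsometryEquiv rfl, fun x => ?_⟩
  have hext : isometry.extend (g x) = f (s (g.rangeRestrict x)) :=
    isometry.extend_apply (g.rangeRestrict x)
  rw [LinearIsometry.coe_toLinearIsometryEquiv, hext, ← sub_eq_zero, ← norm_eq_zero, ← map_sub, h,
    map_sub, hs', LinearMap.codRestrict_apply, sub_self, norm_zero]

lemma norm_toEuclideanCLM_sq (A : Matrix m m ℂ) (x : EuclideanSpace ℂ m) :
    ((‖Matrix.toEuclideanCLM (𝕜 := ℂ) A x‖ ^ 2 : ℝ) : ℂ)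
      = inner ℂ x (Matrix.toEuclideanCLM (𝕜 := ℂ) (Aᴴ * A) x) := by
  rw [map_mul, ← Matrix.star_eq_conjTranspose, map_star, ContinuousLinearMap.star_eq_adjoint,
    mul_apply_eq_comp, ContinuousLinearMap.adjoint_inner_right,
    inner_self_eq_norm_sq_to_K]
  simp

lemma norm_toEuclideanCLM_modulus (A : Matrix m m ℂ) (x : EuclideanSpace ℂ m) :
    ‖Matrix.toEuclideanCLM (𝕜 := ℂ) (modulus A) x‖ = ‖Matrix.toEuclideanCLM (𝕜 := ℂ) A x‖ := by
  refine (pow_left_inj₀ (norm_nonneg _) (norm_nonneg _) two_ne_zero).1 (ofReal_injective ?_)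
  rw [norm_toEuclideanCLM_sq, norm_toEuclideanCLM_sq, conjTranspose_modulus, modulus_mul_self]

lemma exists_eq_unitary_mul_modulus (A : Matrix m m ℂ) :
    ∃ W ∈ Matrix.unitaryGroup m ℂ, A = W * modulus A := by
  obtain ⟨e, he⟩ := exists_linearIsometryEquiv_apply_eq
    (f := (Matrix.toEuclideanCLM (𝕜 := ℂ) A).toLinearMap)
    (g := (Matrix.toEuclideanCLM (𝕜 := ℂ) (modulus A)).toLinearMap)
    fun x => (norm_toEuclideanCLM_modulus A x).symm
  let u := Unitary.linearIsometryEquiv.symm e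
  let Φ := Matrix.toEuclideanCLM (n := m) (𝕜 := ℂ)
  refine ⟨Φ.symm u, Unitary.map_mem Φ.symm u.2, Φ.injective ?_⟩
  calc Φ A = u * Φ (modulus A) := ContinuousLinearMap.ext fun x => (he x).symm
    _ = Φ (Φ.symm u * modulus A) := by rw [map_mul Φ, StarAlgEquiv.apply_symm_apply]

end PolarDecomposition

section EquivariantMaps

variable {m : Type*} [Fintype m] [DecidableEq m]

lemma diagonal_mem_unitaryGroup {d : m → ℂ} (hd : ∀ i, d i * conj (d i) = 1) :
    Matrix.diagonal d ∈ Matrix.unitaryGroup m ℂ := by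
  rw [Matrix.mem_unitaryGroup_iff, Matrix.star_eq_conjTranspose, Matrix.diagonal_conjTranspose,
    Matrix.diagonal_mul_diagonal, ← Matrix.diagonal_one]
  exact congrArg _ (funext hd)

lemma permMatrix_mem_unitaryGroup (σ : Equiv.Perm m) :
    σ.permMatrix ℂ ∈ Matrix.unitaryGroup m ℂ := by
  rw [Matrix.mem_unitaryGroup_iff, Matrix.star_eq_conjTranspose, Matrix.conjTranspose_permMatrix,
    ← Matrix.permMatrix_mul, inv_mul_cancel, Matrix.permMatrix_one]

lemma permMatrix_mul_mul_conjTranspose (σ : Equiv.Perm m) (ξ : Matrix m m ℂ) :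
    σ.permMatrix ℂ * ξ * (σ.permMatrix ℂ)ᴴ = ξ.submatrix σ σ := by
  rw [Matrix.conjTranspose_permMatrix, PEquiv.toMatrix_toPEquiv_mul, PEquiv.mul_toMatrix_toPEquiv]
  rfl

omit [Fintype m] in
lemma exists_eq_ite_of_forall_perm {α : Type*} [Nonempty α] {φ : m → m → α}
    (h : ∀ (σ : Equiv.Perm m) i j, φ (σ i) (σ j) = φ i j) :
    ∃ a b, ∀ i j, φ i j = if i = j then a else b := by
  obtain ⟨a, ha⟩ : ∃ a, ∀ i, φ i i = a := by
    rcases isEmpty_or_nonempty m with _ | ⟨⟨i₀⟩⟩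
    · exact ⟨Classical.arbitrary α, isEmptyElim⟩
    · exact ⟨φ i₀ i₀, fun i => by simpa using h (Equiv.swap i₀ i) i₀ i₀⟩
  obtain ⟨b, hb⟩ : ∃ b, ∀ i j, i ≠ j → φ i j = b := by
    rcases subsingleton_or_nontrivial m with _ | _
    · exact ⟨Classical.arbitrary α, fun i j hij => (hij (Subsingleton.elim i j)).elim⟩
    · obtain ⟨i₀, j₀, h₀⟩ := exists_pair_ne m
      refine ⟨φ i₀ j₀, fun i j hij => ?_⟩
      obtain ⟨σ, rfl, rfl⟩ := MulAction.is_two_pretransitive_iff.1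
        (Equiv.Perm.isMultiplyPretransitive m 2) h₀ hij
      exact h σ i₀ j₀
  refine ⟨a, b, fun i j => ?_⟩
  split_ifs with hij
  · exact hij ▸ ha i
  · exact hb i j hij

/-- A linear map on matrices is unitarily equivariant if it commutes with the conjugation by every
unitary matrix. -/
def UnitarilyEquivariant (Φ : Matrix m m ℂ →ₗ[ℂ] Matrix m m ℂ) : Prop :=
  ∀ U ∈ Matrix.unitaryGroup m ℂ, ∀ ξ, Φ (U * ξ * Uᴴ) = U * Φ ξ * Uᴴ

namespace UnitarilyEquivariant

variable {Φ Ψ : Matrix m m ℂ →ₗ[ℂ] Matrix m m ℂ}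

lemma map_submatrix (hΦ : UnitarilyEquivariant Φ) (σ : Equiv.Perm m) (ξ : Matrix m m ℂ) :
    Φ (ξ.submatrix σ σ) = (Φ ξ).submatrix σ σ := by
  simpa only [permMatrix_mul_mul_conjTranspose] using hΦ _ (permMatrix_mem_unitaryGroup σ) ξ

lemma map_diagonal_apply_ne (hΦ : UnitarilyEquivariant Φ) (d : m → ℂ) {i j : m} (hij : i ≠ j) :
    Φ (Matrix.diagonal d) i j = 0 := by
  let s : m → ℂ := fun k => if k = i then -1 else 1
  have hs (k : m) : s k * conj (s k) = 1 := by by_cases hk : k = i <;> simp [s, hk]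
  have hconj : Matrix.diagonal s * Matrix.diagonal d * (Matrix.diagonal s)ᴴ
      = Matrix.diagonal d := by
    rw [Matrix.diagonal_conjTranspose, Matrix.diagonal_mul_diagonal, Matrix.diagonal_mul_diagonal]
    exact congrArg _ (funext fun k => by
      rw [mul_right_comm, Pi.star_apply, ← starRingEnd_apply, hs, one_mul])
  have happly := congrFun (congrFun (hΦ _ (diagonal_mem_unitaryGroup hs) (.diagonal d)) i) j
  rw [hconj, Matrix.diagonal_conjTranspose, Matrix.mul_diagonal, Matrix.diagonal_mul] at happly
  have hneg : Φ (Matrix.diagonal d) i j = -Φ (Matrix.diagonal d) i j := by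
    simpa [s, hij.symm] using happly
  exact self_eq_neg.1 hneg

lemma exists_map_single (hΦ : UnitarilyEquivariant Φ) :
    ∃ β b : ℂ, ∀ i, Φ (.single i i 1) = β • .single i i 1 + b • 1 := by
  have hsingle (i : m) : Matrix.single i i (1 : ℂ) = Matrix.diagonal (Pi.single i 1) :=
    (Matrix.diagonal_single i 1).symm
  obtain ⟨a, b, hab⟩ := exists_eq_ite_of_forall_perm (φ := fun i j => Φ (.single i i 1) j j)
    fun σ i j => by
      have hσ : (Matrix.single (σ i) (σ i) (1 : ℂ)).submatrix σ σ = .single i i 1 := by simp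
      rw [← hσ, hΦ.map_submatrix]
      rfl
  refine ⟨a - b, b, fun i => ?_⟩
  ext j k
  rcases eq_or_ne j k with rfl | hjk
  · rw [hab]
    rcases eq_or_ne i j with rfl | hij <;> simp [*]
  · rw [hsingle, hΦ.map_diagonal_apply_ne _ hjk]
    simp [hjk]

lemma smul_add_trace (β b : ℂ) : UnitarilyEquivariant
    (β • LinearMap.id + b • (Matrix.traceLinearMap m ℂ ℂ).smulRight (1 : Matrix m m ℂ)) := by
  intro U hU ξ
  have htrace : (U * ξ * Uᴴ).trace = ξ.trace := by
    rw [Matrix.trace_mul_comm, ← Matrix.mul_assoc, conjTranspose_mul_self_of_unitary hU,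
      Matrix.one_mul]
  simp [htrace, Matrix.mul_add, Matrix.add_mul, self_mul_conjTranspose_of_unitary hU]

lemma eq_of_map_single (hΦ : UnitarilyEquivariant Φ) (hΨ : UnitarilyEquivariant Ψ)
    (h : ∀ i, Φ (.single i i 1) = Ψ (.single i i 1)) : Φ = Ψ := by
  have hdiagonal : Φ ∘ₗ Matrix.diagonalLinearMap m ℂ ℂ = Ψ ∘ₗ Matrix.diagonalLinearMap m ℂ ℂ :=
    LinearMap.pi_ext' fun i => LinearMap.ext_ring (by
      change Φ (.diagonal (Pi.single i 1)) = Ψ (.diagonal (Pi.single i 1))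
      rw [Matrix.diagonal_single, h i])
  refine LinearMap.ext_on span_selfAdjoint fun ξ hξ => ?_
  have hξ' : ξ.IsHermitian := hξ
  have hspec := hξ'.spectral_theorem
  rw [Unitary.conjStarAlgAut_apply, Matrix.star_eq_conjTranspose] at hspec
  rw [hspec, hΦ _ hξ'.eigenvectorUnitary.2, hΨ _ hξ'.eigenvectorUnitary.2]
  exact congrArg (fun M => _ * M * _) (LinearMap.congr_fun hdiagonal _)

lemma exists_eq_smul_add_trace (hΦ : UnitarilyEquivariant Φ) :
    ∃ β b : ℂ, ∀ ξ, Φ ξ = β • ξ + (b * ξ.trace) • 1 := by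
  obtain ⟨β, b, hsingle⟩ := hΦ.exists_map_single
  refine ⟨β, b, fun ξ => ?_⟩
  rw [hΦ.eq_of_map_single (smul_add_trace β b) fun i => by rw [hsingle i]; simp]
  simp [mul_smul]

end UnitarilyEquivariant

end EquivariantMaps

section UnitaryInvariance

open scoped Matrix.Norms.Frobenius

variable {ι m p : Type*} [Fintype ι] [Fintype m] [Fintype p]

lemma sum_inner_apply_eq_re_trace (A B : Matrix m p ℂ) :
    ∑ q : m × p, inner ℝ (A q.1 q.2) (B q.1 q.2) = (Aᴴ * B).trace.re := by
  simp only [Fintype.sum_prod_type, Matrix.trace, Matrix.diag, Matrix.mul_apply,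
    Matrix.conjTranspose_apply, re_sum, Complex.inner, mul_comm, starRingEnd_apply]
  exact Finset.sum_comm

lemma sum_norm_apply_sq (A : Matrix m p ℂ) : ∑ q : m × p, ‖A q.1 q.2‖ ^ 2 = ‖A‖ ^ 2 := by
  rw [frobenius_norm_sq_eq_sum, Fintype.sum_prod_type]

lemma measurePreserving_fst_eq (j : ι) :
    MeasurePreserving (fun (y : ι × m → ℂ) q => y (j, q)) (gaussianPi _) (gaussianPi _) := by
  classical
  refine measurePreserving_gaussianPi (fun t q => if q.1 = j then t q.2 else 0)
    (measurable_pi_lambda _ fun q => measurable_pi_apply _) (fun t y => ?_) fun t => ?_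
  all_goals
    rw [Fintype.sum_prod_type (f := fun q : ι × m => _),
      Finset.sum_eq_single j (fun i _ hi => by simp [hi]) (by simp)]
    simp

variable [DecidableEq m]

lemma measurePreserving_unitary_mul {u : ι → Matrix m m ℂ}
    (hu : ∀ j, u j ∈ Matrix.unitaryGroup m ℂ) :
    MeasurePreserving (fun y (q : ι × m × m) =>
        (u q.1 * tupleOf y q.1 : Matrix m m ℂ) q.2.1 q.2.2)
      (gaussianPi _) (gaussianPi _) := by
  have hcont (j : ι) : Continuous fun y => (u j * tupleOf y j : Matrix m m ℂ) :=
    continuous_const.matrix_mul ((continuous_apply j).comp continuous_tupleOf)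
  refine measurePreserving_gaussianPi
    (fun t (q : ι × m × m) => ((u q.1)ᴴ * tupleOf t q.1 : Matrix m m ℂ) q.2.1 q.2.2)
    (measurable_pi_lambda _ fun q => ((hcont q.1).matrix_elem q.2.1 q.2.2).measurable)
    (fun t y => ?_) fun t => ?_
  · simp only [Fintype.sum_prod_type (α₁ := ι)]
    refine Finset.sum_congr rfl fun j _ => ?_
    have hleft := sum_inner_apply_eq_re_trace (tupleOf t j) (u j * tupleOf y j)
    have hright := sum_inner_apply_eq_re_trace ((u j)ᴴ * tupleOf t j) (tupleOf y j)
    rw [Matrix.conjTranspose_mul, Matrix.conjTranspose_conjTranspose, Matrix.mul_assoc] at hright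
    exact hleft.trans hright.symm
  · simp only [Fintype.sum_prod_type (α₁ := ι)]
    refine Finset.sum_congr rfl fun j _ => ?_
    have hleft := sum_norm_apply_sq ((u j)ᴴ * tupleOf t j)
    rw [frobenius_norm_unitary_mul (conjTranspose_mem_unitaryGroup (hu j))] at hleft
    exact hleft.trans (sum_norm_apply_sq (tupleOf t j)).symm

lemma measurePreserving_mul_unitary {V : Matrix m m ℂ} (hV : V ∈ Matrix.unitaryGroup m ℂ) :
    MeasurePreserving (fun z (q : m × m) => (matrixOf z * V : Matrix m m ℂ) q.1 q.2)
      (gaussianPi _) (gaussianPi _) := by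
  have hcont : Continuous fun z => (matrixOf z * V : Matrix m m ℂ) :=
    continuous_matrixOf.matrix_mul continuous_const
  refine measurePreserving_gaussianPi
    (fun t (q : m × m) => (matrixOf t * Vᴴ : Matrix m m ℂ) q.1 q.2)
    (measurable_pi_lambda _ fun q => (hcont.matrix_elem q.1 q.2).measurable)
    (fun t y => ?_) fun t => ?_
  · have hleft := sum_inner_apply_eq_re_trace (matrixOf t) (matrixOf y * V)
    have hright := sum_inner_apply_eq_re_trace (matrixOf t * Vᴴ) (matrixOf y)
    rw [Matrix.conjTranspose_mul, Matrix.conjTranspose_conjTranspose, Matrix.mul_assoc,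
      Matrix.trace_mul_comm, Matrix.mul_assoc] at hright
    exact hleft.trans hright.symm
  · rw [sum_norm_apply_sq, frobenius_norm_mul_unitary (conjTranspose_mem_unitaryGroup hV)]
    exact (sum_norm_apply_sq (matrixOf t)).symm

end UnitaryInvariance

section MatrixIntegrals

open scoped Matrix.Norms.L2Operator

variable {Ω m : Type*} [MeasurableSpace Ω] {μ : Measure Ω} [Fintype m] [DecidableEq m]
  {F : Ω → Matrix m m ℂ}

lemma integral_matrix_apply (hF : Integrable F μ) (i j : m) :
    (∫ ω, F ω ∂μ) i j = ∫ ω, F ω i j ∂μ :=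
  (((Matrix.entryLinearMap ℂ ℂ i j).toContinuousLinearMap).integral_comp_comm hF).symm

lemma integrable_matrix_apply (hF : Integrable F μ) (i j : m) :
    Integrable (fun ω => F ω i j) μ :=
  ((Matrix.entryLinearMap ℂ ℂ i j).toContinuousLinearMap).integrable_comp hF

end MatrixIntegrals

section ModulusIntegrals

open scoped Matrix.Norms.L2Operator

variable {m : Type*} [Fintype m] [DecidableEq m]

lemma opNorm_modulus (A : Matrix m m ℂ) : ‖modulus A‖ = ‖A‖ := by
  have h : ‖modulus A‖ * ‖modulus A‖ = ‖A‖ * ‖A‖ := by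
    rw [← Matrix.l2_opNorm_conjTranspose_mul_self, ← Matrix.l2_opNorm_conjTranspose_mul_self,
      conjTranspose_modulus, modulus_mul_self]
  exact (mul_self_inj (norm_nonneg _) (norm_nonneg _)).1 h

lemma trace_modulus_eq_re (A : Matrix m m ℂ) : (modulus A).trace = (modulus A).trace.re := by
  open scoped ComplexOrder in
  exact Complex.ext rfl (Complex.le_def.1 (modulus_posSemidef A).trace_nonneg).2.symm

lemma continuous_modulus_matrixOf : Continuous fun z : m × m → ℂ => modulus (matrixOf z) :=
  continuous_modulus.comp continuous_matrixOf

lemma integrable_opNorm_matrixOf_sq :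
    Integrable (fun z : m × m → ℂ => ‖matrixOf z‖ ^ 2) (gaussianPi _) := by
  refine integrable_gaussianPi_sum_sq.mono' (continuous_matrixOf.norm.pow 2).aestronglyMeasurable
    (.of_forall fun z => ?_)
  rw [Real.norm_of_nonneg (sq_nonneg _)]
  refine (opNorm_sq_le_re_trace _).trans_eq ?_
  rw [← sum_inner_apply_eq_re_trace]
  simp only [real_inner_self_eq_norm_sq, matrixOf_apply]

lemma integrable_modulus :
    Integrable (fun z : m × m → ℂ => modulus (matrixOf z)) (gaussianPi _) := by
  refine ((integrable_const 1).add integrable_opNorm_matrixOf_sq).mono'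
    continuous_modulus_matrixOf.aestronglyMeasurable (.of_forall fun z => ?_)
  rw [opNorm_modulus, Pi.add_apply]
  nlinarith [sq_nonneg (‖matrixOf z‖ - 1), sq_nonneg ‖matrixOf z‖]

lemma integrable_modulus_mul_mul_modulus (ξ : Matrix m m ℂ) :
    Integrable (fun z : m × m → ℂ => modulus (matrixOf z) * ξ * modulus (matrixOf z))
      (gaussianPi _) := by
  refine (integrable_opNorm_matrixOf_sq.mul_const ‖ξ‖).mono'
    ((continuous_modulus_matrixOf.matrix_mul continuous_const).matrix_mul
      continuous_modulus_matrixOf).aestronglyMeasurable (.of_forall fun z => ?_)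
  calc _ ≤ ‖modulus (matrixOf z)‖ * ‖ξ‖ * ‖modulus (matrixOf z)‖ := norm_mul₃_le
    _ = ‖matrixOf z‖ ^ 2 * ‖ξ‖ := by rw [opNorm_modulus]; ring

lemma integral_comp_conj_modulus {E : Type*} [NormedAddCommGroup E] [NormedSpace ℝ E]
    {V : Matrix m m ℂ} (hV : V ∈ Matrix.unitaryGroup m ℂ) {F : Matrix m m ℂ → E}
    (hF : Continuous F) : ∫ z, F (Vᴴ * modulus (matrixOf z) * V) ∂gaussianPi (m × m)
      = ∫ z, F (modulus (matrixOf z)) ∂gaussianPi (m × m) := by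
  simp only [← modulus_mul_unitary hV]
  exact integral_comp_of_measurePreserving (measurePreserving_mul_unitary hV)
    (hF.comp continuous_modulus_matrixOf).aestronglyMeasurable

lemma exists_integral_modulus_eq_smul_one :
    ∃ c : ℂ, ∫ z, modulus (matrixOf z) ∂gaussianPi (m × m) = c • 1 := by
  refine exists_eq_smul_one_of_unitary_commute fun V hV => ?_
  calc V * ∫ z, modulus (matrixOf z) ∂gaussianPi (m × m)
      = ∫ z, V * modulus (matrixOf z) ∂gaussianPi (m × m) :=
        (integral_const_mul_of_integrable integrable_modulus).symm
    _ = ∫ z, V * (Vᴴ * modulus (matrixOf z) * V) ∂gaussianPi (m × m) :=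
        (integral_comp_conj_modulus hV (continuous_const.matrix_mul continuous_id)).symm
    _ = ∫ z, modulus (matrixOf z) * V ∂gaussianPi (m × m) := by
        simp only [← Matrix.mul_assoc, self_mul_conjTranspose_of_unitary hV, Matrix.one_mul]
    _ = (∫ z, modulus (matrixOf z) ∂gaussianPi (m × m)) * V :=
        integral_mul_const_of_integrable integrable_modulus

variable (m) in
/-- The map `ξ ↦ E |Z| ξ |Z|`, where `Z` is a Gaussian matrix. It is unitarily equivariant, hence a
multiple of the identity on matrices of trace zero. -/
def modulusMap : Matrix m m ℂ →ₗ[ℂ] Matrix m m ℂ where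
  toFun ξ := ∫ z, modulus (matrixOf z) * ξ * modulus (matrixOf z) ∂gaussianPi (m × m)
  map_add' ξ η := by
    rw [← integral_add (integrable_modulus_mul_mul_modulus ξ)
      (integrable_modulus_mul_mul_modulus η)]
    simp only [Matrix.mul_add, Matrix.add_mul]
  map_smul' r ξ := by
    rw [RingHom.id_apply, ← integral_smul]
    simp only [Matrix.mul_smul, Matrix.smul_mul]

lemma modulusMap_apply (ξ : Matrix m m ℂ) : modulusMap m ξ
    = ∫ z, modulus (matrixOf z) * ξ * modulus (matrixOf z) ∂gaussianPi (m × m) := rfl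

lemma unitarilyEquivariant_modulusMap : UnitarilyEquivariant (modulusMap m) := by
  intro V hV ξ
  have hint := integrable_modulus_mul_mul_modulus ξ
  have hcont : Continuous fun M : Matrix m m ℂ => V * (M * ξ * M) * Vᴴ :=
    (continuous_const.matrix_mul ((continuous_id.matrix_mul continuous_const).matrix_mul
      continuous_id)).matrix_mul continuous_const
  have hconj (M : Matrix m m ℂ) :
      V * (Vᴴ * M * V * ξ * (Vᴴ * M * V)) * Vᴴ = M * (V * ξ * Vᴴ) * M := by
    calc _ = V * Vᴴ * (M * (V * ξ * Vᴴ) * M) * (V * Vᴴ) := by simp only [Matrix.mul_assoc]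
      _ = _ := by rw [self_mul_conjTranspose_of_unitary hV, Matrix.one_mul, Matrix.mul_one]
  rw [modulusMap_apply, modulusMap_apply, ← integral_const_mul_of_integrable hint,
    ← integral_mul_const_of_integrable (hint.const_mul V), ← integral_comp_conj_modulus hV hcont]
  simp only [hconj]

lemma modulusMap_one : modulusMap m 1 = (Fintype.card m : ℂ) • 1 := by
  ext a b
  have hentry (z : m × m → ℂ) : (modulus (matrixOf z) * 1 * modulus (matrixOf z) : Matrix m m ℂ) a b
      = ∑ c, z (c, b) * conj (z (c, a)) := by
    rw [Matrix.mul_one, modulus_mul_self, Matrix.mul_apply]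
    exact Finset.sum_congr rfl fun c _ => by simp [mul_comm]
  rw [modulusMap_apply, integral_matrix_apply (integrable_modulus_mul_mul_modulus 1)]
  simp only [hentry]
  rw [integral_finsetSum _ fun c _ => integrable_gaussianPi_mul_conj _ _]
  simp [integral_gaussianPi_mul_conj, Matrix.one_apply, eq_comm]

lemma mul_single_mul_apply (A B : Matrix m m ℂ) (a b : m) :
    (A * Matrix.single a b 1 * B : Matrix m m ℂ) a b = A a a * B b b := by
  simp [Matrix.mul_apply, Matrix.single_apply, ite_and]

lemma trace_modulus_sq (A : Matrix m m ℂ) : (((modulus A).trace.re ^ 2 : ℝ) : ℂ)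
    = ∑ a, ∑ b, (modulus A * Matrix.single a b 1 * modulus A : Matrix m m ℂ) a b := by
  rw [ofReal_pow, ← trace_modulus_eq_re]
  simp only [mul_single_mul_apply, sq, Matrix.trace, Matrix.diag_apply, Finset.sum_mul_sum]

lemma integrable_re_trace_modulus_sq :
    Integrable (fun z : m × m → ℂ => (modulus (matrixOf z)).trace.re ^ 2) (gaussianPi _) := by
  have hint : Integrable (fun z : m × m → ℂ => ∑ a, ∑ b,
      (modulus (matrixOf z) * Matrix.single a b 1 * modulus (matrixOf z) : Matrix m m ℂ) a b)
      (gaussianPi _) :=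
    integrable_finsetSum _ fun a _ => integrable_finsetSum _ fun b _ =>
      integrable_matrix_apply (integrable_modulus_mul_mul_modulus _) a b
  simp only [← trace_modulus_sq] at hint
  simpa only [RCLike.re_eq_complex_re, ofReal_re] using hint.re

lemma sum_modulusMap_single : ∑ a, ∑ b, modulusMap m (.single a b 1) a b
    = ((∫ z, (modulus (matrixOf z)).trace.re ^ 2 ∂gaussianPi (m × m) : ℝ) : ℂ) := by
  have hint (a b : m) : Integrable (fun z : m × m → ℂ =>
      (modulus (matrixOf z) * Matrix.single a b 1 * modulus (matrixOf z) : Matrix m m ℂ) a b)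
      (gaussianPi _) :=
    integrable_matrix_apply (integrable_modulus_mul_mul_modulus _) a b
  rw [← integral_complex_ofReal]
  simp only [trace_modulus_sq, modulusMap_apply]
  rw [integral_finsetSum _ fun a _ => integrable_finsetSum _ fun b _ => hint a b]
  refine Finset.sum_congr rfl fun a _ => ?_
  rw [integral_finsetSum _ fun b _ => hint a b]
  exact Finset.sum_congr rfl fun b _ =>
    integral_matrix_apply (integrable_modulus_mul_mul_modulus _) a b

lemma integrable_re_trace_modulus :
    Integrable (fun z : m × m → ℂ => (modulus (matrixOf z)).trace.re) (gaussianPi _) :=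
  (integrable_finsetSum _ fun a _ => integrable_matrix_apply integrable_modulus a a).re

end ModulusIntegrals

section FourthMoments

variable {ι : Type*} [Fintype ι] [DecidableEq ι]

lemma prod_factorial_single_add_single (i j : ι) :
    ∏ q, ((Pi.single i 1 + Pi.single j 1 : ι → ℕ) q).factorial = if i = j then 2 else 1 := by
  split_ifs with hij
  · subst hij
    rw [Finset.prod_eq_single i (fun q _ hq => by simp [hq]) (by simp)]
    simp
  · refine Finset.prod_eq_one fun q _ => ?_
    rcases eq_or_ne q i with rfl | hqi
    · simp [hij]
    · rcases eq_or_ne q j with rfl | hqj <;> simp [*]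

lemma prod_pow_single_add_single (i j k l : ι) (y : ι → ℂ) :
    (∏ q, y q ^ (Pi.single i 1 + Pi.single j 1 : ι → ℕ) q) *
      ∏ q, conj (y q) ^ (Pi.single k 1 + Pi.single l 1 : ι → ℕ) q
      = y i * y j * (conj (y k) * conj (y l)) := by
  simp only [Pi.add_apply, pow_add, Finset.prod_mul_distrib]
  rw [prod_pow_single, prod_pow_single, prod_pow_single (fun q => conj (y q)),
    prod_pow_single (fun q => conj (y q))]

omit [DecidableEq ι] in
lemma integrable_gaussianPi_fourth (i j k l : ι) :
    Integrable (fun y => y i * y j * (conj (y k) * conj (y l))) (gaussianPi ι) := by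
  classical
  exact (integrable_gaussianPi_monomial _ _).congr
    (.of_forall fun y => prod_pow_single_add_single i j k l y)

lemma integral_gaussianPi_fourth (i j k l : ι) :
    ∫ y, y i * y j * (conj (y k) * conj (y l)) ∂gaussianPi ι
      = (if i = k ∧ j = l then 1 else 0) + if i = l ∧ j = k then 1 else 0 := by
  have h := integral_gaussianPi_monomial (Pi.single i 1 + Pi.single j 1 : ι → ℕ)
    (Pi.single k 1 + Pi.single l 1)
  simp only [prod_pow_single_add_single, prod_factorial_single_add_single,
    Pi.single_add_single_eq_single_add_single one_ne_zero one_ne_zero] at h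
  rw [h]
  norm_cast
  grind

end FourthMoments

section GaussianMoments

variable {N : ℕ}

lemma gaussianMoment_one : gaussianMoment N 1 = (N : ℝ) ^ 2 := by
  have hexpand (z : Fin N × Fin N → ℂ) : ((matrixOf z * (matrixOf z)ᴴ) ^ 1).trace
      = ∑ a, ∑ c, z (a, c) * conj (z (a, c)) := by
    rw [pow_one]
    rfl
  have h := integral_trace_pow_eq_gaussianMoment N 1
  simp only [hexpand] at h
  rw [integral_finsetSum _ fun a _ => integrable_finsetSum _ fun _ _ =>
    integrable_gaussianPi_mul_conj _ _] at h
  simp only [integral_finsetSum _ fun _ _ => integrable_gaussianPi_mul_conj _ _,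
    integral_gaussianPi_mul_conj, if_true, Finset.sum_const, Finset.card_univ, Fintype.card_fin,
    nsmul_eq_mul, mul_one] at h
  exact ofReal_injective (by rw [← h]; push_cast; ring)

lemma trace_mul_conjTranspose_sq (z : Fin N × Fin N → ℂ) :
    ((matrixOf z * (matrixOf z)ᴴ) ^ 2).trace
      = ∑ q : (Fin N × Fin N) × (Fin N × Fin N), z (q.1.1, q.2.1) * z (q.1.2, q.2.2)
          * (conj (z (q.1.2, q.2.1)) * conj (z (q.1.1, q.2.2))) := by
  simp only [Fintype.sum_prod_type, sq, Matrix.trace, Matrix.diag_apply, Matrix.mul_apply,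
    Finset.sum_mul_sum, Matrix.conjTranspose_apply, matrixOf_apply, Complex.star_def]
  refine Finset.sum_congr rfl fun a _ => Finset.sum_congr rfl fun c _ =>
    Finset.sum_congr rfl fun b _ => Finset.sum_congr rfl fun d _ => ?_
  ring

lemma gaussianMoment_two : gaussianMoment N 2 = 2 * (N : ℝ) ^ 3 := by
  have h := integral_trace_pow_eq_gaussianMoment N 2
  simp only [trace_mul_conjTranspose_sq] at h
  rw [integral_finsetSum _ fun q _ => integrable_gaussianPi_fourth _ _ _ _] at h
  have hpairing (a b c d : Fin N) :
      ∫ z, z (a, b) * z (c, d) * (conj (z (c, b)) * conj (z (a, d))) ∂gaussianPi (Fin N × Fin N)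
      = (if a = c then 1 else 0) + if b = d then 1 else 0 := by
    rw [integral_gaussianPi_fourth]
    simp only [Prod.mk.injEq]
    grind
  simp only [Fintype.sum_prod_type] at h
  simp only [hpairing, Finset.sum_add_distrib, Finset.sum_const,
    Finset.sum_ite_eq, Finset.mem_univ, if_true, Finset.card_univ, Fintype.card_fin,
    nsmul_eq_mul, smul_ite, smul_zero, mul_one] at h
  exact ofReal_injective (by rw [← h]; push_cast; ring)

end GaussianMoments

section ModulusMoments

open scoped ComplexOrder Matrix.Norms.L2Operator

variable {m : Type*} [Fintype m]

/-- Expand the trace of `(H - t) (H ^ 2 + 2 t H) (H - t) ≥ 0`. -/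
lemma le_re_trace_of_posSemidef {H : Matrix m m ℂ} (hH : H.PosSemidef) {t : ℝ} (ht : 0 < t) :
    3 / (2 * t) * (H * H).trace.re - 1 / (2 * t ^ 3) * ((H * H) * (H * H)).trace.re
      ≤ H.trace.re := by
  classical
  have hsub : (H - (t : ℂ) • 1)ᴴ = H - (t : ℂ) • 1 := by
    rw [Matrix.conjTranspose_sub, hH.isHermitian.eq, Matrix.conjTranspose_smul,
      Matrix.conjTranspose_one]
    simp
  have hsq : (H * H).PosSemidef := by
    simpa only [hH.isHermitian.eq] using Matrix.posSemidef_conjTranspose_mul_self H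
  have hquartic := ((hsq.add (hH.smul (a := ((2 * t : ℝ) : ℂ)) (by
    exact_mod_cast (by positivity : (0 : ℝ) ≤ 2 * t)))).conjTranspose_mul_mul_same
    (H - (t : ℂ) • 1)).trace_nonneg
  have hexpand : (H - (t : ℂ) • 1) * (H * H + ((2 * t : ℝ) : ℂ) • H) * (H - (t : ℂ) • 1)
      = (H * H) * (H * H) - ((3 * t ^ 2 : ℝ) : ℂ) • (H * H) + ((2 * t ^ 3 : ℝ) : ℂ) • H := by
    simp only [Matrix.mul_add, Matrix.sub_mul, Matrix.mul_sub, Matrix.smul_mul,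
      Matrix.mul_smul, Matrix.one_mul, Matrix.mul_one, Matrix.add_mul, smul_sub, smul_add,
      smul_smul, Matrix.mul_assoc]
    push_cast
    module
  have hre := (Complex.le_def.1 hquartic).1
  rw [hsub, hexpand, Matrix.trace_add, Matrix.trace_sub, Matrix.trace_smul, Matrix.trace_smul,
    smul_eq_mul, smul_eq_mul, add_re, sub_re, re_ofReal_mul, re_ofReal_mul, zero_re] at hre
  have hscaled := mul_nonneg (by positivity : 0 ≤ 1 / (2 * t ^ 3)) hre
  have hcancel : 1 / (2 * t ^ 3) * (((H * H) * (H * H)).trace.re - 3 * t ^ 2 * (H * H).trace.re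
      + 2 * t ^ 3 * H.trace.re) = H.trace.re - (3 / (2 * t) * (H * H).trace.re
        - 1 / (2 * t ^ 3) * ((H * H) * (H * H)).trace.re) := by
    field_simp
    ring
  rw [hcancel] at hscaled
  exact sub_nonneg.1 hscaled

variable [DecidableEq m]

lemma trace_modulus_mul_self_pow (A : Matrix m m ℂ) (k : ℕ) :
    ((modulus A * modulus A) ^ k).trace = ((A * Aᴴ) ^ k).trace := by
  rw [modulus_mul_self]
  rcases k with _ | k
  · rw [pow_zero, pow_zero]
  · have hcomm : (Aᴴ * A) ^ k * Aᴴ = Aᴴ * (A * Aᴴ) ^ k :=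
      (SemiconjBy.pow_right (show Aᴴ * (A * Aᴴ) = Aᴴ * A * Aᴴ from
        (Matrix.mul_assoc _ _ _).symm) k).eq.symm
    rw [pow_succ, ← Matrix.mul_assoc, hcomm, Matrix.mul_assoc, Matrix.trace_mul_comm,
      Matrix.mul_assoc, ← pow_succ]

lemma le_re_trace_modulus (A : Matrix m m ℂ) {t : ℝ} (ht : 0 < t) :
    3 / (2 * t) * ((A * Aᴴ) ^ 1).trace.re - 1 / (2 * t ^ 3) * ((A * Aᴴ) ^ 2).trace.re
      ≤ (modulus A).trace.re := by
  rw [← trace_modulus_mul_self_pow, ← trace_modulus_mul_self_pow, pow_one, sq]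
  exact le_re_trace_of_posSemidef (modulus_posSemidef A) ht

variable {N : ℕ}

lemma le_integral_re_trace_modulus [NeZero N] :
    N * √(N / 2) ≤ ∫ z, (modulus (matrixOf z)).trace.re ∂gaussianPi (Fin N × Fin N) := by
  have hN : (0 : ℝ) < N := by exact_mod_cast NeZero.pos N
  -- `3 s / (2 t) - s ^ 2 / (2 t ^ 3)` for the typical value `2 s = t ^ 2 = 2 N` is of order `√N`.
  set t := √(2 * N)
  have ht_pos : 0 < t := Real.sqrt_pos.2 (by positivity)
  have ht_sq : t ^ 2 = 2 * N := Real.sq_sqrt (by positivity)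
  have hint (k : ℕ) : Integrable (fun z : Fin N × Fin N → ℂ =>
      ((matrixOf z * (matrixOf z)ᴴ) ^ k).trace.re) (gaussianPi _) := (integrable_trace_pow k).re
  have hmono := integral_mono (((hint 1).const_mul (3 / (2 * t))).sub
    ((hint 2).const_mul (1 / (2 * t ^ 3)))) integrable_re_trace_modulus
    fun z => le_re_trace_modulus (matrixOf z) ht_pos
  simp only [Pi.sub_apply] at hmono
  rw [integral_sub ((hint 1).const_mul _) ((hint 2).const_mul _), integral_const_mul,
    integral_const_mul] at hmono
  change 3 / (2 * t) * gaussianMoment N 1 - 1 / (2 * t ^ 3) * gaussianMoment N 2 ≤ _ at hmono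
  rw [gaussianMoment_one, gaussianMoment_two] at hmono
  refine le_of_eq_of_le ?_ hmono
  have hsqrt : √(N / 2) = t / 2 := by
    rw [Real.sqrt_eq_iff_mul_self_eq (by positivity) (by positivity)]
    nlinarith
  rw [hsqrt, show (N : ℝ) = t ^ 2 / 2 by linarith]
  field_simp
  ring

lemma exists_integral_modulus_eq [NeZero N] : ∃ c : ℝ, √(N / 2) ≤ c ∧
    ∫ z, modulus (matrixOf z) ∂gaussianPi (Fin N × Fin N) = (c : ℂ) • 1 := by
  have hN : (0 : ℝ) < N := by exact_mod_cast NeZero.pos N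
  obtain ⟨c, hc⟩ := exists_integral_modulus_eq_smul_one (m := Fin N)
  have htrace : ((∫ z, (modulus (matrixOf z)).trace.re ∂gaussianPi (Fin N × Fin N) : ℝ) : ℂ)
      = N * c := by
    rw [← integral_complex_ofReal]
    simp only [← trace_modulus_eq_re]
    simp only [Matrix.trace, Matrix.diag_apply]
    rw [integral_finsetSum _ fun a _ => integrable_matrix_apply integrable_modulus a a]
    simp [← integral_matrix_apply integrable_modulus, hc]
  refine ⟨(∫ z, (modulus (matrixOf z)).trace.re ∂gaussianPi (Fin N × Fin N)) / N, ?_, ?_⟩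
  · rw [le_div_iff₀ hN, mul_comm]
    exact le_integral_re_trace_modulus
  · rw [hc, ofReal_div, htrace, ofReal_natCast, mul_div_cancel_left₀ c (by exact_mod_cast hN.ne')]

lemma le_integral_re_trace_modulus_sq [NeZero N] : (N : ℝ) ^ 3 / 2
    ≤ ∫ z, (modulus (matrixOf z)).trace.re ^ 2 ∂gaussianPi (Fin N × Fin N) := by
  have hmem : MemLp (fun z : Fin N × Fin N → ℂ => (modulus (matrixOf z)).trace.re) 2
      (gaussianPi _) := (memLp_two_iff_integrable_sq
    integrable_re_trace_modulus.aestronglyMeasurable).2 integrable_re_trace_modulus_sq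
  have hvar := ProbabilityTheory.variance_eq_sub hmem ▸ ProbabilityTheory.variance_nonneg _ _
  simp only [Pi.pow_apply] at hvar
  have hsq := pow_le_pow_left₀ (by positivity) (le_integral_re_trace_modulus (N := N)) 2
  rw [mul_pow, Real.sq_sqrt (by positivity)] at hsq
  linarith

lemma exists_modulusMap_eq_smul (hN : 2 ≤ N) : ∃ β : ℝ, N / 3 ≤ β ∧
    ∀ ξ : Matrix (Fin N) (Fin N) ℂ, ξ.trace = 0 → modulusMap (Fin N) ξ = (β : ℂ) • ξ := by
  have : NeZero N := ⟨by omega⟩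
  have hN' : (2 : ℝ) ≤ N := by exact_mod_cast hN
  obtain ⟨β, b, hβ⟩ := (unitarilyEquivariant_modulusMap (m := Fin N)).exists_eq_smul_add_trace
  set J := ∫ z, (modulus (matrixOf z)).trace.re ^ 2 ∂gaussianPi (Fin N × Fin N) with hJ
  have hone : β + b * N = N := by
    have h := congrFun (congrFun (hβ 1) 0) 0
    rw [modulusMap_one] at h
    simpa using h.symm
  have hsum : β * (N : ℂ) ^ 2 + b * N = J := by
    have htrace (a c : Fin N) : b * (Matrix.single a c (1 : ℂ)).trace * (1 : Matrix _ _ ℂ) a c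
        = if a = c then b else 0 := by
      rcases eq_or_ne a c with rfl | hac <;> simp [*]
    rw [hJ, ← sum_modulusMap_single]
    simp only [hβ, Matrix.add_apply, Matrix.smul_apply, Matrix.single_apply_same, smul_eq_mul,
      mul_one, htrace, Finset.sum_add_distrib, Finset.sum_const, Finset.card_univ,
      Fintype.card_fin, nsmul_eq_mul, Finset.sum_ite_eq, Finset.mem_univ, if_true]
    ring
  have hpos : (0 : ℝ) < (N : ℝ) ^ 2 - 1 := by nlinarith
  have hβ_eq : β = (((J - N) / ((N : ℝ) ^ 2 - 1) : ℝ) : ℂ) := by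
    rw [ofReal_div, eq_div_iff (ofReal_ne_zero.2 hpos.ne')]
    push_cast
    linear_combination hsum - hone
  refine ⟨(J - N) / ((N : ℝ) ^ 2 - 1), ?_, fun ξ hξ => ?_⟩
  · rw [le_div_iff₀ hpos]
    have hJ_ge : (N : ℝ) ^ 3 / 2 ≤ J := le_integral_re_trace_modulus_sq
    nlinarith [mul_nonneg (by linarith : (0 : ℝ) ≤ N) (by nlinarith : (0 : ℝ) ≤ (N : ℝ) ^ 2 - 4)]
  · rw [hβ ξ, hξ, ← hβ_eq, mul_zero, zero_smul, add_zero]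

end ModulusMoments

section Haar

variable {n N : ℕ} {m : Type*}

instance [Finite m] : SecondCountableTopology (Matrix m m ℂ) :=
  inferInstanceAs (SecondCountableTopology (m → m → ℂ))

variable [Fintype m] [DecidableEq m]

lemma isCompact_unitaryGroup : IsCompact (Matrix.unitaryGroup m ℂ : Set (Matrix m m ℂ)) := by
  have hbox : IsCompact {A : Matrix m m ℂ | ∀ i, A i ∈ {r : m → ℂ | ∀ j, r j ∈ closedBall 0 1}} :=
    isCompact_pi_infinite fun _ => isCompact_pi_infinite fun _ => isCompact_closedBall 0 1
  refine hbox.of_isClosed_subset isClosed_unitary fun U hU i j => ?_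
  rw [mem_closedBall_zero_iff]
  exact entry_norm_bound_of_unitary hU i j

instance : CompactSpace (Matrix.unitaryGroup m ℂ) :=
  isCompact_iff_compactSpace.1 isCompact_unitaryGroup

instance : SecondCountableTopology (Matrix.unitaryGroup m ℂ) :=
  inferInstanceAs (SecondCountableTopology (Matrix.unitaryGroup m ℂ : Set (Matrix m m ℂ)))

instance : MeasurableSpace (Matrix.unitaryGroup m ℂ) := borel _

instance : BorelSpace (Matrix.unitaryGroup m ℂ) := ⟨rfl⟩

/-- The set `unitaryTuples n N` as a compact group. -/
abbrev UnitaryTuple (n N : ℕ) : Type := Fin n → Matrix.unitaryGroup (Fin N) ℂ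

/-- The tuple of matrices underlying an element of the group `U(N)^n`. -/
def toTuple (u : UnitaryTuple n N) : Tuple n N := fun j => u j

lemma toTuple_mem (u : UnitaryTuple n N) : toTuple u ∈ unitaryTuples n N := fun j => (u j).2

lemma continuous_toTuple : Continuous (toTuple : UnitaryTuple n N → Tuple n N) :=
  continuous_pi fun j => continuous_subtype_val.comp (continuous_apply j)

/-- The Haar probability measure on `U(N)^n`. It is defined as the image under inversion of the
left invariant one, because only its right invariance is used. -/
def haarUnitary (n N : ℕ) : Measure (UnitaryTuple n N) := (Measure.haarMeasure ⊤).inv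

instance : IsProbabilityMeasure (haarUnitary n N) := by
  constructor
  rw [haarUnitary, Measure.inv_apply, Set.inv_univ]
  exact Measure.haarMeasure_self (K₀ := (⊤ : TopologicalSpace.PositiveCompacts (UnitaryTuple n N)))

instance : (haarUnitary n N).IsMulRightInvariant := by unfold haarUnitary; infer_instance

lemma integrable_haarUnitary {E : Type*} [NormedAddCommGroup E] {f : UnitaryTuple n N → E}
    (hf : Continuous f) : Integrable f (haarUnitary n N) :=
  hf.integrable_of_hasCompactSupport (HasCompactSupport.of_compactSpace f)

end Haar

section Comparison

open scoped Matrix.Norms.Frobenius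

variable {n N : ℕ} {u : Tuple n N}

lemma sum_frobenius_norm_tupleOf_le (y : Fin n × Fin N × Fin N → ℂ) :
    ∑ j, ‖(tupleOf y : Tuple n N) j‖ ≤ ∑ i, ‖y i‖ := by
  rw [Fintype.sum_prod_type]
  refine Finset.sum_le_sum fun j _ => abs_le_of_sq_le_sq' ?_ (by positivity) |>.2
  rw [frobenius_norm_sq_eq_sum, ← Fintype.sum_prod_type']
  exact Finset.sum_sq_le_sq_sum_of_nonneg fun _ _ => norm_nonneg _

/-- The tuple `(x j |Y j|)`, where `Y` is the tuple of matrices with entries `y`. -/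
def mulModulus (x : Tuple n N) (y : Fin n × Fin N × Fin N → ℂ) : Tuple n N :=
  fun j => x j * modulus (tupleOf y j)

lemma continuous_mulModulus :
    Continuous fun p : Tuple n N × (Fin n × Fin N × Fin N → ℂ) => mulModulus p.1 p.2 :=
  continuous_pi fun j => ((continuous_apply j).comp continuous_fst).matrix_mul
    (continuous_modulus.comp ((continuous_apply j).comp (continuous_tupleOf.comp continuous_snd)))

lemma frobenius_norm_modulus {m : Type*} [Fintype m] [DecidableEq m] (A : Matrix m m ℂ) :
    ‖modulus A‖ = ‖A‖ :=
  frobenius_norm_eq_of_trace_eq (by rw [conjTranspose_modulus, modulus_mul_self])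

lemma frobenius_norm_mulModulus (hu : u ∈ unitaryTuples n N) (y : Fin n × Fin N × Fin N → ℂ)
    (j : Fin n) : ‖mulModulus u y j‖ = ‖(tupleOf y : Tuple n N) j‖ := by
  rw [mulModulus, frobenius_norm_unitary_mul (hu j)]
  exact frobenius_norm_modulus _

/-- A function on tuples of matrices that grows at most exponentially, so that it has finite
Gaussian expectation. -/
def HasExpGrowth {E : Type*} [NormedAddCommGroup E] (F : Tuple n N → E) : Prop :=
  ∃ C ≥ 0, ∃ a ≥ 0, ∀ x, ‖F x‖ ≤ C * Real.exp (a * ∑ j, ‖x j‖)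

variable {E : Type*} [NormedAddCommGroup E] {F : Tuple n N → E}

lemma HasExpGrowth.exists_norm_le (h : HasExpGrowth F) : ∃ C a : ℝ,
    ∀ (x : Tuple n N) (y : Fin n × Fin N × Fin N → ℂ),
      (∀ j, ‖x j‖ = ‖(tupleOf y : Tuple n N) j‖) → ‖F x‖ ≤ C * Real.exp (a * ∑ i, ‖y i‖) := by
  obtain ⟨C, hC, a, ha, h⟩ := h
  refine ⟨C, a, fun x y hxy => (h x).trans ?_⟩
  simp only [hxy]
  gcongr
  exact sum_frobenius_norm_tupleOf_le y

lemma HasExpGrowth.integrable_mulModulus (h : HasExpGrowth F) (hF : Continuous F)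
    (hu : u ∈ unitaryTuples n N) : Integrable (fun y => F (mulModulus u y)) (gaussianPi _) := by
  obtain ⟨C, a, hbound⟩ := h.exists_norm_le
  exact integrable_gaussianPi_of_norm_le_exp (hF.comp (continuous_mulModulus.comp
    (continuous_const.prodMk continuous_id))).aestronglyMeasurable C a
    fun y => hbound _ y (frobenius_norm_mulModulus hu y)

lemma HasExpGrowth.integrable_prod (h : HasExpGrowth F) (hF : Continuous F)
    {g : UnitaryTuple n N × (Fin n × Fin N × Fin N → ℂ) → Tuple n N} (hg : Continuous g)
    (hnorm : ∀ p j, ‖g p j‖ = ‖(tupleOf p.2 : Tuple n N) j‖) :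
    Integrable (fun p => F (g p)) ((haarUnitary n N).prod (gaussianPi _)) := by
  obtain ⟨C, a, hbound⟩ := h.exists_norm_le
  exact (((integrable_gaussianPi_exp_sum_norm a).const_mul C).comp_snd (haarUnitary n N)).mono'
    (hF.comp hg).aestronglyMeasurable (.of_forall fun p => hbound _ p.2 (hnorm p))

lemma HasExpGrowth.integrable_prod_mulModulus (h : HasExpGrowth F) (hF : Continuous F) :
    Integrable (fun p => F (mulModulus (toTuple p.1) p.2))
      ((haarUnitary n N).prod (gaussianPi _)) :=
  h.integrable_prod hF (continuous_mulModulus.comp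
    ((continuous_toTuple.comp continuous_fst).prodMk continuous_snd))
    fun p j => frobenius_norm_mulModulus (toTuple_mem p.1) p.2 j

lemma HasExpGrowth.integrable_prod_mul (h : HasExpGrowth F) (hF : Continuous F) :
    Integrable (fun p => F fun j => toTuple p.1 j * tupleOf p.2 j)
      ((haarUnitary n N).prod (gaussianPi _)) :=
  h.integrable_prod hF (g := fun p j => toTuple p.1 j * tupleOf p.2 j)
    (continuous_pi fun j => ((continuous_apply j).comp
      (continuous_toTuple.comp continuous_fst)).matrix_mul
      ((continuous_apply j).comp (continuous_tupleOf.comp continuous_snd)))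
    fun p j => frobenius_norm_unitary_mul (toTuple_mem p.1 j) _

variable [NormedSpace ℝ E]

/-- The polar decomposition `Y j = W j |Y j|` and the invariance of the Haar measure under
translation by `W`. -/
lemma integral_haarUnitary_mulModulus (F : Tuple n N → E) (y : Fin n × Fin N × Fin N → ℂ) :
    ∫ u, F (mulModulus (toTuple u) y) ∂haarUnitary n N
      = ∫ u, F (fun j => toTuple u j * tupleOf y j) ∂haarUnitary n N := by
  choose W hW hpolar using fun j => exists_eq_unitary_mul_modulus ((tupleOf y : Tuple n N) j)
  rw [← integral_mul_right_eq_self (fun u => F (mulModulus (toTuple u) y)) fun j => ⟨W j, hW j⟩]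
  refine integral_congr_ae (.of_forall fun u => congrArg F (funext fun j => ?_))
  calc (u j * W j : Mat N) * modulus (tupleOf y j)
      = u j * (W j * modulus (tupleOf y j)) := Matrix.mul_assoc _ _ _
    _ = u j * tupleOf y j := by rw [← hpolar]

lemma HasExpGrowth.integral_mulModulus [CompleteSpace E] (h : HasExpGrowth F) (hF : Continuous F) :
    ∫ u, ∫ y, F (mulModulus (toTuple u) y) ∂gaussianPi _ ∂haarUnitary n N
      = ∫ y, F (tupleOf y) ∂gaussianPi _ := by
  rw [integral_integral_swap (h.integrable_prod_mulModulus hF)]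
  simp only [integral_haarUnitary_mulModulus]
  rw [← integral_integral_swap (h.integrable_prod_mul hF)]
  have hinv (u : UnitaryTuple n N) :
      ∫ y, F (fun j => toTuple u j * tupleOf y j) ∂gaussianPi _
        = ∫ y, F (tupleOf y) ∂gaussianPi _ :=
    integral_comp_of_measurePreserving (measurePreserving_unitary_mul (toTuple_mem u))
      (g := fun y => F (tupleOf y)) (hF.comp continuous_tupleOf).aestronglyMeasurable
  simp only [hinv, integral_const, probReal_univ, one_smul]

end Comparison

section ModulusOfTuple

open scoped Matrix.Norms.L2Operator

lemma integrable_comp_modulus_tupleOf {ι m E : Type*} [Fintype ι] [Fintype m] [DecidableEq m]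
    [NormedAddCommGroup E] {F : Matrix m m ℂ → E} (j : ι)
    (h : Integrable (fun z => F (modulus (matrixOf z))) (gaussianPi _)) :
    Integrable (fun y => F (modulus (tupleOf y j))) (gaussianPi _) :=
  (measurePreserving_fst_eq j).integrable_comp_of_integrable h

lemma integral_comp_modulus_tupleOf {ι m E : Type*} [Fintype ι] [Fintype m] [DecidableEq m]
    [NormedAddCommGroup E] [NormedSpace ℝ E] {F : Matrix m m ℂ → E} (j : ι)
    (h : Integrable (fun z => F (modulus (matrixOf z))) (gaussianPi _)) :
    ∫ y, F (modulus (tupleOf y j)) ∂gaussianPi _ = ∫ z, F (modulus (matrixOf z)) ∂gaussianPi _ :=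
  integral_comp_of_measurePreserving (measurePreserving_fst_eq j)
    (g := fun z => F (modulus (matrixOf z))) h.aestronglyMeasurable

variable {n N : ℕ}

lemma integral_sum_conj_mulModulus_apply (u : Tuple n N) (ξ : Mat N) (p : Fin N × Fin N) :
    ∫ y, (∑ j, mulModulus u y j * ξ * (mulModulus u y j)ᴴ) p.1 p.2 ∂gaussianPi _
      = (∑ j, u j * modulusMap (Fin N) ξ * (u j)ᴴ) p.1 p.2 := by
  have hint (j : Fin n) : Integrable (fun z : Fin N × Fin N → ℂ =>
      u j * (modulus (matrixOf z) * ξ * modulus (matrixOf z)) * (u j)ᴴ) (gaussianPi _) :=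
    ((integrable_modulus_mul_mul_modulus ξ).const_mul (u j)).mul_const (u j)ᴴ
  have hval (j : Fin n) : ∫ y : Fin n × Fin N × Fin N → ℂ,
      u j * (modulus (tupleOf y j) * ξ * modulus (tupleOf y j)) * (u j)ᴴ ∂gaussianPi _
        = u j * modulusMap (Fin N) ξ * (u j)ᴴ := by
    rw [integral_comp_modulus_tupleOf (F := fun M => u j * (M * ξ * M) * (u j)ᴴ) j (hint j),
      integral_mul_const_of_integrable ((integrable_modulus_mul_mul_modulus ξ).const_mul (u j)),
      integral_const_mul_of_integrable (integrable_modulus_mul_mul_modulus ξ), modulusMap_apply]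
  have hint' (j : Fin n) : Integrable (fun y : Fin n × Fin N × Fin N → ℂ =>
      u j * (modulus (tupleOf y j) * ξ * modulus (tupleOf y j)) * (u j)ᴴ) (gaussianPi _) :=
    integrable_comp_modulus_tupleOf (F := fun M => u j * (M * ξ * M) * (u j)ᴴ) j (hint j)
  have hsum (y : Fin n × Fin N × Fin N → ℂ) : ∑ j, mulModulus u y j * ξ * (mulModulus u y j)ᴴ
      = ∑ j, u j * (modulus (tupleOf y j) * ξ * modulus (tupleOf y j)) * (u j)ᴴ := by
    simp only [mulModulus, Matrix.conjTranspose_mul, conjTranspose_modulus, Matrix.mul_assoc]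
  simp only [hsum]
  rw [← integral_matrix_apply (integrable_finsetSum _ fun j _ => hint' j),
    integral_finsetSum _ fun j _ => hint' j]
  simp only [hval]

lemma integrable_trace_mul_modulus_mul {m : Type*} [Fintype m] [DecidableEq m]
    (A B : Matrix m m ℂ) :
    Integrable (fun z : m × m → ℂ => (A * modulus (matrixOf z) * B).trace) (gaussianPi _) :=
  integrable_finsetSum _ fun a _ =>
    integrable_matrix_apply ((integrable_modulus.const_mul A).mul_const B) a a

lemma exists_integral_trace_mul_modulus_mul_eq [NeZero N] : ∃ c : ℝ, √(N / 2) ≤ c ∧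
    ∀ A B : Mat N, ∫ z, (A * modulus (matrixOf z) * B).trace ∂gaussianPi _ = c * (A * B).trace := by
  obtain ⟨c, hcN, hc⟩ := exists_integral_modulus_eq (N := N)
  refine ⟨c, hcN, fun A B => ?_⟩
  have hint := (integrable_modulus.const_mul A).mul_const B
  have hmean : ∫ z, A * modulus (matrixOf z) * B ∂gaussianPi _ = (c : ℂ) • (A * B) := by
    rw [integral_mul_const_of_integrable (integrable_modulus.const_mul A),
      integral_const_mul_of_integrable integrable_modulus, hc, Matrix.mul_smul, Matrix.smul_mul,
      Matrix.mul_one]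
  simp only [Matrix.trace, Matrix.diag]
  rw [integral_finsetSum _ fun a _ => integrable_matrix_apply hint a a]
  simp only [← integral_matrix_apply hint, hmean, Matrix.smul_apply, smul_eq_mul, Finset.mul_sum]

end ModulusOfTuple

section HaarBounds

open scoped Matrix.Norms.Frobenius

variable {n N : ℕ} {u : Tuple n N}

lemma hasExpGrowth_tracelessOp :
    HasExpGrowth fun x : Tuple n N => tracelessOp x := by
  refine ⟨2, two_pos.le, 1, one_pos.le, fun x => ?_⟩
  have hS : 0 ≤ ∑ j, ‖x j‖ := by positivity
  calc ‖tracelessOp x‖ ≤ ∑ j, ‖x j‖ * ‖x j‖ :=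
        (norm_comp_tracelessProj_le _).trans (tensorNorm_le_sum _ _)
    _ ≤ (∑ j, ‖x j‖) ^ 2 := by
        simpa only [sq] using Finset.sum_sq_le_sq_sum_of_nonneg (s := Finset.univ)
          (f := fun j => ‖x j‖) fun j _ => norm_nonneg _
    _ ≤ 2 * Real.exp (1 * ∑ j, ‖x j‖) := by
        rw [one_mul]
        linarith [Real.quadratic_le_exp_of_nonneg hS]

lemma integral_tracelessOp_mulModulus (hu : u ∈ unitaryTuples n N) {β : ℝ}
    (hβ : ∀ ξ : Mat N, ξ.trace = 0 → modulusMap (Fin N) ξ = (β : ℂ) • ξ) :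
    ∫ y, tracelessOp (mulModulus u y) ∂gaussianPi _ = (β : ℂ) • tracelessOp u := by
  have hint := hasExpGrowth_tracelessOp.integrable_mulModulus continuous_tracelessOp hu
  ext v p
  obtain ⟨ξ, htrace, hξ⟩ := exists_tracelessProj_eq_entries v
  have hcoord := (EuclideanSpace.proj p : EuclideanSpace ℂ (Fin N × Fin N) →L[ℂ] ℂ)
    |>.integral_comp_comm (hint.apply_continuousLinearMap v)
  simp only [PiLp.proj_apply] at hcoord
  rw [ContinuousLinearMap.integral_apply hint, ← hcoord]
  simp only [tracelessOp, ContinuousLinearMap.comp_apply, hξ, tensorOp_entries, entries_apply,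
    integral_sum_conj_mulModulus_apply, hβ ξ htrace, smul_apply, PiLp.smul_apply,
    Matrix.mul_smul, Matrix.smul_mul, ← Finset.smul_sum, Matrix.smul_apply]

lemma integral_haarUnitary_norm_tracelessOp_le [NeZero n] (hN : 2 ≤ N) :
    ∫ u, ‖tracelessOp (toTuple u : Tuple n N)‖ ∂haarUnitary n N ≤ 19200 * √n := by
  have : NeZero N := ⟨by omega⟩
  have hN_pos : (0 : ℝ) < N := by exact_mod_cast NeZero.pos N
  obtain ⟨β, hβN, hβ⟩ := exists_modulusMap_eq_smul hN
  have hβ0 : 0 < β := (div_pos hN_pos three_pos).trans_le hβN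
  have hgrowth : HasExpGrowth fun x : Tuple n N => ‖tracelessOp x‖ := by
    simpa only [HasExpGrowth, norm_norm] using hasExpGrowth_tracelessOp (n := n) (N := N)
  have hcont : Continuous fun x : Tuple n N => ‖tracelessOp x‖ := continuous_tracelessOp.norm
  have hJensen (u : UnitaryTuple n N) : β * ‖tracelessOp (toTuple u)‖
      ≤ ∫ y, ‖tracelessOp (mulModulus (toTuple u) y)‖ ∂gaussianPi _ := by
    have h := norm_integral_le_integral_norm (μ := gaussianPi _)
      fun y => tracelessOp (mulModulus (toTuple u) y)
    rwa [integral_tracelessOp_mulModulus (toTuple_mem u) hβ, norm_smul, norm_real,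
      Real.norm_of_nonneg hβ0.le] at h
  have hcompare := integral_mono
    ((integrable_haarUnitary (hcont.comp continuous_toTuple)).const_mul β)
    (hgrowth.integrable_prod_mulModulus hcont).integral_prod_left hJensen
  rw [hgrowth.integral_mulModulus hcont, integral_const_mul] at hcompare
  have hmean : 0 ≤ ∫ u, ‖tracelessOp (toTuple u : Tuple n N)‖ ∂haarUnitary n N :=
    integral_nonneg fun u => norm_nonneg _
  refine le_of_mul_le_mul_left ?_ (show (0 : ℝ) < N / 3 from div_pos hN_pos three_pos)
  calc _ ≤ β * ∫ u, ‖tracelessOp (toTuple u : Tuple n N)‖ ∂haarUnitary n N :=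
        mul_le_mul_of_nonneg_right hβN hmean
    _ ≤ 6400 * N * √n := hcompare.trans integral_norm_tracelessOp_le
    _ = N / 3 * (19200 * √n) := by ring

/-- The real linear functional `x ↦ Re ∑ tr (x j A j)`. -/
def reTracePairing (A x : Tuple n N) : ℝ := ∑ j, (x j * A j).trace.re

lemma continuous_reTracePairing (A : Tuple n N) : Continuous (reTracePairing A) :=
  continuous_finsetSum _ fun j _ => continuous_re.comp
    ((continuous_apply j).matrix_mul continuous_const).matrix_trace

lemma reTracePairing_smul (c : ℝ) (A x : Tuple n N) :
    reTracePairing (fun j => (c : ℂ) • A j) x = c * reTracePairing A x := by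
  simp only [reTracePairing, Matrix.mul_smul, Matrix.trace_smul, smul_eq_mul, re_ofReal_mul,
    Finset.mul_sum]

lemma abs_reTracePairing_le (A x : Tuple n N) :
    |reTracePairing A x| ≤ (∑ j, ‖A j‖) * ∑ j, ‖x j‖ := by
  refine (Finset.abs_sum_le_sum_abs _ _).trans ?_
  rw [Finset.mul_sum]
  refine Finset.sum_le_sum fun j hj => ?_
  calc |(x j * A j).trace.re| ≤ ‖x j‖ * ‖A j‖ := (abs_re_le_norm _).trans (norm_trace_mul_le _ _)
    _ ≤ (∑ j, ‖A j‖) * ‖x j‖ := by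
        rw [mul_comm]
        gcongr
        exact Finset.single_le_sum (f := fun j => ‖A j‖) (fun j _ => norm_nonneg _) hj

lemma hasExpGrowth_exp_reTracePairing (A : Tuple n N) :
    HasExpGrowth fun x => Real.exp (reTracePairing A x) := by
  refine ⟨1, one_pos.le, ∑ j, ‖A j‖, by positivity, fun x => ?_⟩
  rw [one_mul, Real.norm_of_nonneg (Real.exp_nonneg _)]
  exact Real.exp_le_exp.2 ((le_abs_self _).trans (abs_reTracePairing_le A x))

lemma integral_exp_reTracePairing_tupleOf (A : Tuple n N) :
    ∫ y, Real.exp (reTracePairing A (tupleOf y)) ∂gaussianPi _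
      = Real.exp ((∑ j, ‖A j‖ ^ 2) / 4) := by
  have h := integral_gaussianPi_exp fun q : Fin n × Fin N × Fin N => (A q.1)ᴴ q.2.1 q.2.2
  have hinner (y : Fin n × Fin N × Fin N → ℂ) :
      ∑ q, inner ℝ ((A q.1)ᴴ q.2.1 q.2.2) (y q) = reTracePairing A (tupleOf y) := by
    rw [Fintype.sum_prod_type]
    refine Finset.sum_congr rfl fun j _ => ?_
    refine (sum_inner_apply_eq_re_trace (A j)ᴴ (tupleOf y j)).trans ?_
    rw [Matrix.conjTranspose_conjTranspose, Matrix.trace_mul_comm]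
  have hnorm : ∑ q : Fin n × Fin N × Fin N, ‖(A q.1)ᴴ q.2.1 q.2.2‖ ^ 2 = ∑ j, ‖A j‖ ^ 2 := by
    rw [Fintype.sum_prod_type]
    refine Finset.sum_congr rfl fun j _ => ?_
    rw [← Matrix.frobenius_norm_conjTranspose, ← sum_norm_apply_sq]
  simpa only [hinner, hnorm] using h

lemma integrable_trace_mulModulus_mul (u A : Tuple n N) (j : Fin n) :
    Integrable (fun y => (mulModulus u y j * A j).trace) (gaussianPi _) :=
  integrable_comp_modulus_tupleOf (F := fun M => (u j * M * A j).trace) j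
    (integrable_trace_mul_modulus_mul _ _)

lemma integrable_reTracePairing_mulModulus (u A : Tuple n N) :
    Integrable (fun y => reTracePairing A (mulModulus u y)) (gaussianPi _) :=
  integrable_finsetSum _ fun j _ => (integrable_trace_mulModulus_mul u A j).re

lemma integral_reTracePairing_mulModulus {c : ℝ}
    (hc : ∀ A B : Mat N,
      ∫ z, (A * modulus (matrixOf z) * B).trace ∂gaussianPi _ = c * (A * B).trace)
    (u A : Tuple n N) :
    ∫ y, reTracePairing A (mulModulus u y) ∂gaussianPi _ = c * reTracePairing A u := by
  simp only [reTracePairing]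
  have hint (j : Fin n) : Integrable (fun y => (mulModulus u y j * A j).trace.re) (gaussianPi _) :=
    (integrable_trace_mulModulus_mul u A j).re
  rw [integral_finsetSum _ fun j _ => hint j, Finset.mul_sum]
  refine Finset.sum_congr rfl fun j _ => ?_
  have hre := integral_re (integrable_trace_mulModulus_mul u A j)
  simp only [RCLike.re_eq_complex_re] at hre
  have hmean : ∫ y, (mulModulus u y j * A j).trace ∂gaussianPi _ = c * (u j * A j).trace :=
    (integral_comp_modulus_tupleOf (F := fun M => (u j * M * A j).trace) j
      (integrable_trace_mul_modulus_mul _ _)).trans (hc _ _)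
  rw [hre, hmean, re_ofReal_mul]

lemma integral_haarUnitary_exp_mul_reTracePairing_le {c : ℝ}
    (hc : ∀ A B : Mat N,
      ∫ z, (A * modulus (matrixOf z) * B).trace ∂gaussianPi _ = c * (A * B).trace)
    (A : Tuple n N) :
    ∫ u, Real.exp (c * reTracePairing A (toTuple u)) ∂haarUnitary n N
      ≤ Real.exp ((∑ j, ‖A j‖ ^ 2) / 4) := by
  have hgrowth := hasExpGrowth_exp_reTracePairing A
  have hcont : Continuous fun x : Tuple n N => Real.exp (reTracePairing A x) :=
    Real.continuous_exp.comp (continuous_reTracePairing A)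
  have hJensen (u : UnitaryTuple n N) : Real.exp (c * reTracePairing A (toTuple u))
      ≤ ∫ y, Real.exp (reTracePairing A (mulModulus (toTuple u) y)) ∂gaussianPi _ := by
    rw [← integral_reTracePairing_mulModulus hc]
    exact convexOn_exp.map_integral_le Real.continuous_exp.continuousOn isClosed_univ
      (.of_forall fun _ => Set.mem_univ _) (integrable_reTracePairing_mulModulus _ _)
      (hgrowth.integrable_mulModulus hcont (toTuple_mem u))
  rw [← integral_exp_reTracePairing_tupleOf, ← hgrowth.integral_mulModulus hcont]
  exact integral_mono (integrable_haarUnitary (Real.continuous_exp.comp (continuous_const.mul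
    ((continuous_reTracePairing A).comp continuous_toTuple))))
    (hgrowth.integrable_prod_mulModulus hcont).integral_prod_left hJensen

lemma integral_haarUnitary_exp_reTracePairing_le [NeZero N] (A : Tuple n N) :
    ∫ u, Real.exp (reTracePairing A (toTuple u)) ∂haarUnitary n N
      ≤ Real.exp ((∑ j, ‖A j‖ ^ 2) / (2 * N)) := by
  have hN : (0 : ℝ) < N := by exact_mod_cast NeZero.pos N
  obtain ⟨c, hcN, hc⟩ := exists_integral_trace_mul_modulus_mul_eq (N := N)
  have hc0 : 0 < c := lt_of_lt_of_le (by positivity) hcN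
  have hc2 : (N : ℝ) / 2 ≤ c ^ 2 := (Real.sqrt_le_left hc0.le).1 hcN
  have hle := integral_haarUnitary_exp_mul_reTracePairing_le hc fun j => ((c⁻¹ : ℝ) : ℂ) • A j
  simp only [reTracePairing_smul, mul_inv_cancel_left₀ hc0.ne', norm_smul, norm_real, norm_inv,
    Real.norm_of_nonneg hc0.le, mul_pow, ← Finset.mul_sum] at hle
  refine hle.trans (Real.exp_le_exp.2 ?_)
  calc c⁻¹ ^ 2 * (∑ j, ‖A j‖ ^ 2) / 4 = (∑ j, ‖A j‖ ^ 2) / (4 * c ^ 2) := by field_simp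
    _ ≤ (∑ j, ‖A j‖ ^ 2) / (2 * N) :=
        div_le_div_of_nonneg_left (by positivity) (by positivity) (by linarith)

end HaarBounds

section ExpanderEstimates

open scoped Matrix.Norms.Frobenius

variable {n N : ℕ} {ε : ℝ} {u v : Tuple n N}

lemma hNorm_eq_frobenius_norm (ξ : Mat N) : hNorm ξ = √((N : ℝ)⁻¹) * ‖ξ‖ := by
  rw [hNorm, ← frobenius_norm_sq_eq_re_trace, Real.sqrt_mul (by positivity),
    Real.sqrt_sq (norm_nonneg ξ)]

lemma mem_expanders_iff [NeZero N] : u ∈ expanders ε n N ↔ u ∈ unitaryTuples n N ∧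
    ∀ ξ : Mat N, ξ.trace = 0 → ‖∑ j, u j * ξ * (u j)ᴴ‖ ≤ ε * n * ‖ξ‖ := by
  have hN : 0 < √((N : ℝ)⁻¹) :=
    Real.sqrt_pos.2 (inv_pos.2 (by exact_mod_cast NeZero.pos N))
  simp only [expanders, Set.mem_ofPred_eq, hNorm_eq_frobenius_norm, mul_left_comm (ε * n),
    mul_le_mul_iff_right₀ hN]

lemma expanders_mono {ε' : ℝ} (h : ε ≤ ε') : expanders ε n N ⊆ expanders ε' n N :=
  fun _ hu => ⟨hu.1, fun ξ hξ => (hu.2 ξ hξ).trans (mul_le_mul_of_nonneg_right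
    (mul_le_mul_of_nonneg_right h n.cast_nonneg) (Real.sqrt_nonneg _))⟩

lemma mem_expanders_of_norm_tracelessOp_le [NeZero N] (hu : u ∈ unitaryTuples n N)
    (h : ‖tracelessOp u‖ ≤ ε * n) : u ∈ expanders ε n N := by
  refine mem_expanders_iff.2 ⟨hu, fun ξ hξ => ?_⟩
  simpa only [tracelessOp, ContinuousLinearMap.comp_apply, tracelessProj_entries hξ,
    tensorOp_entries, LinearIsometryEquiv.norm_map] using
    (tracelessOp u).le_of_opNorm_le h (entries ξ)

lemma trace_sub_trace_smul_one [NeZero N] (A : Mat N) :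
    (A - (A.trace / N) • (1 : Mat N)).trace = 0 := by
  rw [Matrix.trace_sub, Matrix.trace_smul, Matrix.trace_one, Fintype.card_fin, smul_eq_mul,
    div_mul_cancel₀ _ (NeZero.ne (N : ℂ)), sub_self]

lemma frobenius_norm_sub_trace_smul_one_le [NeZero N] (A : Mat N) :
    ‖A - (A.trace / N) • (1 : Mat N)‖ ≤ ‖A‖ := by
  have hproj_one : tracelessProj N (entries 1) = 0 := by
    rw [tracelessProj, Submodule.starProjection_apply_eq_zero_iff,
      Submodule.orthogonal_orthogonal]
    exact Submodule.mem_span_singleton_self _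
  have hproj : tracelessProj N (entries A) = entries (A - (A.trace / N) • (1 : Mat N)) := by
    rw [← tracelessProj_entries (trace_sub_trace_smul_one A), map_sub, map_smul, map_sub, map_smul,
      hproj_one, smul_zero, sub_zero]
  rw [← entries.norm_map A, ← entries.norm_map (A - _), ← hproj]
  exact Submodule.norm_starProjection_apply_le _ _

lemma norm_sum_trace_le_of_expander [NeZero N] (hε : 0 ≤ ε) (hu : u ∈ expanders ε n N)
    (A B : Mat N) : ‖∑ j, (B * (u j * A * (u j)ᴴ)).trace‖
      ≤ n * (‖A.trace‖ * ‖B.trace‖ / N + ε * (‖A‖ * ‖B‖)) := by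
  set A₀ := A - (A.trace / N) • (1 : Mat N) with hA₀
  have hsum : ∑ j, (B * (u j * A * (u j)ᴴ)).trace
      = n * (A.trace * B.trace / N) + (B * ∑ j, u j * A₀ * (u j)ᴴ).trace := by
    have hconst : ∑ j, (B * (u j * (A.trace / N) • 1 * (u j)ᴴ)).trace
        = n * (A.trace * B.trace / N) := by
      simp [self_mul_conjTranspose_of_unitary (hu.1 _), mul_div_right_comm]
    rw [← hconst, Finset.mul_sum, Matrix.trace_sum, ← Finset.sum_add_distrib]
    refine Finset.sum_congr rfl fun j _ => ?_
    rw [← Matrix.trace_add, ← Matrix.mul_add, ← Matrix.add_mul, ← Matrix.mul_add, hA₀,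
      add_sub_cancel]
  have htraceless : ‖(B * ∑ j, u j * A₀ * (u j)ᴴ).trace‖ ≤ n * (ε * (‖A‖ * ‖B‖)) :=
    calc ‖(B * ∑ j, u j * A₀ * (u j)ᴴ).trace‖
        ≤ ‖B‖ * (ε * n * ‖A₀‖) := (norm_trace_mul_le _ _).trans <| mul_le_mul_of_nonneg_left
          ((mem_expanders_iff.1 hu).2 A₀ (trace_sub_trace_smul_one A)) (norm_nonneg B)
      _ ≤ ‖B‖ * (ε * n * ‖A‖) := by
          gcongr
          exact frobenius_norm_sub_trace_smul_one_le A
      _ = n * (ε * (‖A‖ * ‖B‖)) := by ring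
  rw [hsum, mul_add]
  refine (norm_add_le _ _).trans (add_le_add (le_of_eq ?_) htraceless)
  simp

lemma frobenius_norm_mul_mul_conjTranspose_sq {m : Type*} [Fintype m] (R S X : Matrix m m ℂ) :
    ((‖S * X * Rᴴ‖ ^ 2 : ℝ) : ℂ) = (Sᴴ * S * (X * (Rᴴ * R) * Xᴴ)).trace := by
  rw [frobenius_norm_sq_eq_trace, Matrix.trace_mul_comm]
  simp only [Matrix.conjTranspose_mul, Matrix.conjTranspose_conjTranspose]
  rw [← Matrix.mul_assoc, ← Matrix.mul_assoc, Matrix.trace_mul_comm]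
  simp only [Matrix.mul_assoc]

lemma sum_frobenius_norm_sq_le_of_expander [NeZero N] (hε : 0 ≤ ε) (hu : u ∈ expanders ε n N)
    {W W' : Mat N} (hW : W ∈ Matrix.unitaryGroup (Fin N) ℂ)
    (hW' : W' ∈ Matrix.unitaryGroup (Fin N) ℂ) (R S : Mat N) :
    ∑ j, ‖S * (W'ᴴ * u j * W) * Rᴴ‖ ^ 2
      ≤ n * (‖(Rᴴ * R).trace‖ * ‖(Sᴴ * S).trace‖ / N + ε * (‖Rᴴ * R‖ * ‖Sᴴ * S‖)) := by
  have h := norm_sum_trace_le_of_expander hε hu (W * (Rᴴ * R) * Wᴴ) (W' * (Sᴴ * S) * W'ᴴ)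
  rw [trace_conj_unitary hW, trace_conj_unitary hW', frobenius_norm_conj_unitary hW,
    frobenius_norm_conj_unitary hW'] at h
  have hsum : ∑ j, (W' * (Sᴴ * S) * W'ᴴ * (u j * (W * (Rᴴ * R) * Wᴴ) * (u j)ᴴ)).trace
      = ((∑ j, ‖S * (W'ᴴ * u j * W) * Rᴴ‖ ^ 2 : ℝ) : ℂ) := by
    rw [ofReal_sum]
    refine Finset.sum_congr rfl fun j _ => ?_
    rw [frobenius_norm_mul_mul_conjTranspose_sq, Matrix.mul_assoc W', Matrix.mul_assoc W',
      Matrix.trace_mul_comm W']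
    simp only [Matrix.conjTranspose_mul, Matrix.conjTranspose_conjTranspose, Matrix.mul_assoc]
  rw [hsum, norm_real] at h
  exact (Real.le_norm_self _).trans h

end ExpanderEstimates

section SpectralTruncation

open scoped Matrix.Norms.Frobenius ComplexOrder

variable {m : Type*} [Fintype m] {κ : ℝ}

/-- The operator norm of `A` is at most `κ`. It is expressed through the Frobenius norm of products,
since the latter is the norm on matrices in force here. -/
def OpNormLE (κ : ℝ) (A : Matrix m m ℂ) : Prop := ∀ B : Matrix m m ℂ, ‖A * B‖ ≤ κ * ‖B‖

variable [DecidableEq m]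

/-- The diagonal matrix with real entries `d`. -/
def realDiagonal (d : m → ℝ) : Matrix m m ℂ := Matrix.diagonal fun i => (d i : ℂ)

lemma frobenius_norm_realDiagonal_sq (d : m → ℝ) : ‖realDiagonal d‖ ^ 2 = ∑ i, d i ^ 2 := by
  rw [frobenius_norm_sq_eq_sum]
  refine Finset.sum_congr rfl fun i _ => ?_
  rw [Finset.sum_eq_single i (fun j _ hj => by simp [realDiagonal, hj.symm]) (by simp)]
  simp [realDiagonal]

lemma frobenius_norm_realDiagonal_mono {d e : m → ℝ} (hd : 0 ≤ d) (hde : d ≤ e) :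
    ‖realDiagonal d‖ ≤ ‖realDiagonal e‖ := by
  refine le_of_sq_le_sq ?_ (norm_nonneg _)
  rw [frobenius_norm_realDiagonal_sq, frobenius_norm_realDiagonal_sq]
  exact Finset.sum_le_sum fun i _ => pow_le_pow_left₀ (hd i) (hde i) 2

lemma norm_trace_realDiagonal {d : m → ℝ} (hd : 0 ≤ d) :
    ‖(realDiagonal d).trace‖ = ∑ i, d i := by
  rw [realDiagonal, Matrix.trace_diagonal, ← ofReal_sum, norm_real,
    Real.norm_of_nonneg (Finset.sum_nonneg fun i _ => hd i)]

lemma opNormLE_realDiagonal {d : m → ℝ} (hκ : 0 ≤ κ) (hd : 0 ≤ d) (hdκ : ∀ i, d i ≤ κ) :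
    OpNormLE κ (realDiagonal d) := by
  refine fun B => le_of_sq_le_sq ?_ (mul_nonneg hκ (norm_nonneg B))
  simp only [mul_pow, frobenius_norm_sq_eq_sum, Finset.mul_sum, realDiagonal, Matrix.diagonal_mul,
    norm_mul, norm_real, Real.norm_of_nonneg (hd _)]
  gcongr with i _ j
  · exact hd i
  · exact hdκ i

variable {U A : Matrix m m ℂ}

lemma OpNormLE.unitary_mul (hA : OpNormLE κ A) (hU : U ∈ Matrix.unitaryGroup m ℂ) :
    OpNormLE κ (U * A) := fun B => by
  rw [Matrix.mul_assoc, frobenius_norm_unitary_mul hU]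
  exact hA B

lemma OpNormLE.mul_unitary (hA : OpNormLE κ A) (hU : U ∈ Matrix.unitaryGroup m ℂ) :
    OpNormLE κ (A * U) := fun B => by
  rw [Matrix.mul_assoc, ← frobenius_norm_unitary_mul hU B]
  exact hA (U * B)

omit [Fintype m] in
lemma realDiagonal_min_add_max (d : m → ℝ) (κ : ℝ) :
    realDiagonal (fun i => min (d i) κ) + realDiagonal (fun i => max (d i - κ) 0)
      = realDiagonal d := by
  rw [realDiagonal, realDiagonal, Matrix.diagonal_add, realDiagonal]
  congr! with i
  rw [← ofReal_add]
  congr 1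
  rcases le_total (d i) κ with h | h
  · rw [min_eq_left h, max_eq_right (sub_nonpos.2 h), add_zero]
  · rw [min_eq_right h, max_eq_left (sub_nonneg.2 h), add_sub_cancel]

lemma norm_trace_realDiagonal_max_le (d : m → ℝ) (κ : ℝ) :
    4 * κ * ‖(realDiagonal fun i => max (d i - κ) 0).trace‖ ≤ ‖realDiagonal d‖ ^ 2 := by
  rw [norm_trace_realDiagonal fun i => le_max_right (d i - κ) 0, frobenius_norm_realDiagonal_sq,
    Finset.mul_sum]
  refine Finset.sum_le_sum fun i _ => ?_
  rcases le_total (d i - κ) 0 with h | h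
  · rw [max_eq_right h, mul_zero]
    positivity
  · rw [max_eq_left h]
    linarith [sq_nonneg (d i - 2 * κ)]

lemma exists_eq_add_of_posSemidef {H : Matrix m m ℂ} (hH : H.PosSemidef) (hκ : 0 ≤ κ) :
    ∃ H₁ H₂ : Matrix m m ℂ, H = H₁ + H₂ ∧ OpNormLE κ H₁ ∧ ‖H₁‖ ≤ ‖H‖ ∧
      H₂.PosSemidef ∧ ‖H₂‖ ≤ ‖H‖ ∧ 4 * κ * ‖H₂.trace‖ ≤ ‖H‖ ^ 2 := by
  set U : Matrix m m ℂ := (hH.isHermitian.eigenvectorUnitary : Matrix m m ℂ)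
  have hU : U ∈ Matrix.unitaryGroup m ℂ := hH.isHermitian.eigenvectorUnitary.2
  set d := hH.isHermitian.eigenvalues
  have hd : 0 ≤ d := hH.eigenvalues_nonneg
  have hspectral : H = U * realDiagonal d * Uᴴ := by
    have h := hH.isHermitian.spectral_theorem
    rwa [Unitary.conjStarAlgAut_apply, Matrix.star_eq_conjTranspose] at h
  have hnorm : ‖H‖ = ‖realDiagonal d‖ := by
    conv_lhs => rw [hspectral, frobenius_norm_conj_unitary hU]
  have hmin : 0 ≤ fun i => min (d i) κ := fun i => le_min (hd i) hκ
  have hmax : 0 ≤ fun i => max (d i - κ) 0 := fun i => le_max_right _ _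
  refine ⟨U * realDiagonal (fun i => min (d i) κ) * Uᴴ,
    U * realDiagonal (fun i => max (d i - κ) 0) * Uᴴ, ?_, ?_, ?_, ?_, ?_, ?_⟩
  · rwa [← Matrix.add_mul, ← Matrix.mul_add, realDiagonal_min_add_max]
  · exact ((opNormLE_realDiagonal hκ hmin fun i => min_le_right _ _).unitary_mul hU).mul_unitary
      (conjTranspose_mem_unitaryGroup hU)
  · rw [frobenius_norm_conj_unitary hU, hnorm]
    exact frobenius_norm_realDiagonal_mono hmin fun i => min_le_left _ _
  · exact (Matrix.posSemidef_diagonal_iff.2 fun i =>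
      zero_le_real.2 (hmax i)).mul_mul_conjTranspose_same U
  · rw [frobenius_norm_conj_unitary hU, hnorm]
    exact frobenius_norm_realDiagonal_mono hmax fun i =>
      max_le (sub_le_self _ hκ) (hd i)
  · rw [trace_conj_unitary hU, hnorm]
    exact norm_trace_realDiagonal_max_le d κ

end SpectralTruncation

section Correlation

open scoped Matrix.Norms.Frobenius ComplexOrder

variable {n N : ℕ} {ε σ : ℝ} {u v : Tuple n N}

/-- The tuple `ξ * (v j)ᴴ * η`, whose pairing with `u` is the Hilbert–Schmidt pairing of
`tensorOp u v` with `ξ` and `η`. -/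
def sandwich (v : Tuple n N) (ξ η : Mat N) : Tuple n N := fun j => ξ * (v j)ᴴ * η

lemma reTracePairing_sandwich (u v : Tuple n N) (ξ η : Mat N) :
    reTracePairing (sandwich v ξ η) u = ((∑ j, u j * ξ * (v j)ᴴ) * η).trace.re := by
  simp only [reTracePairing, sandwich, Finset.sum_mul, Matrix.trace_sum, re_sum, Matrix.mul_assoc]

lemma reTracePairing_sandwich_le (u v : Tuple n N) (ξ η : Mat N) :
    reTracePairing (sandwich v ξ η) u ≤ tensorNorm u v * ‖ξ‖ * ‖η‖ := by
  rw [reTracePairing_sandwich]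
  exact (re_le_norm _).trans ((norm_trace_mul_le _ _).trans
    (mul_le_mul_of_nonneg_right (norm_sum_le_tensorNorm u v ξ) (norm_nonneg η)))

lemma tensorNorm_le_of_reTracePairing_le {C : ℝ} (hC : 0 ≤ C)
    (h : ∀ ξ η : Mat N, ‖ξ‖ ≤ 1 → ‖η‖ ≤ 1 → reTracePairing (sandwich v ξ η) u ≤ C) :
    tensorNorm u v ≤ C := by
  refine (tensorOp u v).opNorm_le_of_unit_norm hC (entries.surjective.forall.2 fun ξ hξ => ?_)
  rw [tensorOp_entries, LinearIsometryEquiv.norm_map]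
  rw [LinearIsometryEquiv.norm_map] at hξ
  set X := ∑ j, u j * ξ * (v j)ᴴ with hX
  have hη : ‖(‖X‖⁻¹ : ℂ) • Xᴴ‖ ≤ 1 := by
    rw [norm_smul, norm_inv, norm_real, norm_norm, Matrix.frobenius_norm_conjTranspose]
    exact inv_mul_le_one
  have hpair := h ξ _ hξ.le hη
  rwa [reTracePairing_sandwich, ← hX, Matrix.mul_smul, Matrix.trace_smul, Matrix.trace_mul_comm,
    ← frobenius_norm_sq_eq_trace, ← ofReal_inv, smul_eq_mul, ← ofReal_mul, ofReal_re, sq,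
    ← mul_assoc, inv_mul_mul_self] at hpair

lemma reTracePairing_sandwich_le_of_posSemidef [NeZero N] (hε : 0 ≤ ε) (hu : u ∈ expanders ε n N)
    (hv : v ∈ expanders ε n N) {W W' H K : Mat N} (hW : W ∈ Matrix.unitaryGroup (Fin N) ℂ)
    (hW' : W' ∈ Matrix.unitaryGroup (Fin N) ℂ) (hH : H.PosSemidef) (hK : K.PosSemidef) :
    reTracePairing (sandwich v (W * H) (W' * K)) u
      ≤ n * (‖H.trace‖ * ‖K.trace‖ / N + ε * (‖H‖ * ‖K‖)) := by
  obtain ⟨R, rfl⟩ := exists_eq_conjTranspose_mul_self hH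
  obtain ⟨S, rfl⟩ := exists_eq_conjTranspose_mul_self hK
  have hone : (1 : Mat N) ∈ Matrix.unitaryGroup (Fin N) ℂ := one_mem _
  let X (j : Fin n) : Mat N := S * (1ᴴ * u j * W) * Rᴴ
  let Y (j : Fin n) : Mat N := S * (W'ᴴ * v j * 1) * Rᴴ
  have hfactor (j : Fin n) :
      (u j * sandwich v (W * (Rᴴ * R)) (W' * (Sᴴ * S)) j).trace = (X j * (Y j)ᴴ).trace := by
    have hcycle : u j * sandwich v (W * (Rᴴ * R)) (W' * (Sᴴ * S)) j
        = u j * W * Rᴴ * (R * (v j)ᴴ * W' * Sᴴ) * S := by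
      simp only [sandwich, Matrix.mul_assoc]
    rw [hcycle, Matrix.trace_mul_comm]
    simp only [X, Y, Matrix.conjTranspose_mul, Matrix.conjTranspose_conjTranspose,
      Matrix.conjTranspose_one, Matrix.one_mul, Matrix.mul_assoc]
  have hterm (j : Fin n) : (u j * sandwich v (W * (Rᴴ * R)) (W' * (Sᴴ * S)) j).trace.re
      ≤ (‖X j‖ ^ 2 + ‖Y j‖ ^ 2) / 2 := by
    rw [hfactor]
    refine (re_le_norm _).trans ((norm_trace_mul_le _ _).trans ?_)
    rw [Matrix.frobenius_norm_conjTranspose]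
    linarith [two_mul_le_add_sq ‖X j‖ ‖Y j‖]
  refine (Finset.sum_le_sum fun j _ => hterm j).trans ?_
  rw [← Finset.sum_div, Finset.sum_add_distrib]
  linarith [sum_frobenius_norm_sq_le_of_expander hε hu hW hone R S,
    sum_frobenius_norm_sq_le_of_expander hε hv hone hW' R S]

/-- The tuples correlated with `v` through matrices `ξ` and `η` in the Hilbert–Schmidt unit ball,
the operator norm of `ξ` being at most `κ`. -/
def Correlated (σ κ : ℝ) (v : Tuple n N) : Set (Tuple n N) :=
  {u | ∃ ξ η : Mat N, OpNormLE κ ξ ∧ ‖ξ‖ ≤ 1 ∧ ‖η‖ ≤ 1 ∧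
    σ * n / 2 < reTracePairing (sandwich v ξ η) u}

lemma reTracePairing_sandwich_add_left (u v : Tuple n N) (ξ ξ' η : Mat N) :
    reTracePairing (sandwich v (ξ + ξ') η) u
      = reTracePairing (sandwich v ξ η) u + reTracePairing (sandwich v ξ' η) u := by
  simp only [reTracePairing_sandwich, Matrix.mul_add, Matrix.add_mul, Finset.sum_add_distrib,
    Matrix.trace_add, add_re]

lemma reTracePairing_sandwich_add_right (u v : Tuple n N) (ξ η η' : Mat N) :
    reTracePairing (sandwich v ξ (η + η')) u
      = reTracePairing (sandwich v ξ η) u + reTracePairing (sandwich v ξ η') u := by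
  simp only [reTracePairing_sandwich, Matrix.mul_add, Matrix.trace_add, add_re]

lemma reTracePairing_sandwich_unbounded_le [NeZero N] (hε : 0 ≤ ε) (hεσ : ε ≤ σ / 4)
    (hu : u ∈ expanders ε n N) (hv : v ∈ expanders ε n N) {W H η : Mat N}
    (hW : W ∈ Matrix.unitaryGroup (Fin N) ℂ) (hH : H.PosSemidef) (hHnorm : ‖H‖ ≤ 1)
    (hHtrace : ‖H.trace‖ ≤ σ * √N / 4) (hη : ‖η‖ ≤ 1) :
    reTracePairing (sandwich v (W * H) η) u ≤ σ * n / 2 := by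
  have hN : (0 : ℝ) < N := by exact_mod_cast NeZero.pos N
  obtain ⟨W', hW', hpolar⟩ := exists_eq_unitary_mul_modulus η
  have hpair := reTracePairing_sandwich_le_of_posSemidef hε hu hv hW hW' hH (modulus_posSemidef η)
  rw [← hpolar, frobenius_norm_modulus] at hpair
  have hηtrace : ‖(modulus η).trace‖ ≤ √N := by
    refine (norm_trace_le _).trans ?_
    rw [frobenius_norm_modulus, Fintype.card_fin]
    exact mul_le_of_le_one_right (Real.sqrt_nonneg _) hη
  have htraces : ‖H.trace‖ * ‖(modulus η).trace‖ / N ≤ σ / 4 := by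
    rw [div_le_iff₀ hN]
    calc ‖H.trace‖ * ‖(modulus η).trace‖ ≤ σ * √N / 4 * √N :=
          mul_le_mul hHtrace hηtrace (norm_nonneg _) ((norm_nonneg _).trans hHtrace)
      _ = σ / 4 * (√N * √N) := by ring
      _ = σ / 4 * N := by rw [Real.mul_self_sqrt hN.le]
  have hnorms : ε * (‖H‖ * ‖η‖) ≤ σ / 4 :=
    (mul_le_of_le_one_right hε (mul_le_one₀ hHnorm (norm_nonneg _) hη)).trans hεσ
  calc reTracePairing (sandwich v (W * H) η) u
      ≤ n * (‖H.trace‖ * ‖(modulus η).trace‖ / N + ε * (‖H‖ * ‖η‖)) := hpair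
    _ ≤ n * (σ / 4 + σ / 4) := by gcongr
    _ = σ * n / 2 := by ring

lemma tensorNorm_le_of_not_correlated [NeZero N] (hσ : 0 < σ) (hε : 0 ≤ ε) (hεσ : ε ≤ σ / 4)
    (hu : u ∈ expanders ε n N) (hv : v ∈ expanders ε n N)
    (h : u ∉ Correlated σ (1 / (σ * √N)) v) : tensorNorm u v ≤ σ * n := by
  have hN : 0 < √(N : ℝ) := Real.sqrt_pos.2 (by exact_mod_cast NeZero.pos N)
  refine tensorNorm_le_of_reTracePairing_le (by positivity) fun ξ η hξ hη => ?_
  obtain ⟨W, hW, hpolar⟩ := exists_eq_unitary_mul_modulus ξ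
  obtain ⟨H₁, H₂, hsplit, hH₁op, hH₁, hH₂pos, hH₂, htrace⟩ :=
    exists_eq_add_of_posSemidef (modulus_posSemidef ξ) (κ := 1 / (σ * √N)) (by positivity)
  rw [frobenius_norm_modulus] at hH₁ hH₂ htrace
  have hbounded : reTracePairing (sandwich v (W * H₁) η) u ≤ σ * n / 2 := by
    by_contra! hlt
    refine h ⟨W * H₁, η, hH₁op.unitary_mul hW, ?_, hη, hlt⟩
    rw [frobenius_norm_unitary_mul hW]
    exact hH₁.trans hξ
  have htrace' : ‖H₂.trace‖ ≤ σ * √N / 4 := by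
    have hle := htrace.trans (pow_le_one₀ (norm_nonneg ξ) hξ)
    rw [← le_div_iff₀' (by positivity)] at hle
    refine hle.trans_eq ?_
    field_simp
  have hunbounded : reTracePairing (sandwich v (W * H₂) η) u ≤ σ * n / 2 :=
    reTracePairing_sandwich_unbounded_le hε hεσ hu hv hW hH₂pos (hH₂.trans hξ) htrace' hη
  rw [hpolar, hsplit, Matrix.mul_add, reTracePairing_sandwich_add_left]
  linarith

end Correlation

section UpperBound

open scoped Matrix.Norms.Frobenius

variable {n N : ℕ} {δ : ℝ} {x y : Tuple n N}

/-- The vector of all entries of a tuple of matrices, which embeds tuples into a Euclidean space. -/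
def tupleEntries (x : Tuple n N) : EuclideanSpace ℂ (Fin n × Fin N × Fin N) :=
  WithLp.toLp 2 fun p => x p.1 p.2.1 p.2.2

lemma tupleEntries_injective : Function.Injective (tupleEntries (n := n) (N := N)) := by
  intro x y h
  ext j a b
  exact congrArg (fun v => v (j, a, b)) h

lemma tupleEntries_sub (x y : Tuple n N) :
    tupleEntries (x - y) = tupleEntries x - tupleEntries y := rfl

lemma norm_tupleEntries_sq (x : Tuple n N) : ‖tupleEntries x‖ ^ 2 = ∑ j, ‖x j‖ ^ 2 := by
  simp only [EuclideanSpace.norm_sq_eq, Fintype.sum_prod_type, frobenius_norm_sq_eq_sum,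
    tupleEntries]

lemma norm_tupleEntries_of_unitary (hx : x ∈ unitaryTuples n N) :
    ‖tupleEntries x‖ = √(n * N) := by
  rw [← Real.sqrt_sq (norm_nonneg (tupleEntries x)), norm_tupleEntries_sq]
  simp [frobenius_norm_unitary (hx _)]

lemma sum_re_trace_mul_conjTranspose_le (x y : Tuple n N) :
    ∑ j, (x j * (y j)ᴴ).trace.re ≤ tensorNorm x y * N := by
  have hsum : ∑ j, (x j * (y j)ᴴ).trace.re = reTracePairing (sandwich y 1 1) x := by
    simp only [reTracePairing, sandwich, Matrix.one_mul, Matrix.mul_one]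
  rw [hsum]
  refine (reTracePairing_sandwich_le x y 1 1).trans_eq ?_
  rw [mul_assoc, frobenius_norm_one, Fintype.card_fin, Real.mul_self_sqrt N.cast_nonneg]

lemma sqrt_le_norm_tupleEntries_sub [NeZero N] (hx : x ∈ unitaryTuples n N)
    (hy : y ∈ unitaryTuples n N) (h : Separated δ x y) :
    √(2 * δ * (n * N)) ≤ ‖tupleEntries x - tupleEntries y‖ := by
  refine Real.sqrt_le_iff.2 ⟨norm_nonneg _, ?_⟩
  have hpair : ∑ j, (x j * (y j)ᴴ).trace.re ≤ (1 - δ) * n * N :=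
    (sum_re_trace_mul_conjTranspose_le x y).trans
      (mul_le_mul_of_nonneg_right ((separated_iff_of_unitary hx hy).1 h) N.cast_nonneg)
  have hnorm (j : Fin n) : ‖(x - y) j‖ ^ 2 = 2 * N - 2 * (x j * (y j)ᴴ).trace.re := by
    rw [Pi.sub_apply, frobenius_norm_sub_sq, frobenius_norm_unitary (hx j),
      frobenius_norm_unitary (hy j), Fintype.card_fin, Real.sq_sqrt N.cast_nonneg]
    ring
  have hsum : ‖tupleEntries x - tupleEntries y‖ ^ 2
      = 2 * (n * N) - 2 * ∑ j, (x j * (y j)ᴴ).trace.re := by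
    rw [← tupleEntries_sub, norm_tupleEntries_sq, Finset.sum_congr rfl fun j _ => hnorm j,
      Finset.sum_sub_distrib, Finset.mul_sum, Finset.sum_const, Finset.card_univ,
      Fintype.card_fin, nsmul_eq_mul]
    ring
  linarith

lemma two_mul_sqrt_div_sqrt {a : ℝ} (ha : 0 < a) (δ : ℝ) : 2 * √a / √(2 * δ * a) = √(2 / δ) := by
  have hnum : 2 * √a = √(2 * 2 * a) := by
    rw [Real.sqrt_mul (mul_self_nonneg 2), Real.sqrt_mul_self zero_le_two]
  rw [hnum, ← Real.sqrt_div (mul_nonneg (mul_self_nonneg 2) ha.le), mul_div_mul_right _ _ ha.ne',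
    mul_div_mul_left _ _ two_ne_zero]

lemma card_le_of_separatedFamily [NeZero n] [NeZero N] (hδ : 0 < δ) (t : Finset (Tuple n N))
    (ht : (t : Set (Tuple n N)) ⊆ unitaryTuples n N)
    (hs : SeparatedFamily δ (t : Set (Tuple n N))) :
    (t.card : ℝ) ≤ (1 + √(2 / δ)) ^ (2 * n * N ^ 2) := by
  classical
  have hnN : (0 : ℝ) < n * N :=
    mul_pos (by exact_mod_cast NeZero.pos n) (by exact_mod_cast NeZero.pos N)
  have hdim : finrank ℝ (EuclideanSpace ℂ (Fin n × Fin N × Fin N)) = 2 * n * N ^ 2 := by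
    simp only [finrank_real_euclideanSpace, Fintype.card_prod, Fintype.card_fin]
    ring
  have hpacking := card_le_of_separated_of_norm_le (t.image tupleEntries) (Real.sqrt_nonneg (n * N))
    (Real.sqrt_pos.2 (mul_pos (mul_pos two_pos hδ) hnN))
    (Finset.forall_mem_image.2 fun x hx => (norm_tupleEntries_of_unitary (ht hx)).le)
    (Finset.forall_mem_image.2 fun x hx => Finset.forall_mem_image.2 fun y hy hne =>
      sqrt_le_norm_tupleEntries_sub (ht hx) (ht hy) (hs hx hy (ne_of_apply_ne _ hne)))
  rwa [Finset.card_image_of_injective _ tupleEntries_injective, hdim,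
    two_mul_sqrt_div_sqrt hnN δ] at hpacking

lemma one_add_pow_le_exp (a : ℝ) (ha : 0 ≤ a) (k : ℕ) : (1 + a) ^ k ≤ Real.exp (k * a) := by
  rw [Real.exp_nat_mul, add_comm]
  exact pow_le_pow_left₀ (by positivity) (Real.add_one_le_exp a) k

lemma finite_and_ncard_le_of_separatedFamily [NeZero n] [NeZero N] (hδ : 0 < δ)
    {T : Set (Tuple n N)} (hT : T ⊆ unitaryTuples n N) (hs : SeparatedFamily δ T) :
    T.Finite ∧ (T.ncard : ℝ) ≤ (1 + √(2 / δ)) ^ (2 * n * N ^ 2) ∧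
      (T.ncard : ℝ) ≤ Real.exp (2 * √(2 / δ) * n * (N : ℝ) ^ 2) := by
  have hcard (t : Finset (Tuple n N)) (ht : (t : Set (Tuple n N)) ⊆ T) :
      (t.card : ℝ) ≤ (1 + √(2 / δ)) ^ (2 * n * N ^ 2) :=
    card_le_of_separatedFamily hδ t (ht.trans hT) (hs.mono ht)
  have hfin : T.Finite := by
    by_contra hinf
    obtain ⟨t, ht, htcard⟩ := Set.Infinite.exists_subset_card_eq hinf
      (⌊(1 + √(2 / δ)) ^ (2 * n * N ^ 2)⌋₊ + 1)
    exact (Nat.lt_of_floor_lt (by rw [htcard]; exact Nat.lt_succ_self _)).not_ge (hcard t ht)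
  have hncard : (T.ncard : ℝ) ≤ (1 + √(2 / δ)) ^ (2 * n * N ^ 2) := by
    rw [Set.ncard_eq_toFinset_card T hfin]
    exact hcard _ hfin.coe_toFinset.subset
  refine ⟨hfin, hncard, hncard.trans ?_⟩
  refine (one_add_pow_le_exp _ (Real.sqrt_nonneg _) _).trans_eq (congrArg _ ?_)
  push_cast
  ring

end UpperBound

section Probability

open ProbabilityTheory
open scoped Matrix.Norms.Frobenius

variable {n N : ℕ} {ε σ : ℝ} {v : Tuple n N}

lemma tracelessOp_eq_zero (x : Tuple n 1) : tracelessOp x = 0 := by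
  ext1 v
  obtain ⟨ξ, htrace, hξ⟩ := exists_tracelessProj_eq_entries v
  have hξ0 : ξ = 0 := by
    rw [Matrix.trace_fin_one] at htrace
    ext a b
    rwa [Subsingleton.elim a 0, Subsingleton.elim b 0]
  rw [tracelessOp, ContinuousLinearMap.comp_apply, hξ, hξ0, map_zero, map_zero, zero_apply]

lemma half_le_measure_expanders [NeZero n] [NeZero N] (hε : 0 < ε) (hn : 38400 / ε ≤ √n) :
    1 / 2 ≤ (haarUnitary n N).real (toTuple ⁻¹' expanders ε n N) := by
  have hn0 : (0 : ℝ) < n := by exact_mod_cast NeZero.pos n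
  have hcont : Continuous fun u : UnitaryTuple n N => ‖tracelessOp (toTuple u)‖ :=
    (continuous_tracelessOp.comp continuous_toTuple).norm
  have hmean : ∫ u, ‖tracelessOp (toTuple u : Tuple n N)‖ ∂haarUnitary n N ≤ 19200 * √n := by
    rcases (NeZero.one_le : 1 ≤ N).eq_or_lt with rfl | hN
    · simp only [tracelessOp_eq_zero, norm_zero, integral_zero]
      positivity
    · exact integral_haarUnitary_norm_tracelessOp_le hN
  let bad := {u : UnitaryTuple n N | ε * n ≤ ‖tracelessOp (toTuple u)‖}
  have hbad : (haarUnitary n N).real bad ≤ 1 / 2 := by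
    have hmarkov := (mul_meas_ge_le_integral_of_nonneg (.of_forall fun u => norm_nonneg _)
      (integrable_haarUnitary hcont) (ε * n)).trans hmean
    have hsqrt : 38400 * √n ≤ ε * n := by
      calc 38400 * √n ≤ √n * ε * √n :=
            mul_le_mul_of_nonneg_right ((div_le_iff₀ hε).1 hn) (Real.sqrt_nonneg _)
        _ = ε * (√n * √n) := by ring
        _ = ε * n := by rw [Real.mul_self_sqrt hn0.le]
    exact le_of_mul_le_mul_left (by linarith) (mul_pos hε hn0)
  have hgood : badᶜ ⊆ toTuple ⁻¹' expanders ε n N := fun u hu =>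
    mem_expanders_of_norm_tracelessOp_le (toTuple_mem u) (le_of_not_ge hu)
  have hcompl : (haarUnitary n N).real badᶜ = 1 - (haarUnitary n N).real bad :=
    probReal_compl_eq_one_sub (isClosed_le continuous_const hcont).measurableSet
  linarith [measureReal_mono (μ := haarUnitary n N) hgood]

lemma hasSubgaussianMGF_reTracePairing [NeZero N] {A : Tuple n N} {c : NNReal}
    (hA : ∑ j, ‖A j‖ ^ 2 ≤ N * c) :
    HasSubgaussianMGF (fun u => reTracePairing A (toTuple u)) c (haarUnitary n N) where
  integrable_exp_mul t := integrable_haarUnitary (Real.continuous_exp.comp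
    (continuous_const.mul ((continuous_reTracePairing A).comp continuous_toTuple)))
  mgf_le t := by
    have hN : (0 : ℝ) < N := by exact_mod_cast NeZero.pos N
    simp only [mgf, ← reTracePairing_smul]
    refine (integral_haarUnitary_exp_reTracePairing_le _).trans (Real.exp_le_exp.2 ?_)
    simp only [norm_smul, norm_real, mul_pow, Real.norm_eq_abs, sq_abs, ← Finset.mul_sum]
    calc t ^ 2 * (∑ j, ‖A j‖ ^ 2) / (2 * N) ≤ t ^ 2 * (N * c) / (2 * N) := by gcongr
      _ = c * t ^ 2 / 2 := by field_simp

lemma measure_le_reTracePairing_le [NeZero n] [NeZero N] (hσ : 0 < σ) {A : Tuple n N}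
    (hA : ∀ j, ‖A j‖ ≤ 1 / (σ * √N)) :
    (haarUnitary n N).real {u | σ * n / 4 ≤ reTracePairing A (toTuple u)}
      ≤ Real.exp (-(σ ^ 4 / 32 * (n * (N : ℝ) ^ 2))) := by
  have hn : (0 : ℝ) < n := by exact_mod_cast NeZero.pos n
  have hN : (0 : ℝ) < N := by exact_mod_cast NeZero.pos N
  let c : NNReal := ⟨n / (σ * N) ^ 2, by positivity⟩
  have hsum : ∑ j, ‖A j‖ ^ 2 ≤ N * c := by
    have hterm (j : Fin n) : ‖A j‖ ^ 2 ≤ 1 / (σ ^ 2 * N) :=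
      (pow_le_pow_left₀ (norm_nonneg _) (hA j) 2).trans_eq
        (by rw [div_pow, one_pow, mul_pow, Real.sq_sqrt hN.le])
    calc ∑ j, ‖A j‖ ^ 2 ≤ ∑ _j : Fin n, 1 / (σ ^ 2 * N) := Finset.sum_le_sum fun j _ => hterm j
      _ = n * (1 / (σ ^ 2 * N)) := by simp
      _ = N * (n / (σ * N) ^ 2) := by field_simp
  refine ((hasSubgaussianMGF_reTracePairing hsum).measure_ge_le (by positivity)).trans_eq
    (congrArg _ ?_)
  change -(σ * n / 4) ^ 2 / (2 * (n / (σ * N) ^ 2)) = _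
  field_simp
  norm_num

lemma exists_finset_matrix_net {A : Set (Mat N)} {θ : ℝ} (hθ : 0 < θ) (hA : ∀ ξ ∈ A, ‖ξ‖ ≤ 1) :
    ∃ t : Finset (Mat N), (t : Set (Mat N)) ⊆ A ∧ (t.card : ℝ) ≤ Real.exp (4 / θ * (N : ℝ) ^ 2) ∧
      ∀ ξ ∈ A, ∃ η ∈ t, ‖ξ - η‖ < θ := by
  obtain ⟨t, htA, htcard, htnet⟩ := exists_finset_net zero_le_one hθ hA
  refine ⟨t, htA, htcard.trans ?_, htnet⟩
  rw [mul_one, finrank_matrix, finrank_real_complex, Fintype.card_fin]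
  refine (one_add_pow_le_exp _ (by positivity) _).trans_eq (congrArg _ ?_)
  push_cast
  ring

lemma reTracePairing_sandwich_sub_le {u : Tuple n N} (hu : u ∈ unitaryTuples n N)
    (hv : v ∈ unitaryTuples n N) {ξ ξ' η η' : Mat N} (hη : ‖η‖ ≤ 1) (hξ' : ‖ξ'‖ ≤ 1) :
    reTracePairing (sandwich v ξ η) u - reTracePairing (sandwich v ξ' η') u
      ≤ n * (‖ξ - ξ'‖ + ‖η - η'‖) := by
  have hbound (X Y : Mat N) : reTracePairing (sandwich v X Y) u ≤ n * (‖X‖ * ‖Y‖) :=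
    (reTracePairing_sandwich_le u v X Y).trans <| by
      rw [mul_assoc]
      exact mul_le_mul_of_nonneg_right (tensorNorm_le_of_unitary hu hv) (by positivity)
  have hleft := reTracePairing_sandwich_add_left u v (ξ - ξ') ξ' η
  have hright := reTracePairing_sandwich_add_right u v ξ' (η - η') η'
  rw [sub_add_cancel] at hleft hright
  calc reTracePairing (sandwich v ξ η) u - reTracePairing (sandwich v ξ' η') u
      = reTracePairing (sandwich v (ξ - ξ') η) u + reTracePairing (sandwich v ξ' (η - η')) u := by
        linarith
    _ ≤ n * (‖ξ - ξ'‖ * ‖η‖) + n * (‖ξ'‖ * ‖η - η'‖) := add_le_add (hbound _ _) (hbound _ _)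
    _ ≤ n * ‖ξ - ξ'‖ + n * ‖η - η'‖ := by
        gcongr
        · exact mul_le_of_le_one_right (norm_nonneg _) hη
        · exact mul_le_of_le_one_left (norm_nonneg _) hξ'
    _ = n * (‖ξ - ξ'‖ + ‖η - η'‖) := by ring

lemma exists_preimage_correlated_subset (hσ : 0 < σ) (κ : ℝ) (hv : v ∈ unitaryTuples n N) :
    ∃ s : Finset (Mat N × Mat N), (s.card : ℝ) ≤ Real.exp (64 / σ * (N : ℝ) ^ 2) ∧
      (∀ p ∈ s, OpNormLE κ p.1 ∧ ‖p.2‖ ≤ 1) ∧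
      (toTuple ⁻¹' Correlated σ κ v : Set (UnitaryTuple n N))
        ⊆ ⋃ p ∈ s, {u | σ * n / 4 ≤ reTracePairing (sandwich v p.1 p.2) (toTuple u)} := by
  obtain ⟨s, hs, hscard, hsnet⟩ := exists_finset_matrix_net
    (A := {ξ : Mat N | OpNormLE κ ξ ∧ ‖ξ‖ ≤ 1}) (θ := σ / 8) (by positivity) fun ξ hξ => hξ.2
  obtain ⟨t, ht, htcard, htnet⟩ := exists_finset_matrix_net
    (A := {η : Mat N | ‖η‖ ≤ 1}) (θ := σ / 8) (by positivity) fun η hη => hη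
  refine ⟨s ×ˢ t, ?_, fun p hp => ?_, ?_⟩
  · rw [Finset.card_product, Nat.cast_mul]
    refine (mul_le_mul hscard htcard (Nat.cast_nonneg _) (Real.exp_nonneg _)).trans_eq ?_
    rw [← Real.exp_add]
    congr 1
    field_simp
    ring
  · rw [Finset.mem_product] at hp
    exact ⟨(hs hp.1).1, ht hp.2⟩
  · rintro u ⟨ξ, η, hξop, hξ, hη, hlt⟩
    obtain ⟨ξ', hξ's, hξ'⟩ := hsnet ξ ⟨hξop, hξ⟩
    obtain ⟨η', hη't, hη'⟩ := htnet η hη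
    refine Set.mem_biUnion (x := (ξ', η')) (Finset.mem_product.2 ⟨hξ's, hη't⟩) ?_
    have hdiff := reTracePairing_sandwich_sub_le (toTuple_mem u) hv (ξ := ξ) (η' := η') hη
      (hs hξ's).2
    have hsmall : (n : ℝ) * (‖ξ - ξ'‖ + ‖η - η'‖) ≤ n * (σ / 4) :=
      mul_le_mul_of_nonneg_left (by linarith) n.cast_nonneg
    change σ * n / 4 ≤ reTracePairing (sandwich v ξ' η') (toTuple u)
    linarith

lemma measure_correlated_le [NeZero n] [NeZero N] (hσ : 0 < σ) (hv : v ∈ unitaryTuples n N) :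
    (haarUnitary n N).real (toTuple ⁻¹' Correlated σ (1 / (σ * √N)) v)
      ≤ Real.exp (64 / σ * (N : ℝ) ^ 2 - σ ^ 4 / 32 * (n * (N : ℝ) ^ 2)) := by
  obtain ⟨s, hscard, hs, hcover⟩ := exists_preimage_correlated_subset hσ (1 / (σ * √N)) hv
  have htail (p : Mat N × Mat N) (hp : p ∈ s) : (haarUnitary n N).real
      {u | σ * n / 4 ≤ reTracePairing (sandwich v p.1 p.2) (toTuple u)}
      ≤ Real.exp (-(σ ^ 4 / 32 * (n * (N : ℝ) ^ 2))) := by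
    refine measure_le_reTracePairing_le hσ fun j => ?_
    rw [sandwich, Matrix.mul_assoc]
    refine ((hs p hp).1 _).trans ?_
    rw [frobenius_norm_unitary_mul (conjTranspose_mem_unitaryGroup (hv j))]
    exact mul_le_of_le_one_right (by positivity) (hs p hp).2
  calc (haarUnitary n N).real (toTuple ⁻¹' Correlated σ (1 / (σ * √N)) v)
      ≤ ∑ p ∈ s, (haarUnitary n N).real
          {u | σ * n / 4 ≤ reTracePairing (sandwich v p.1 p.2) (toTuple u)} :=
        (measureReal_mono hcover (measure_ne_top _ _)).trans (measureReal_biUnion_finset_le _ _)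
    _ ≤ s.card * Real.exp (-(σ ^ 4 / 32 * (n * (N : ℝ) ^ 2))) := by
        rw [← nsmul_eq_mul]
        exact Finset.sum_le_card_nsmul _ _ _ htail
    _ ≤ Real.exp (64 / σ * (N : ℝ) ^ 2) * Real.exp (-(σ ^ 4 / 32 * (n * (N : ℝ) ^ 2))) :=
        mul_le_mul_of_nonneg_right hscard (Real.exp_nonneg _)
    _ = Real.exp (64 / σ * (N : ℝ) ^ 2 - σ ^ 4 / 32 * (n * (N : ℝ) ^ 2)) := by
        rw [← Real.exp_add, sub_eq_add_neg]

end Probability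

section LowerBound

variable {n N : ℕ} {δ ε σ : ℝ}

lemma preimage_expanders_subset [NeZero n] [NeZero N] (hσ : 0 < σ) (hσ1 : σ < 1) (hε : 0 ≤ ε)
    (hεσ : ε ≤ σ / 4) {T : Finset (Tuple n N)} (hT : (T : Set (Tuple n N)) ⊆ expanders ε n N)
    (hmax : ∀ u ∈ expanders ε n N, u ∉ T → ∃ v ∈ T, ¬Separated (1 - σ) u v) :
    (toTuple ⁻¹' expanders ε n N : Set (UnitaryTuple n N))
      ⊆ ⋃ v ∈ T, toTuple ⁻¹' Correlated σ (1 / (σ * √N)) v := by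
  intro u hu
  have hn : (0 : ℝ) < n := by exact_mod_cast NeZero.pos n
  have hlarge : ∃ v ∈ T, σ * n < tensorNorm (toTuple u) v := by
    by_cases huT : toTuple u ∈ T
    · refine ⟨toTuple u, huT, ?_⟩
      rw [tensorNorm_self_of_unitary hu.1]
      exact mul_lt_of_lt_one_left hn hσ1
    · obtain ⟨v, hvT, hsep⟩ := hmax _ hu huT
      rw [separated_iff_of_unitary hu.1 (hT hvT).1, sub_sub_cancel, not_le] at hsep
      exact ⟨v, hvT, hsep⟩
  obtain ⟨v, hvT, hlt⟩ := hlarge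
  refine Set.mem_biUnion hvT (by_contra fun hcorr => ?_)
  exact (tensorNorm_le_of_not_correlated hσ hε hεσ hu (hT hvT) hcorr).not_gt hlt

lemma separated_symm (δ : ℝ) : Std.Symm (Separated δ : Tuple n N → Tuple n N → Prop) where
  symm x y h := by rwa [Separated, tensorNorm_comm, mul_comm (√(tensorNorm y y))]

lemma exp_le_of_half_le_mul_exp {c x : ℝ} (hx : 1 ≤ x) (h : 1 / 2 ≤ c * Real.exp (-(2 * x))) :
    Real.exp x ≤ c := by
  rw [Real.exp_neg, ← div_eq_mul_inv, le_div_iff₀ (Real.exp_pos _), two_mul, Real.exp_add] at h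
  have htwo : 2 ≤ Real.exp x := by linarith [Real.add_one_le_exp x]
  calc Real.exp x = 1 / 2 * (2 * Real.exp x) := by ring
    _ ≤ 1 / 2 * (Real.exp x * Real.exp x) := by gcongr
    _ ≤ c := h

lemma exp_le_of_half_le_mul_exp_sub [NeZero N] {c : ℝ} (hc : 0 ≤ c) (hσ : 0 < σ) (hσ1 : σ < 1)
    (hn : 4096 / σ ^ 5 ≤ n)
    (h : 1 / 2 ≤ c * Real.exp (64 / σ * (N : ℝ) ^ 2 - σ ^ 4 / 32 * (n * (N : ℝ) ^ 2))) :
    Real.exp (σ ^ 4 / 128 * n * (N : ℝ) ^ 2) ≤ c := by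
  have hN : (1 : ℝ) ≤ (N : ℝ) ^ 2 := one_le_pow₀ (by exact_mod_cast NeZero.one_le)
  have hx : 32 / σ * (N : ℝ) ^ 2 ≤ σ ^ 4 / 128 * n * (N : ℝ) ^ 2 := by
    refine mul_le_mul_of_nonneg_right ?_ (sq_nonneg _)
    calc 32 / σ = σ ^ 4 / 128 * (4096 / σ ^ 5) := by field_simp; norm_num
      _ ≤ σ ^ 4 / 128 * n := by gcongr
  have hone : 1 ≤ 32 / σ * (N : ℝ) ^ 2 :=
    one_le_mul_of_one_le_of_one_le ((one_le_div₀ hσ).2 (by linarith)) hN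
  refine exp_le_of_half_le_mul_exp (hone.trans hx) (h.trans ?_)
  refine mul_le_mul_of_nonneg_left (Real.exp_le_exp.2 ?_) hc
  have hsplit : 64 / σ * (N : ℝ) ^ 2 = 2 * (32 / σ * (N : ℝ) ^ 2) := by ring
  linarith

lemma exists_separated_expanders [NeZero n] [NeZero N] (hσ : 0 < σ) (hσ1 : σ < 1) (hε : 0 < ε)
    (hεσ : ε ≤ σ / 4) (hnσ : 4096 / σ ^ 5 ≤ n) (hnε : 38400 / ε ≤ √n) :
    ∃ T : Finset (Tuple n N), (T : Set (Tuple n N)) ⊆ expanders ε n N ∧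
      SeparatedFamily (1 - σ) (T : Set (Tuple n N)) ∧
      Real.exp (σ ^ 4 / 128 * n * (N : ℝ) ^ 2) ≤ T.card := by
  have := separated_symm (n := n) (N := N) (1 - σ)
  obtain ⟨T, hT, hsep, hmax⟩ := exists_maximal_pairwise (r := Separated (1 - σ))
    (A := expanders ε n N) fun t ht hs => Nat.le_floor
      (card_le_of_separatedFamily (sub_pos.2 hσ1) t (fun x hx => (ht hx).1) hs)
  refine ⟨T, hT, hsep, exp_le_of_half_le_mul_exp_sub (Nat.cast_nonneg _) hσ hσ1 hnσ ?_⟩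
  calc (1 : ℝ) / 2 ≤ (haarUnitary n N).real (toTuple ⁻¹' expanders ε n N) :=
        half_le_measure_expanders hε hnε
    _ ≤ ∑ v ∈ T, (haarUnitary n N).real (toTuple ⁻¹' Correlated σ (1 / (σ * √N)) v) :=
        (measureReal_mono (preimage_expanders_subset hσ hσ1 hε.le hεσ hT hmax)
          (measure_ne_top _ _)).trans (measureReal_biUnion_finset_le _ _)
    _ ≤ T.card * Real.exp (64 / σ * (N : ℝ) ^ 2 - σ ^ 4 / 32 * (n * (N : ℝ) ^ 2)) := by
        rw [← nsmul_eq_mul]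
        exact Finset.sum_le_card_nsmul _ _ _ fun v hv => measure_correlated_le hσ (hT hv).1

lemma exists_threshold_separated_expanders (hδ : 0 < δ) (hδ1 : δ < 1) (hε : 0 < ε) :
    ∃ n₀ : ℕ, ∀ n : ℕ, n₀ ≤ n → ∀ N : ℕ, 1 ≤ N →
      ∃ T : Finset (Tuple n N), (T : Set (Tuple n N)) ⊆ expanders ε n N ∧
        SeparatedFamily δ (T : Set (Tuple n N)) ∧
        Real.exp ((1 - δ) ^ 4 / 128 * n * (N : ℝ) ^ 2) ≤ (T.card : ℝ) := by
  have hσ : 0 < 1 - δ := sub_pos.2 hδ1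
  let ε' := min ε ((1 - δ) / 4)
  have hε' : 0 < ε' := lt_min hε (by positivity)
  refine ⟨max 1 (max ⌈4096 / (1 - δ) ^ 5⌉₊ ⌈(38400 / ε') ^ 2⌉₊), fun n hn N hN => ?_⟩
  simp only [max_le_iff, Nat.ceil_le] at hn
  obtain ⟨hn1, hnδ, hnε⟩ := hn
  have : NeZero n := ⟨Nat.one_le_iff_ne_zero.1 hn1⟩
  have : NeZero N := ⟨Nat.one_le_iff_ne_zero.1 hN⟩
  obtain ⟨T, hT, hsep, hcard⟩ := exists_separated_expanders (N := N) hσ (sub_lt_self 1 hδ) hε'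
    (min_le_right _ _) hnδ (Real.le_sqrt_of_sq_le hnε)
  rw [sub_sub_cancel] at hsep
  exact ⟨T, hT.trans (expanders_mono (min_le_left _ _)), hsep, hcard⟩

end LowerBound

end QExp
end

theorem mainTheorem1 :
    (∀ δ : ℝ, 0 < δ → δ < 1 → ∃ β : ℝ, 0 < β ∧
      ∀ ε : ℝ, 0 < ε → ε < 1 → ∃ n₀ : ℕ, ∀ n : ℕ, n₀ ≤ n → ∀ N : ℕ, 1 ≤ N →
        ∃ T : Finset (QExp.Tuple n N),
          (T : Set (QExp.Tuple n N)) ⊆ QExp.expanders ε n N ∧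
          QExp.SeparatedFamily δ (T : Set (QExp.Tuple n N)) ∧
          Real.exp (β * n * (N : ℝ) ^ 2) ≤ (T.card : ℝ)) ∧
    (∀ δ : ℝ, 0 < δ → δ < 1 → ∀ n N : ℕ, 1 ≤ n → 1 ≤ N →
      ∀ T : Set (QExp.Tuple n N), T ⊆ QExp.unitaryTuples n N → QExp.SeparatedFamily δ T →
        T.Finite ∧
        (T.ncard : ℝ) ≤ (1 + Real.sqrt (2 / δ)) ^ (2 * n * N ^ 2) ∧
        (T.ncard : ℝ) ≤ Real.exp (2 * Real.sqrt (2 / δ) * n * (N : ℝ) ^ 2)) := by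
  refine ⟨fun δ hδ hδ1 => ⟨(1 - δ) ^ 4 / 128, div_pos (pow_pos (sub_pos.2 hδ1) 4) (by norm_num),
    fun ε hε _ => QExp.exists_threshold_separated_expanders hδ hδ1 hε⟩,
    fun δ hδ _ n N hn hN T hT hsep => ?_⟩
  have : NeZero n := ⟨Nat.one_le_iff_ne_zero.1 hn⟩
  have : NeZero N := ⟨Nat.one_le_iff_ne_zero.1 hN⟩
  exact QExp.finite_and_ncard_le_of_separatedFamily hδ hT hsep
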